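/- All graphs are finite and simple. A cograph is a graph without an induced path on four vertices. For a graph $G=(V,E)$ and a set $S$ of unordered pairs of distinct vertices, the edit of $G$ by $S$ is $(V,E\,\triangle\,S)$. Cograph edge editing asks, given $G$ and an integer $k\ge 0$, whether some edit of $G$ by at most $k$ pairs is a cograph; if so, $(G,k)$ is a positive instance. Definitions. A set $X\subseteq V$ is a module of $G$ if all its vertices have the same neighbourhood in $V\setminus X$. A comodule is a connected component of $G$ or of its complement $\overline G$. A $t$-module is a set that becomes a module after editing at most $t$ pairs of $G$. A nested $t$-module of $(G,k)$ is a partition of $V$ into five nonempty sets $A,B,C,K,I$ such that $A$, $A\cup B$, $A\cup B\cup C$ are $t$-modules, $|A|>k+t$, and each of the following four sets has at least $3t+1$ elements: $B_\oplus$, the vertices of $B$ adjacent to all of $A\cup K$ and to none of $I$; $B_+$, the vertices of $B$ adjacent to all of $K$ and to none of $A\cup I$; $C_\oplus$, the vertices of $C$ adjacent to all of $A\cup B\cup K$ and to none of $I$; $C_+$, the vertices of $C$ adjacent to all of $K$ and to none of $A\cup B\cup I$. The instance $(G,k)$ is reduced if none of the following four rules applies: 1. (comodule rule) some comodule of $G$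 induces a cograph (remove it); 2. (module reduction rule) some module of $G$ with more than $k+1$ vertices is an independent set (shrink it to $k+1$ vertices); 3. (module extraction rule) some module $X$ of $G$ that contains an edge is neither a union of connected components of $G$ nor a union of connected components of $\overline G$ (add a disjoint copy of $G[X]$ and replace the original by an independent set of size $|X|$); 4. (nested $t$-module rule) for some $t\ge 0$ there is a nested $t$-module $A,B,C,K,I$ with an edge between $A$ and $I$ or a non-edge between $A$ and $K$ (edit all these pairs). Statement. (a) Cograph edge editing, parameterized by $k$, has a polynomial-time kernel with $O(k^2\log k)$ vertices: there are a function $f:\mathbb N\to\mathbb N$ with $f(k)=O(k^2\log k)$ and $f(k)\le 409\,k^2(1+\log_2 2k)$ for all $k\ge 1$, and an algorithm that transforms every graph $G$ on $n$ vertices and every integer $k\ge 0$, in time polynomial in $n$, into a graph $G'$ with at most $f(k)$ vertices such that $(G,k)$ is a positive instance if and only if $(G',k)$ is. (Time is the number of steps of a random access machine on natural numbers whose only arithmetic operations are addition and truncated subtraction; the input is $n$, $k$ and the adjacency matrix of $G$.) (b) If $k\ge 559$ and $(G,k)$ is a reduced positive instance, then $G$ has at most $409\,k^2(1+\log_2 2k)$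 vertices. -/

import Mathlib

/-! ### Cographs, edits, and the editing problem -/

/-- A cograph is a graph without an induced path on four vertices. -/
def IsCograph {V : Type*} (G : SimpleGraph V) : Prop :=
  IsEmpty (SimpleGraph.pathGraph 4 ↪g G)

/-- The edit of `G` by a set `S` of pairs of vertices: the graph with edge set `E(G) ∆ S`. -/
def editBy {V : Type*} (G : SimpleGraph V) (S : Finset (Sym2 V)) : SimpleGraph V :=
  SimpleGraph.fromEdgeSet (symmDiff G.edgeSet (S : Set (Sym2 V)))

/-- `(G, k)` is a positive instance of cograph edge editing: changing the adjacency of at most `k`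
unordered pairs of distinct vertices turns `G` into a cograph. -/
def CographEditable {V : Type*} (G : SimpleGraph V) (k : ℕ) : Prop :=
  ∃ S : Finset (Sym2 V), (∀ e ∈ S, ¬ e.IsDiag) ∧ S.card ≤ k ∧ IsCograph (editBy G S)

/-! ### Modules, comodules, and the four reduction rules -/

/-- All vertices of `X` have the same neighbourhood outside `X`. -/
def IsModule {V : Type*} (G : SimpleGraph V) (X : Set V) : Prop :=
  ∀ x ∈ X, ∀ y ∈ X, ∀ z ∉ X, (G.Adj x z ↔ G.Adj y z)

/-- A comodule is a connected component of the graph or of its complement. -/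
def IsComodule {V : Type*} (G : SimpleGraph V) (M : Set V) : Prop :=
  (∃ c : G.ConnectedComponent, M = c.supp) ∨ (∃ c : Gᶜ.ConnectedComponent, M = c.supp)

/-- `X` is a union of connected components of `G`. -/
def IsUnionOfComponents {V : Type*} (G : SimpleGraph V) (X : Set V) : Prop :=
  ∃ 𝒞 : Set G.ConnectedComponent, X = ⋃ c ∈ 𝒞, c.supp

/-- A `t`-module: a set that becomes a module after editing at most `t` pairs. -/
def IsTModule {V : Type*} (G : SimpleGraph V) (t : ℕ) (X : Set V) : Prop :=
  ∃ T : Finset (Sym2 V), (∀ e ∈ T, ¬ e.IsDiag) ∧ T.card ≤ t ∧ IsModule (editBy G T) X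

/-- The vertices of `B` that are joined to all of `N` and to nothing in `O`. -/
def joinedTo {V : Type*} (G : SimpleGraph V) (B N O : Set V) : Set V :=
  {b ∈ B | (∀ v ∈ N, G.Adj b v) ∧ (∀ v ∈ O, ¬ G.Adj b v)}

/-- A nested `t`-module `(A, B, C, K, I)` of the instance `(G, k)`. -/
structure IsNestedTModule {V : Type*} (G : SimpleGraph V) (k t : ℕ) (A B C K I : Set V) :
    Prop where
  nonempty : A.Nonempty ∧ B.Nonempty ∧ C.Nonempty ∧ K.Nonempty ∧ I.Nonempty
  disjoint : [A, B, C, K, I].Pairwise Disjoint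
  cover : A ∪ B ∪ C ∪ K ∪ I = Set.univ
  tmodule_A : IsTModule G t A
  tmodule_AB : IsTModule G t (A ∪ B)
  tmodule_ABC : IsTModule G t (A ∪ B ∪ C)
  card_A : k + t < A.ncard
  card_B_oplus : 3 * t + 1 ≤ (joinedTo G B (A ∪ K) I).ncard
  card_B_plus : 3 * t + 1 ≤ (joinedTo G B K (A ∪ I)).ncard
  card_C_oplus : 3 * t + 1 ≤ (joinedTo G C (A ∪ B ∪ K) I).ncard
  card_C_plus : 3 * t + 1 ≤ (joinedTo G C K (A ∪ B ∪ I)).ncard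

/-- Some comodule induces a cograph (and can be removed). -/
def ComoduleRuleApplies {V : Type*} (G : SimpleGraph V) : Prop :=
  ∃ M : Set V, IsComodule G M ∧ IsCograph (G.induce M)

/-- Some independent module has more than `k + 1` vertices (and can be shrunk to `k + 1`). -/
def ModuleReductionRuleApplies {V : Type*} (G : SimpleGraph V) (k : ℕ) : Prop :=
  ∃ M : Set V, IsModule G M ∧ (∀ x ∈ M, ∀ y ∈ M, ¬ G.Adj x y) ∧ k + 1 < M.ncard

/-- Some module that contains an edge is neither a union of connected components of `G` nor a union
of connected components of the complement (and can be extracted). In particular such a module is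
not a comodule. -/
def ModuleExtractionRuleApplies {V : Type*} (G : SimpleGraph V) : Prop :=
  ∃ X : Set V, IsModule G X ∧ (∃ x ∈ X, ∃ y ∈ X, G.Adj x y) ∧
    ¬ IsUnionOfComponents G X ∧ ¬ IsUnionOfComponents Gᶜ X

/-- Some nested `t`-module has an edge between `A` and `I` or a non-edge between `A` and `K`
(and these pairs can be edited). -/
def NestedModuleRuleApplies {V : Type*} (G : SimpleGraph V) (k : ℕ) : Prop :=
  ∃ (t : ℕ) (A B C K I : Set V), IsNestedTModule G k t A B C K I ∧
    ((∃ a ∈ A, ∃ i ∈ I, G.Adj a i) ∨ (∃ a ∈ A, ∃ x ∈ K, ¬ G.Adj a x))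

/-- None of the four reduction rules applies to `(G, k)`. -/
def IsReducedInstance {V : Type*} (G : SimpleGraph V) (k : ℕ) : Prop :=
  ¬ ComoduleRuleApplies G ∧ ¬ ModuleReductionRuleApplies G k ∧
    ¬ ModuleExtractionRuleApplies G ∧ ¬ NestedModuleRuleApplies G k

/-! ### Random access machines

Structured programs for a random access machine with step counting. The memory consists of
registers `reg r` and of two-dimensional arrays `arr a`, all holding natural numbers. A program
names its registers and arrays by constants, and addresses the cells of an array by the contents of
registers. Every instruction and every test costs one step. The only arithmetic is addition and
truncated subtraction, so a step lengthens the largest number in memory by at most one bit, and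
polynomial time in this model is polynomial time on Turing machines. -/

namespace RAM

/-- The contents of the memory. -/
structure Store where
  reg : ℕ → ℕ
  arr : ℕ → ℕ → ℕ → ℕ

/-- Replace the content of register `d` by `v`. -/
def Store.setReg (σ : Store) (d v : ℕ) : Store where
  reg := fun r => if r = d then v else σ.reg r
  arr := σ.arr

/-- Replace the content of cell `(i, j)` of array `a` by `v`. -/
def Store.setArr (σ : Store) (a i j v : ℕ) : Store where
  reg := σ.reg
  arr := fun a' i' j' => if a' = a ∧ i' = i ∧ j' = j then v else σ.arr a' i' j'

/-- Programs. -/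
inductive Prog where
  /-- Do nothing. -/
  | skip : Prog
  /-- `reg d := c`. -/
  | const (d c : ℕ) : Prog
  /-- `reg d := reg x + reg y`. -/
  | add (d x y : ℕ) : Prog
  /-- `reg d := reg x - reg y` (truncated at zero). -/
  | sub (d x y : ℕ) : Prog
  /-- `reg d := arr a (reg i) (reg j)`. -/
  | load (d a i j : ℕ) : Prog
  /-- `arr a (reg i) (reg j) := reg s`. -/
  | store (a i j s : ℕ) : Prog
  /-- First `p`, then `q`. -/
  | seq (p q : Prog) : Prog
  /-- If `reg x < reg y` then `p`, else `q`. -/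
  | ite (x y : ℕ) (p q : Prog) : Prog
  /-- While `reg x < reg y`, do `p`. -/
  | while (x y : ℕ) (p : Prog) : Prog

/-- `Runs p σ t τ`: started on the memory `σ`, the program `p` halts after exactly `t` steps with
the memory `τ`. -/
inductive Runs : Prog → Store → ℕ → Store → Prop where
  | skip (σ : Store) : Runs Prog.skip σ 1 σ
  | const (σ : Store) (d c : ℕ) : Runs (Prog.const d c) σ 1 (σ.setReg d c)
  | add (σ : Store) (d x y : ℕ) :
      Runs (Prog.add d x y) σ 1 (σ.setReg d (σ.reg x + σ.reg y))
  | sub (σ : Store) (d x y : ℕ) :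
      Runs (Prog.sub d x y) σ 1 (σ.setReg d (σ.reg x - σ.reg y))
  | load (σ : Store) (d a i j : ℕ) :
      Runs (Prog.load d a i j) σ 1 (σ.setReg d (σ.arr a (σ.reg i) (σ.reg j)))
  | store (σ : Store) (a i j s : ℕ) :
      Runs (Prog.store a i j s) σ 1 (σ.setArr a (σ.reg i) (σ.reg j) (σ.reg s))
  | seq {p q : Prog} {σ τ υ : Store} {t u : ℕ} :
      Runs p σ t τ → Runs q τ u υ → Runs (Prog.seq p q) σ (t + u) υ
  | ite_true {x y : ℕ} {p q : Prog} {σ τ : Store} {t : ℕ} :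
      σ.reg x < σ.reg y → Runs p σ t τ → Runs (Prog.ite x y p q) σ (t + 1) τ
  | ite_false {x y : ℕ} {p q : Prog} {σ τ : Store} {t : ℕ} :
      ¬ σ.reg x < σ.reg y → Runs q σ t τ → Runs (Prog.ite x y p q) σ (t + 1) τ
  | while_true {x y : ℕ} {p : Prog} {σ τ υ : Store} {t u : ℕ} :
      σ.reg x < σ.reg y → Runs p σ t τ → Runs (Prog.while x y p) τ u υ →
        Runs (Prog.while x y p) σ (t + u + 1) υ
  | while_false {x y : ℕ} {p : Prog} {σ : Store} :
      ¬ σ.reg x < σ.reg y → Runs (Prog.while x y p) σ 1 σ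

open Classical in
/-- The input memory for a graph `G` on `n` vertices and a parameter `k`: `n` in register `0`, `k`
in register `1`, the adjacency matrix of `G` in array `0`, and zeros everywhere else. -/
noncomputable def inputStore {n : ℕ} (G : SimpleGraph (Fin n)) (k : ℕ) : Store where
  reg := fun r => if r = 0 then n else if r = 1 then k else 0
  arr := fun a i j =>
    if a = 0 ∧ ∃ (hi : i < n) (hj : j < n), G.Adj ⟨i, hi⟩ ⟨j, hj⟩ then 1 else 0

open Classical in
/-- The memory holds the instance `(G, k)` with `G` on `m` vertices as its output. -/
def IsOutput (τ : Store) {m : ℕ} (G : SimpleGraph (Fin m)) (k : ℕ) : Prop :=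
  τ.reg 0 = m ∧ τ.reg 1 = k ∧
    ∀ i j : Fin m, τ.arr 0 (i : ℕ) (j : ℕ) = if G.Adj i j then 1 else 0

end RAM

/-- Cograph edge editing, parameterized by the number `k` of edits, has a polynomial-time kernel
with at most `f k` vertices: a program that turns every graph `G` and every `k`, in time polynomial
in the number `n` of vertices of `G`, into a graph `G'` with at most `f k` vertices such that
`(G, k)` and `(G', k)` are equivalent instances. -/
def HasCographEditingKernel (f : ℕ → ℕ) : Prop :=
  ∃ (P : RAM.Prog) (T : Polynomial ℕ), ∀ (n : ℕ) (G : SimpleGraph (Fin n)) (k : ℕ),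
    ∃ (t : ℕ) (τ : RAM.Store) (m : ℕ) (G' : SimpleGraph (Fin m)),
      RAM.Runs P (RAM.inputStore G k) t τ ∧ t ≤ T.eval n ∧ RAM.IsOutput τ G' k ∧
        m ≤ f k ∧ (CographEditable G k ↔ CographEditable G' k)

/-! Edits are counted as ordered pairs, so a solution is a cograph `H` with at most `2 * k` pairs in
`diff G H`. Three ideas carry the proof.

Substitution. A path on four vertices has no nontrivial module, so a cograph stays a cograph when a
set `X` is made a module whose vertices all see the outside as one chosen `r ∈ X` does
(`substAt_P4Free`). If `X` is a module of `G` and `r` is chosen with few or no edits leaving `X`,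
the cost does not grow. This makes the removal of twins, the replacement of cograph modules and the
extraction of modules safe. For a set with at most `t` defects and more than `k + t` vertices it
shows that an optimal solution edits at most `t` pairs leaving the set
(`ncard_cross_le_of_optimal`). With three nested sets of this kind the two layers contain vertices
that avoid the relevant edits, and forbidden paths through them determine the adjacency of the
innermost set to the outside of the outermost one (`Nested.adj_iff_of_optimal`). A pair that
contradicts it is edited in every optimal solution.

Size. Fix a solution `H` and the set `F` of at most `2 * k` vertices that it touches. Descend
through the decomposition of `H` into unions and joins. Parts that avoid `F` are modules of `G`
inducing cographs; by irreducibility they are independent and have at most `k + 1` vertices.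
Branchings into parts that both meet `F` are paid for by `|F|`. What remains are rungs: a step that
removes an untouched part `X` and then an untouched part `Y`, leaving `L`. With `u ∈ Y` and `w ∈ X`,
the set `L` is `N(u) \ N(w)`, so the rungs are described by pairs of vertices (`exists_rungs`). A
rung is too large to be a module of `G`, hence some edit crosses it. The rungs crossed by one fixed
edit form a chain, and more than `6 * s + 2` of them with at most `s` crossing edits each would make
up a nested `s`-module to which the rule applies (`card_rungs_le`). If every rung spreads weight one
evenly over its crossing edits, each edit receives at most `8 * harmonic k`, so there are `O(k log
k)` rungs (`card_rungs_le_divisorSum`), and each accounts for at most `2 * (k + 1)` vertices.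

Algorithm. The bound uses irreducibility only for twin classes, for pairs of twin classes, and for
sets of the form `N(u) \ N(w)`. Hence it suffices to try rules indexed by boundedly many vertices.
Their conditions and effects are written as arithmetic expressions with bounded sums, which are
compiled once and for all into programs with polynomial time bounds. A potential decreases with
every application. At the end, disjoint paths on four vertices raise the parameter back to its
original value, and an irreducible instance that exceeds the bound is replaced by a negative
instance made of such paths. -/

namespace CographKernel

/-! ### Cographs, differences of graphs, and substitution -/

/-- `X` contains no induced path on four vertices. -/
def P4FreeOn {V : Type*} (G : SimpleGraph V) (X : Set V) : Prop :=
  ∀ a ∈ X, ∀ b ∈ X, ∀ c ∈ X, ∀ d ∈ X, G.Adj a b → G.Adj b c → G.Adj c d →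
    G.Adj a c ∨ G.Adj a d ∨ G.Adj b d

/-- A graph without an induced path on four vertices, in terms of adjacencies. -/
def P4Free {V : Type*} (G : SimpleGraph V) : Prop :=
  ∀ a b c d, G.Adj a b → G.Adj b c → G.Adj c d → G.Adj a c ∨ G.Adj a d ∨ G.Adj b d

/-- Distinctness of the four vertices need not be required: if two non-consecutive ones coincided,
an edge of the path would be one of the forbidden chords. -/
theorem isCograph_iff_P4Free {V : Type*} (G : SimpleGraph V) : IsCograph G ↔ P4Free G := by
  constructor
  · intro h a b c d hab hbc hcd
    by_contra! hn
    obtain ⟨hac, had, hbd⟩ := hn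
    have e1 : a ≠ c := by rintro rfl; exact had hcd
    have e2 : a ≠ d := by rintro rfl; exact hbd hab.symm
    have e3 : b ≠ d := by rintro rfl; exact had hab
    refine h.false ⟨⟨![a, b, c, d], ?_⟩, ?_⟩
    · have := hab.ne
      have := hbc.ne
      have := hcd.ne
      intro i j hij
      fin_cases i <;> fin_cases j <;> simp_all
    · intro i j
      have hba := hab.symm
      have hcb := hbc.symm
      have hdc := hcd.symm
      have hca : ¬ G.Adj c a := fun e => hac e.symm
      have hda : ¬ G.Adj d a := fun e => had e.symm
      have hdb : ¬ G.Adj d b := fun e => hbd e.symm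
      rw [SimpleGraph.pathGraph_adj]
      change G.Adj (![a, b, c, d] i) (![a, b, c, d] j) ↔ _
      fin_cases i <;> fin_cases j <;> simp_all
  · rintro h
    refine ⟨fun f => ?_⟩
    have key : ∀ i j : Fin 4, G.Adj (f i) (f j) ↔ ((i : ℕ) + 1 = j ∨ (j : ℕ) + 1 = i) := by
      intro i j
      rw [← SimpleGraph.pathGraph_adj]
      exact f.map_rel_iff
    have := h (f 0) (f 1) (f 2) (f 3) ((key _ _).2 (by simp)) ((key _ _).2 (by simp))
      ((key _ _).2 (by simp))
    simp [key] at this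

theorem P4Free.on {V : Type*} {G : SimpleGraph V} (h : P4Free G) (X : Set V) : P4FreeOn G X :=
  fun a _ b _ c _ d _ => h a b c d

theorem P4FreeOn.mono {V : Type*} {G : SimpleGraph V} {X Y : Set V} (h : P4FreeOn G Y)
    (hXY : X ⊆ Y) : P4FreeOn G X :=
  fun a ha b hb c hc d hd => h a (hXY ha) b (hXY hb) c (hXY hc) d (hXY hd)

theorem P4FreeOn.congr {V : Type*} {G H : SimpleGraph V} {X : Set V} (h : P4FreeOn G X)
    (e : ∀ a ∈ X, ∀ b ∈ X, (H.Adj a b ↔ G.Adj a b)) : P4FreeOn H X := by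
  intro a ha b hb c hc d hd
  rw [e a ha b hb, e b hb c hc, e c hc d hd, e a ha c hc, e a ha d hd, e b hb d hd]
  exact h a ha b hb c hc d hd

theorem P4FreeOn.of_map {V W : Type*} {G : SimpleGraph V} {H : SimpleGraph W} {X : Set V}
    (φ : V → W) (h : P4Free H) (e : ∀ a ∈ X, ∀ b ∈ X, (G.Adj a b ↔ H.Adj (φ a) (φ b))) :
    P4FreeOn G X := by
  intro a ha b hb c hc d hd
  rw [e a ha b hb, e b hb c hc, e c hc d hd, e a ha c hc, e a ha d hd, e b hb d hd]
  exact h _ _ _ _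

theorem P4Free.comap {V W : Type*} {H : SimpleGraph W} (φ : V → W) (h : P4Free H) :
    P4Free (H.comap φ) :=
  fun _ _ _ _ => h _ _ _ _

theorem isCograph_induce_iff {V : Type*} (G : SimpleGraph V) (X : Set V) :
    IsCograph (G.induce X) ↔ P4FreeOn G X := by
  rw [isCograph_iff_P4Free]
  constructor
  · intro h a ha b hb c hc d hd
    exact h ⟨a, ha⟩ ⟨b, hb⟩ ⟨c, hc⟩ ⟨d, hd⟩
  · intro h a b c d
    exact h a a.2 b b.2 c c.2 d d.2

/-- A graph is a cograph if its two sides are and no edge joins them. -/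
theorem P4Free.of_separated {V : Type*} {G : SimpleGraph V} (X : Set V)
    (hX : ∀ a b, G.Adj a b → (a ∈ X ↔ b ∈ X)) (h₁ : P4FreeOn G X) (h₂ : P4FreeOn G Xᶜ) :
    P4Free G := by
  intro a b c d hab hbc hcd
  by_cases ha : a ∈ X
  · have hb := (hX _ _ hab).1 ha
    have hc := (hX _ _ hbc).1 hb
    exact h₁ a ha b hb c hc d ((hX _ _ hcd).1 hc) hab hbc hcd
  · have hb := fun e => ha ((hX _ _ hab).2 e)
    have hc := fun e => hb ((hX _ _ hbc).2 e)
    exact h₂ a ha b hb c hc d (fun e => hc ((hX _ _ hcd).2 e)) hab hbc hcd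

/-- Substituting a cograph for a vertex of a cograph yields a cograph. -/
theorem P4Free.of_isModule {V : Type*} {G : SimpleGraph V} {X : Set V} (hX : IsModule G X)
    {r : V} (hr : r ∈ X) (h₁ : P4FreeOn G X) (h₂ : P4FreeOn G (insert r Xᶜ)) : P4Free G := by
  have hm : ∀ p q z, p ∈ X → q ∈ X → z ∉ X → G.Adj p z → G.Adj q z :=
    fun p q z hp hq hz h => (hX p hp q hq z hz).1 h
  have hm' : ∀ p q z, p ∈ X → q ∈ X → z ∉ X → G.Adj z p → G.Adj z q :=
    fun p q z hp hq hz h => (hm p q z hp hq hz h.symm).symm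
  have hi : ∀ z, z ∉ X → z ∈ insert r Xᶜ := fun z hz => Or.inr hz
  have hri : r ∈ insert r Xᶜ := Or.inl rfl
  intro a b c d hab hbc hcd
  by_contra! hn
  obtain ⟨hac, had, hbd⟩ := hn
  -- With two or three of the vertices in `X`, the module property turns an edge of the path into a
  -- chord. With exactly one in `X`, that vertex can be replaced by `r`. The other two cases lie
  -- inside `X` or outside it.
  by_cases ha : a ∈ X <;> by_cases hb : b ∈ X <;> by_cases hc : c ∈ X <;> by_cases hd : d ∈ X
  · exact (h₁ a ha b hb c hc d hd hab hbc hcd).elim hac (fun h => h.elim had hbd)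
  · exact had (hm c a d hc ha hd hcd)
  · exact hac (hm b a c hb ha hc hbc)
  · exact hac (hm b a c hb ha hc hbc)
  · exact hbd (hm' a d b ha hd hb hab.symm).symm.symm
  · exact had (hm c a d hc ha hd hcd)
  · exact hbd (hm' a d b ha hd hb hab.symm)
  · rcases h₂ r hri b (hi b hb) c (hi c hc) d (hi d hd) (hm a r b ha hr hb hab) hbc hcd with h | h | h
    · exact hac (hm r a c hr ha hc h)
    · exact had (hm r a d hr ha hd h)
    · exact hbd h
  · exact had ((hm b d a hb hd ha hab.symm).symm)
  · exact hac ((hm b c a hb hc ha hab.symm).symm)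
  · exact had ((hm b d a hb hd ha hab.symm).symm)
  · rcases h₂ a (hi a ha) r hri c (hi c hc) d (hi d hd) (hm' b r a hb hr ha hab) (hm b r c hb hr hc hbc) hcd with h | h | h
    · exact hac h
    · exact had h
    · exact hbd (hm r b d hr hb hd h)
  · exact hbd (hm' c d b hc hd hb hbc)
  · rcases h₂ a (hi a ha) b (hi b hb) r hri d (hi d hd) hab (hm' c r b hc hr hb hbc) (hm c r d hc hr hd hcd) with h | h | h
    · exact hac (hm' r c a hr hc ha h)
    · exact had h
    · exact hbd h
  · rcases h₂ a (hi a ha) b (hi b hb) c (hi c hc) r hri hab hbc (hm' d r c hd hr hc hcd) with h | h | h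
    · exact hac h
    · exact had (hm' r d a hr hd ha h)
    · exact hbd (hm' r d b hr hd hb h)
  · rcases h₂ a (hi a ha) b (hi b hb) c (hi c hc) d (hi d hd) hab hbc hcd with h | h | h
    · exact hac h
    · exact had h
    · exact hbd h

/-- The path on four vertices is self-complementary: the complement of `a b c d` is the path `b d a
c`. -/
theorem P4FreeOn.compl {V : Type*} {G : SimpleGraph V} {X : Set V} (h : P4FreeOn G X) :
    P4FreeOn Gᶜ X := by
  intro a ha b hb c hc d hd hab hbc hcd
  have := h b hb d hd a ha c hc
  have e1 : a ≠ d → b ≠ d → a ≠ c → Gᶜ.Adj a c ∨ Gᶜ.Adj a d ∨ Gᶜ.Adj b d := by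
    intro h1 h2 h3
    simp only [SimpleGraph.compl_adj, G.adj_comm d a, G.adj_comm b a, G.adj_comm d c] at *
    tauto
  by_cases h1 : a = d
  · subst h1; exact Or.inr (Or.inr hab.symm)
  by_cases h2 : b = d
  · subst h2; exact Or.inr (Or.inl hab)
  by_cases h3 : a = c
  · subst h3; exact Or.inr (Or.inl hcd)
  exact e1 h1 h2 h3

/-- The ordered pairs on which two graphs differ. -/
def diff {V : Type*} (G H : SimpleGraph V) : Set (V × V) :=
  {p | ¬ (G.Adj p.1 p.2 ↔ H.Adj p.1 p.2)}

theorem mem_diff {V : Type*} {G H : SimpleGraph V} {x y : V} :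
    (x, y) ∈ diff G H ↔ ¬ (G.Adj x y ↔ H.Adj x y) := Iff.rfl

theorem mem_diff_swap {V : Type*} {G H : SimpleGraph V} {x y : V} :
    (y, x) ∈ diff G H ↔ (x, y) ∈ diff G H := by
  rw [mem_diff, mem_diff, G.adj_comm, H.adj_comm]

theorem editBy_adj {V : Type*} (G : SimpleGraph V) (S : Finset (Sym2 V))
    {x y : V} : (editBy G S).Adj x y ↔ (¬ (G.Adj x y ↔ s(x, y) ∈ S)) ∧ x ≠ y := by
  unfold editBy
  rw [SimpleGraph.fromEdgeSet_adj, Set.mem_symmDiff, SimpleGraph.mem_edgeSet, Finset.mem_coe]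
  tauto

/-- The graph whose edges are the pairs on which two graphs differ. -/
def diffGraph {V : Type*} (G H : SimpleGraph V) : SimpleGraph V where
  Adj x y := ¬ (G.Adj x y ↔ H.Adj x y)
  symm := ⟨fun x y h => by rwa [G.adj_comm, H.adj_comm]⟩
  loopless := ⟨fun x h => h (by simp)⟩

theorem diffGraph_adj {V : Type*} {G H : SimpleGraph V} {x y : V} :
    (diffGraph G H).Adj x y ↔ ¬ (G.Adj x y ↔ H.Adj x y) := Iff.rfl

theorem ncard_diff {V : Type*} [Fintype V] (G H : SimpleGraph V)
    [Fintype (diffGraph G H).edgeSet] :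
    (diff G H).ncard = 2 * (diffGraph G H).edgeFinset.card := by
  classical
  have := (diffGraph G H).two_mul_card_edgeFinset
  rw [Set.ncard_eq_toFinset_card']
  convert this.symm using 2
  · ext ⟨x, y⟩
    rw [Set.mem_toFinset, Finset.mem_filter]
    exact ⟨fun h => ⟨Finset.mem_univ _, h⟩, fun h => h.2⟩
  · congr!

/-- Each edited pair occurs in `diff` in both orientations, hence `2 * k`. Ordered pairs allow edits
to be counted by their first vertex. -/
theorem cographEditable_iff {V : Type*} [Fintype V] (G : SimpleGraph V) (k : ℕ) :
    CographEditable G k ↔ ∃ H : SimpleGraph V, P4Free H ∧ (diff G H).ncard ≤ 2 * k := by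
  classical
  constructor
  · rintro ⟨S, hS, hk, hc⟩
    refine ⟨editBy G S, (isCograph_iff_P4Free _).1 hc, ?_⟩
    rw [ncard_diff]
    have : (diffGraph G (editBy G S)).edgeFinset ⊆ S := by
      intro e
      induction e using Sym2.ind with
      | _ x y =>
        simp only [SimpleGraph.mem_edgeFinset, SimpleGraph.mem_edgeSet, diffGraph_adj, editBy_adj]
        by_cases hxy : x = y
        · subst hxy; simp
        · tauto
    have := Finset.card_le_card this
    omega
  · rintro ⟨H, hH, hk⟩
    rw [ncard_diff] at hk
    refine ⟨(diffGraph G H).edgeFinset, ?_, by omega, ?_⟩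
    · intro e he
      exact (diffGraph G H).not_isDiag_of_mem_edgeFinset he
    · rw [isCograph_iff_P4Free]
      convert hH
      ext x y
      rw [editBy_adj, SimpleGraph.mem_edgeFinset, SimpleGraph.mem_edgeSet]
      by_cases hxy : x = y
      · subst hxy; simp
      · simp only [diffGraph_adj]; tauto

/-- The pairs leaving `X` on which two graphs differ. -/
def cross {V : Type*} (G H : SimpleGraph V) (X : Set V) : Set (V × V) :=
  {p | p ∈ diff G H ∧ p.1 ∈ X ∧ p.2 ∉ X}

/-- The pairs on the same side of `X` on which two graphs differ. -/
def uncrossed {V : Type*} (G H : SimpleGraph V) (X : Set V) : Set (V × V) :=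
  {p | p ∈ diff G H ∧ (p.1 ∈ X ↔ p.2 ∈ X)}

/-- A pair leaving `X` is in `cross` in one orientation only, hence the factor two. With at most `2
* k` ordered pairs in all, at most `k` edits leave any given set. -/
theorem ncard_diff_eq {V : Type*} [Finite V] (G H : SimpleGraph V) (X : Set V) :
    (diff G H).ncard = (uncrossed G H X).ncard + 2 * (cross G H X).ncard := by
  have h1 : diff G H = uncrossed G H X ∪ (cross G H X ∪ Prod.swap '' cross G H X) := by
    ext ⟨x, y⟩
    simp only [uncrossed, cross, Set.mem_union, Set.mem_image, Prod.exists, Prod.swap_prod_mk,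
      Prod.mk.injEq, Set.mem_ofPred_eq]
    constructor
    · intro h
      by_cases hx : x ∈ X <;> by_cases hy : y ∈ X
      · left; simp [h, hx, hy]
      · right; left; simp [h, hx, hy]
      · right; right; exact ⟨y, x, ⟨mem_diff_swap.2 h, hy, hx⟩, rfl, rfl⟩
      · left; simp [h, hx, hy]
    · rintro (h | h | ⟨a, b, h, rfl, rfl⟩)
      · exact h.1
      · exact h.1
      · exact mem_diff_swap.2 h.1
  have h2 : Disjoint (cross G H X) (Prod.swap '' cross G H X) := by
    rw [Set.disjoint_left]
    rintro ⟨x, y⟩ h ⟨⟨a, b⟩, h', e⟩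
    simp only [Prod.swap_prod_mk, Prod.mk.injEq] at e
    obtain ⟨rfl, rfl⟩ := e
    exact h.2.2 h'.2.1
  have h3 : Disjoint (uncrossed G H X) (cross G H X ∪ Prod.swap '' cross G H X) := by
    rw [Set.disjoint_left]
    rintro ⟨x, y⟩ h (h' | ⟨⟨a, b⟩, h', e⟩)
    · exact h'.2.2 (h.2.1 h'.2.1)
    · simp only [Prod.swap_prod_mk, Prod.mk.injEq] at e
      obtain ⟨rfl, rfl⟩ := e
      exact h'.2.2 (h.2.2 h'.2.1)
  rw [h1, Set.ncard_union_eq h3, Set.ncard_union_eq h2,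
    Set.ncard_image_of_injective _ Prod.swap_injective]
  ring

/-- The graph `Q` on `X`, the graph `H` outside `X`, and every vertex of `X` joined to the outside
as the vertex `r` is in `H`. -/
def substAt {V : Type*} (X : Set V) (r : V) (Q H : SimpleGraph V) : SimpleGraph V where
  Adj x y := (x ∈ X ∧ y ∈ X ∧ Q.Adj x y) ∨ (x ∈ X ∧ y ∉ X ∧ H.Adj r y) ∨
    (x ∉ X ∧ y ∈ X ∧ H.Adj x r) ∨ (x ∉ X ∧ y ∉ X ∧ H.Adj x y)
  symm := ⟨fun x y h => by
    rw [Q.adj_comm y x, H.adj_comm y x, H.adj_comm r x, H.adj_comm y r]; tauto⟩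
  loopless := ⟨fun x h => by simp at h; tauto⟩

section

variable {V : Type*} {X : Set V} {r : V} {Q H : SimpleGraph V} {x y : V}

theorem substAt_adj_in (hx : x ∈ X) (hy : y ∈ X) : (substAt X r Q H).Adj x y ↔ Q.Adj x y := by
  simp [substAt, hx, hy]

theorem substAt_adj_cross (hx : x ∈ X) (hy : y ∉ X) :
    (substAt X r Q H).Adj x y ↔ H.Adj r y := by
  simp [substAt, hx, hy]

theorem substAt_adj_out (hx : x ∉ X) (hy : y ∉ X) :
    (substAt X r Q H).Adj x y ↔ H.Adj x y := by
  simp [substAt, hx, hy]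

theorem substAt_isModule : IsModule (substAt X r Q H) X := fun a ha b hb z hz => by
  rw [substAt_adj_cross ha hz, substAt_adj_cross hb hz]

/-- On `r` together with the outside of `X` the new graph agrees with `H`, so it is a cograph
substituted for the vertex `r` of a cograph. -/
theorem substAt_P4Free (hr : r ∈ X) (hQ : P4FreeOn Q X) (hH : P4Free H) :
    P4Free (substAt X r Q H) := by
  refine P4Free.of_isModule substAt_isModule hr
    (hQ.congr fun a ha b hb => substAt_adj_in ha hb) ?_
  refine P4FreeOn.of_map id hH ?_
  rintro a ha b hb
  rcases ha with rfl | ha <;> rcases hb with rfl | hb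
  · simp
  · exact substAt_adj_cross hr hb
  · rw [SimpleGraph.adj_comm, substAt_adj_cross hr ha, SimpleGraph.adj_comm]; rfl
  · exact substAt_adj_out ha hb

end

/-- If few pairs in `P` start in the set `X`, then some vertex of `X` starts none of them. -/
theorem exists_notMem_image_fst {V : Type*} [Finite V] (X : Set V) (P : Set (V × V))
    (h : P.ncard < X.ncard) : ∃ r ∈ X, ∀ z, (r, z) ∉ P := by
  have h1 : (Prod.fst '' P).ncard < X.ncard := (Set.ncard_image_le).trans_lt h
  obtain ⟨r, hr, hr'⟩ := Set.exists_mem_notMem_of_ncard_lt_ncard h1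
  exact ⟨r, hr, fun z hz => hr' ⟨_, hz, rfl⟩⟩

/-! ### Equivalence of instances -/

section

variable {V : Type*} {G H : SimpleGraph V} {X : Set V} {k : ℕ}

/-- At most `k` edits leave `X`, so they cannot start at all of its `k + 1` or more vertices. -/
theorem exists_uncrossed_vertex [Finite V] (hk : (diff G H).ncard ≤ 2 * k) (hX : k + 1 ≤ X.ncard) :
    ∃ r ∈ X, ∀ z ∉ X, (G.Adj r z ↔ H.Adj r z) := by
  have h1 := ncard_diff_eq G H X
  obtain ⟨r, hr, h⟩ := exists_notMem_image_fst X (cross G H X) (by omega)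
  exact ⟨r, hr, fun z hz => by by_contra hn; exact h z ⟨hn, hr, hz⟩⟩

theorem ncard_diff_mono [Finite V] {K : SimpleGraph V}
    (h1 : (uncrossed G H X).ncard ≤ (uncrossed G K X).ncard)
    (h2 : (cross G H X).ncard ≤ (cross G K X).ncard) : (diff G H).ncard ≤ (diff G K).ncard := by
  rw [ncard_diff_eq G H X, ncard_diff_eq G K X]
  omega

theorem uncrossed_substAt_self {r : V} : uncrossed G (substAt X r H H) X = uncrossed G H X := by
  ext ⟨x, y⟩
  refine and_congr_left fun h => ?_
  dsimp only at h
  rw [mem_diff, mem_diff]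
  by_cases hx : x ∈ X
  · rw [substAt_adj_in hx (h.1 hx)]
  · rw [substAt_adj_out hx (fun e => hx (h.2 e))]

theorem cross_substAt_eq_empty (hm : IsModule G X) {r : V} (hr : r ∈ X) {Q : SimpleGraph V}
    (h : ∀ z ∉ X, (G.Adj r z ↔ H.Adj r z)) : cross G (substAt X r Q H) X = ∅ := by
  ext ⟨x, y⟩
  simp only [Set.mem_empty_iff_false, iff_false]
  rintro ⟨h1, h2, h3⟩
  rw [mem_diff, substAt_adj_cross h2 h3, hm x h2 r hr y h3, h y h3] at h1
  exact h1 Iff.rfl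

/-- A large module can be left a module. -/
theorem exists_edit_keeping_module [Finite V] (hm : IsModule G X) (hX : k + 1 ≤ X.ncard) (hH : P4Free H)
    (hk : (diff G H).ncard ≤ 2 * k) :
    ∃ H', P4Free H' ∧ (diff G H').ncard ≤ 2 * k ∧ ∀ x ∈ X, ∀ y ∉ X, (G.Adj x y ↔ H'.Adj x y) := by
  obtain ⟨r, hr, h⟩ := exists_uncrossed_vertex hk hX
  refine ⟨substAt X r H H, substAt_P4Free hr (hH.on X) hH,
    (ncard_diff_mono (X := X) ?_ ?_).trans hk, ?_⟩
  · rw [uncrossed_substAt_self]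
  · rw [cross_substAt_eq_empty hm hr h]; simp
  · intro x hx y hy
    rw [substAt_adj_cross hx hy, hm x hx r hr y hy, h y hy]

/-- A large module that induces a cograph can be left untouched. -/
theorem exists_edit_keeping_cograph [Finite V] (hm : IsModule G X) (hX : k + 1 ≤ X.ncard)
    (hc : P4FreeOn G X) (hH : P4Free H) (hk : (diff G H).ncard ≤ 2 * k) :
    ∃ H', P4Free H' ∧ (diff G H').ncard ≤ 2 * k ∧ ∀ x ∈ X, ∀ y, (G.Adj x y ↔ H'.Adj x y) := by
  obtain ⟨r, hr, h⟩ := exists_uncrossed_vertex hk hX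
  refine ⟨substAt X r G H, substAt_P4Free hr hc hH,
    (ncard_diff_mono (X := X) ?_ ?_).trans hk, ?_⟩
  · refine Set.ncard_le_ncard ?_
    rintro ⟨x, y⟩ ⟨h1, h2⟩
    refine ⟨?_, h2⟩
    dsimp only at h2
    rw [mem_diff] at h1 ⊢
    by_cases hx : x ∈ X
    · rw [substAt_adj_in hx (h2.1 hx)] at h1; exact absurd Iff.rfl h1
    · rwa [substAt_adj_out hx (fun e => hx (h2.2 e))] at h1
  · rw [cross_substAt_eq_empty hm hr h]; simp
  · intro x hx y
    by_cases hy : y ∈ X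
    · rw [substAt_adj_in hx hy]
    · rw [substAt_adj_cross hx hy, hm x hx r hr y hy, h y hy]

/-- Averaging: `r` starts the fewest pairs of `P`. This serves modules that may be too small to
contain an unedited vertex. -/
theorem exists_mul_le_ncard [Finite V] (X : Set V) (hX : X.Nonempty) (P : Set (V × V))
    (hP : ∀ p ∈ P, p.1 ∈ X) : ∃ r ∈ X, X.ncard * {z | (r, z) ∈ P}.ncard ≤ P.ncard := by
  classical
  have := Fintype.ofFinite V
  obtain ⟨r, hr, hmin⟩ := Set.exists_min_image X (fun r => {z | (r, z) ∈ P}.ncard)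
    (Set.toFinite X) hX
  refine ⟨r, hr, ?_⟩
  rw [Set.ncard_eq_toFinset_card' X, Set.ncard_eq_toFinset_card' P,
    Finset.card_eq_sum_card_fiberwise (f := Prod.fst) (t := X.toFinset)
      (fun p hp => by simpa using hP p (by simpa using hp)), ← smul_eq_mul]
  refine Finset.card_nsmul_le_sum _ _ _ fun x hx => (hmin x (by simpa using hx)).trans ?_
  rw [← Set.ncard_image_of_injective _ (Prod.mk_right_injective x),
    ← Set.ncard_coe_finset]
  refine Set.ncard_le_ncard ?_
  rintro _ ⟨z, hz, rfl⟩
  have hz' : (x, z) ∈ P := hz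
  simp [hz']

end

/-- Replacing the inside of a module by a cograph preserves positive instances. -/
theorem cographEditable_replace_module {V : Type*} [Fintype V] {G G' : SimpleGraph V} {X : Set V}
    {k : ℕ} (hne : X.Nonempty) (hm : IsModule G X) (hc : P4FreeOn G' X)
    (he : ∀ x y, ¬ (x ∈ X ∧ y ∈ X) → (G'.Adj x y ↔ G.Adj x y)) (h : CographEditable G k) :
    CographEditable G' k := by
  rw [cographEditable_iff] at h ⊢
  obtain ⟨H, hH, hk⟩ := h
  -- `r` has the fewest edits leaving `X`. Copying its outside adjacency to every vertex costs `|X|`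
  -- times that number, which is at most what `H` spends across `X`.
  obtain ⟨r, hr, hmin⟩ := exists_mul_le_ncard X hne (cross G H X) (fun p hp => hp.2.1)
  refine ⟨substAt X r G' H, substAt_P4Free hr hc hH, le_trans ?_ hk⟩
  rw [ncard_diff_eq _ _ X, ncard_diff_eq _ _ X]
  have h1 : (uncrossed G' (substAt X r G' H) X).ncard ≤ (uncrossed G H X).ncard := by
    refine Set.ncard_le_ncard ?_
    rintro ⟨x, y⟩ ⟨h1, h2⟩
    refine ⟨?_, h2⟩
    dsimp only at h2
    rw [mem_diff] at h1 ⊢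
    by_cases hx : x ∈ X
    · rw [substAt_adj_in hx (h2.1 hx)] at h1; exact absurd Iff.rfl h1
    · rwa [substAt_adj_out hx (fun e => hx (h2.2 e)), he _ _ (fun e => hx e.1)] at h1
  have h2 : (cross G' (substAt X r G' H) X).ncard ≤ (cross G H X).ncard := by
    refine le_trans ?_ hmin
    rw [← Set.ncard_prod]
    refine Set.ncard_le_ncard ?_
    rintro ⟨x, y⟩ ⟨h1, h2, h3⟩
    refine ⟨h2, ?_, hr, h3⟩
    dsimp only at h2 h3
    rw [mem_diff, substAt_adj_cross h2 h3, he _ _ (fun e => h3 e.2), hm x h2 r hr y h3] at h1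
    exact h1
  omega

theorem cographEditable_replace_module_iff {V : Type*} [Fintype V] {G G' : SimpleGraph V}
    {X : Set V} {k : ℕ} (hne : X.Nonempty) (hm : IsModule G X) (hc : P4FreeOn G X)
    (hc' : P4FreeOn G' X) (he : ∀ x y, ¬ (x ∈ X ∧ y ∈ X) → (G'.Adj x y ↔ G.Adj x y)) :
    CographEditable G k ↔ CographEditable G' k := by
  refine ⟨fun h => cographEditable_replace_module hne hm hc' he h,
    fun h => cographEditable_replace_module hne ?_ hc (fun x y hxy => (he x y hxy).symm) h⟩
  intro x hx y hy z hz
  rw [he x z fun e => hz e.2, he y z fun e => hz e.2]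
  exact hm x hx y hy z hz

theorem ncard_le_of_map {V W : Type*} [Finite W] {P : Set (V × V)} {Q : Set (W × W)}
    {φ : V → W} (hφ : Function.Injective φ) (h : ∀ x y, (x, y) ∈ P → (φ x, φ y) ∈ Q) :
    P.ncard ≤ Q.ncard :=
  Set.ncard_le_ncard_of_injOn (Prod.map φ φ) (fun p hp => h p.1 p.2 hp)
    (Function.Injective.injOn (hφ.prodMap hφ))

theorem cographEditable_comap {V W : Type*} [Fintype V] [Fintype W] {G : SimpleGraph V} {k : ℕ}
    {φ : W → V} (hφ : Function.Injective φ) (h : CographEditable G k) :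
    CographEditable (G.comap φ) k := by
  rw [cographEditable_iff] at h ⊢
  obtain ⟨H, hH, hk⟩ := h
  exact ⟨H.comap φ, hH.comap φ, (ncard_le_of_map hφ fun x y hxy => hxy).trans hk⟩

/-- The vertices with the same neighbours as `x`. -/
def twins {V : Type*} (G : SimpleGraph V) (x : V) : Set V :=
  {y | ∀ z, G.Adj y z ↔ G.Adj x z}

theorem twins_not_adj {V : Type*} {G : SimpleGraph V} {x y z : V} (hy : y ∈ twins G x)
    (hz : z ∈ twins G x) : ¬ G.Adj y z := by
  rw [hy z, G.adj_comm, hz x]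
  exact G.loopless.irrefl x

/-- One of more than `k + 1` twins can be removed. -/
theorem cographEditable_remove_twin_iff {V W : Type*} [Fintype V] [Fintype W]
    {G : SimpleGraph V} {k : ℕ} {x : V} {φ : W → V} (hφ : Function.Injective φ)
    (hr : ∀ v, v ≠ x → v ∈ Set.range φ) (hx : k + 1 < (twins G x).ncard) :
    CographEditable G k ↔ CographEditable (G.comap φ) k := by
  classical
  refine ⟨fun h => cographEditable_comap hφ h, fun h => ?_⟩
  rw [cographEditable_iff] at h ⊢
  obtain ⟨H, hH, hk⟩ := h
  -- After the removal of `x` at least `k + 1` twins remain. They form an independent module, which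
  -- a solution can leave untouched.
  have hcard : k + 1 ≤ (φ ⁻¹' twins G x).ncard := by
    have h1 : twins G x ⊆ insert x (φ '' (φ ⁻¹' twins G x)) := by
      intro v hv
      by_cases hvx : v = x
      · exact Or.inl hvx
      · obtain ⟨w, rfl⟩ := hr v hvx
        exact Or.inr ⟨w, hv, rfl⟩
    have h2 := Set.ncard_le_ncard h1
    have h3 := Set.ncard_insert_le x (φ '' (φ ⁻¹' twins G x))
    have h4 : (φ '' (φ ⁻¹' twins G x)).ncard ≤ _ := Set.ncard_image_le
    omega
  have hmod : IsModule (G.comap φ) (φ ⁻¹' twins G x) := by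
    intro a ha b hb z _
    exact (ha (φ z)).trans (hb (φ z)).symm
  obtain ⟨H', hH', hk', ht⟩ := exists_edit_keeping_cograph hmod hcard
    (fun a ha b hb _ _ _ _ hab => absurd hab (twins_not_adj (G := G) ha hb)) hH hk
  obtain ⟨y, hy⟩ : (φ ⁻¹' twins G x).Nonempty := Set.nonempty_of_ncard_ne_zero (by omega)
  -- `ψ` inverts `φ` and sends `x` to a surviving twin `y`. Since `y` is untouched, reinserting `x`
  -- as a copy of `y` creates no edit.
  have hex : ∀ v, ∃ w, (v = x → w = y) ∧ (v ≠ x → φ w = v) := by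
    intro v
    by_cases hv : v = x
    · exact ⟨y, fun _ => rfl, fun h => absurd hv h⟩
    · obtain ⟨w, rfl⟩ := hr v hv
      exact ⟨w, fun h => absurd h hv, fun _ => rfl⟩
  choose ψ hψ1 hψ2 using hex
  have hxb : ∀ b, (G.Adj x b ↔ H'.Adj (ψ x) (ψ b)) := by
    intro b
    by_cases hb : b = x
    · subst hb; simp
    · rw [hψ1 x rfl, ← ht y hy, SimpleGraph.comap_adj, hψ2 b hb, hy b]
  refine ⟨H'.comap ψ, hH'.comap ψ, le_trans ?_ hk'⟩
  refine le_trans (Set.ncard_le_ncard ?_ (Set.toFinite _))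
    (Set.ncard_image_le (f := Prod.map φ φ) (Set.toFinite _))
  rintro ⟨a, b⟩ hab
  have ha : a ≠ x := by rintro rfl; exact hab (hxb b)
  have hb : b ≠ x := by rintro rfl; exact mem_diff_swap.2 hab (hxb a)
  refine ⟨(ψ a, ψ b), ?_, by simp [hψ2 _ ha, hψ2 _ hb]⟩
  rw [mem_diff, SimpleGraph.comap_adj, hψ2 _ ha, hψ2 _ hb]
  exact hab

/-- A large module can be extracted and replaced by an independent set of at least `k + 1`
vertices. -/
theorem cographEditable_extract_iff {V W : Type*} [Fintype V] [Fintype W]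
    {G : SimpleGraph V} {G' : SimpleGraph W} {k : ℕ} {A : Set V} {a₀ : V} {φ : V → W}
    (hφ : Function.Injective φ) (hA : IsModule G A) (ha₀ : a₀ ∈ A) (hcard : k + 1 ≤ A.ncard)
    (hnew : k + 1 ≤ (Set.range φ)ᶜ.ncard)
    (h₁ : ∀ a b, G'.Adj (φ a) (φ b) ↔ G.Adj a b ∧ (a ∈ A ↔ b ∈ A))
    (h₂ : ∀ y ∉ Set.range φ, ∀ b, G'.Adj y (φ b) ↔ b ∉ A ∧ G.Adj a₀ b)
    (h₃ : ∀ y ∉ Set.range φ, ∀ z ∉ Set.range φ, ¬ G'.Adj y z) :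
    CographEditable G k ↔ CographEditable G' k := by
  classical
  rw [cographEditable_iff, cographEditable_iff]
  constructor
  · rintro ⟨H, hH, hk⟩
    obtain ⟨H₀, hH₀, hk₀, hc⟩ := exists_edit_keeping_module hA hcard hH hk
    -- `ψ` inverts `φ` and sends the new vertices to `a₀`, whose adjacency to the outside of `A` is
    -- the same in `G` and in `H₀`.
    have hex : ∀ w, ∃ v, (∀ u, w = φ u → v = u) ∧ (w ∉ Set.range φ → v = a₀) := by
      intro w
      by_cases hw : w ∈ Set.range φ
      · obtain ⟨u, rfl⟩ := hw
        exact ⟨u, fun _ h => hφ h, fun h => absurd ⟨u, rfl⟩ h⟩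
      · exact ⟨a₀, fun u h => absurd ⟨u, h.symm⟩ hw, fun _ => rfl⟩
    choose ψ hψ1 hψ2 using hex
    have hψ : ∀ u, ψ (φ u) = u := fun u => hψ1 _ u rfl
    let H₁ : SimpleGraph W :=
      { Adj := fun p q => H₀.Adj (ψ p) (ψ q) ∧ (p ∈ φ '' A ↔ q ∈ φ '' A)
        symm := ⟨fun p q h => ⟨h.1.symm, h.2.symm⟩⟩
        loopless := ⟨fun p h => H₀.loopless.irrefl _ h.1⟩ }
    refine ⟨H₁, P4Free.of_separated (φ '' A) (fun a b h => h.2) ?_ ?_, le_trans ?_ hk₀⟩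
    · exact P4FreeOn.of_map ψ hH₀ fun a ha b hb => and_iff_left (by simp only [ha, hb])
    · exact P4FreeOn.of_map ψ hH₀ fun a ha b hb => and_iff_left (by
        have := ha; have := hb; simp_all only [Set.mem_compl_iff])
    · refine le_trans (Set.ncard_le_ncard ?_ (Set.toFinite _))
        (Set.ncard_image_le (f := Prod.map φ φ) (Set.toFinite _))
      have hnewdiff : ∀ p q, p ∉ Set.range φ → (p, q) ∉ diff G' H₁ := by
        intro p q hp hpq
        apply hpq
        dsimp only
        have hp' : p ∉ φ '' A := fun h => hp (Set.image_subset_range _ _ h)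
        change _ ↔ H₀.Adj (ψ p) (ψ q) ∧ (p ∈ φ '' A ↔ q ∈ φ '' A)
        by_cases hq : q ∈ Set.range φ
        · obtain ⟨b, rfl⟩ := hq
          rw [h₂ p hp, hψ, hψ2 p hp, hφ.mem_set_image]
          by_cases hb : b ∈ A
          · simp [hp', hb]
          · rw [hc a₀ ha₀ b hb]
            simp [hp', hb]
        · simp [h₃ p hp q hq, hψ2 p hp, hψ2 q hq]
      rintro ⟨p, q⟩ hpq
      have hp : p ∈ Set.range φ := by
        by_contra hp; exact hnewdiff p q hp hpq
      have hq : q ∈ Set.range φ := by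
        by_contra hq; exact hnewdiff q p hq (mem_diff_swap.2 hpq)
      obtain ⟨a, rfl⟩ := hp
      obtain ⟨b, rfl⟩ := hq
      refine ⟨(a, b), ?_, rfl⟩
      rw [mem_diff, h₁] at hpq
      change ¬ (_ ↔ H₀.Adj (ψ (φ a)) (ψ (φ b)) ∧ (φ a ∈ φ '' A ↔ φ b ∈ φ '' A)) at hpq
      rw [hψ, hψ, hφ.mem_set_image, hφ.mem_set_image] at hpq
      rw [mem_diff]
      tauto
  · rintro ⟨H, hH, hk⟩
    -- Conversely, the new vertices form a large independent module of `G'` and can be left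
    -- untouched. One of them, `r`, then stands for `A`, and the solution on the extracted copy is
    -- substituted for it.
    have hmod : IsModule G' (Set.range φ)ᶜ := by
      intro x hx y hy z hz
      simp only [Set.mem_compl_iff, not_not] at hz
      obtain ⟨b, rfl⟩ := hz
      rw [h₂ x hx, h₂ y hy]
    obtain ⟨H₁, hH₁, hk₁, hc⟩ := exists_edit_keeping_cograph hmod hnew
      (fun a ha b hb _ _ _ _ hab => absurd hab (h₃ a ha b hb)) hH hk
    obtain ⟨r, hr⟩ : ((Set.range φ)ᶜ).Nonempty := Set.nonempty_of_ncard_ne_zero (by omega)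
    -- The pairs leaving `A` are taken from `G`, so only edits inside `A` and edits outside `A` are
    -- used, and these are edits of `G'` as well.
    let H₀ : SimpleGraph V :=
      { Adj := fun a b => (H₁.Adj (φ a) (φ b) ∧ (a ∈ A ↔ b ∈ A)) ∨ (G.Adj a b ∧ ¬ (a ∈ A ↔ b ∈ A))
        symm := ⟨fun a b h => by rw [H₁.adj_comm, G.adj_comm]; tauto⟩
        loopless := ⟨fun a h => by simp at h⟩ }
    have hsame : ∀ a b, (a ∈ A ↔ b ∈ A) → (H₀.Adj a b ↔ H₁.Adj (φ a) (φ b)) := by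
      intro a b h
      change (_ ∨ _) ↔ _
      tauto
    have hcr : ∀ a b, ¬ (a ∈ A ↔ b ∈ A) → (H₀.Adj a b ↔ G.Adj a b) := by
      intro a b h
      change (_ ∨ _) ↔ _
      tauto
    refine ⟨H₀, P4Free.of_isModule (X := A) ?_ ha₀ ?_ ?_, le_trans ?_ hk₁⟩
    · intro x hx y hy z hz
      rw [hcr x z (by tauto), hcr y z (by tauto)]
      exact hA x hx y hy z hz
    · exact P4FreeOn.of_map φ hH₁ fun a ha b hb => hsame a b (by simp only [ha, hb])
    · have ha₀b : ∀ b ∉ A, (H₀.Adj a₀ b ↔ H₁.Adj r (φ b)) := by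
        intro b hb
        rw [hcr a₀ b (by tauto), ← hc r hr, h₂ r hr]
        simp [hb]
      refine P4FreeOn.of_map (fun v => if v = a₀ then r else φ v) hH₁ ?_
      rintro a ha b hb
      rcases ha with rfl | ha <;> rcases hb with rfl | hb
      · simp
      · have : b ≠ a := by rintro rfl; exact hb ha₀
        simpa [this] using ha₀b b hb
      · have : a ≠ b := by rintro rfl; exact ha ha₀
        rw [SimpleGraph.adj_comm, ha₀b a ha, SimpleGraph.adj_comm]
        simp [this]
      · have h1 : a ≠ a₀ := by rintro rfl; exact ha ha₀
        have h2 : b ≠ a₀ := by rintro rfl; exact hb ha₀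
        simp only [h1, h2, if_false]
        exact hsame a b ⟨fun h => absurd h ha, fun h => absurd h hb⟩
    · refine ncard_le_of_map hφ fun a b hab => ?_
      rw [mem_diff] at hab ⊢
      rw [h₁]
      by_cases h : a ∈ A ↔ b ∈ A
      · rw [hsame a b h] at hab; tauto
      · rw [hcr a b h] at hab; tauto

/-! ### Splitting cographs -/

/-- `P` and `Q` partition `M`, and all pairs between them are adjacent (if `b`) or all are not
(if not `b`). -/
structure Split {V : Type*} (H : SimpleGraph V) (b : Prop) (M P Q : Set V) : Prop where
  left_nonempty : P.Nonempty
  right_nonempty : Q.Nonempty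
  disjoint : Disjoint P Q
  union : P ∪ Q = M
  adj : ∀ x ∈ P, ∀ y ∈ Q, (H.Adj x y ↔ b)

section

variable {V : Type*} {H : SimpleGraph V} {b : Prop} {M P Q : Set V}

theorem Split.symm (h : Split H b M P Q) : Split H b M Q P where
  left_nonempty := h.right_nonempty
  right_nonempty := h.left_nonempty
  disjoint := h.disjoint.symm
  union := by rw [Set.union_comm, h.union]
  adj := fun x hx y hy => by rw [H.adj_comm]; exact h.adj y hy x hx

theorem Split.compl (h : Split H b M P Q) : Split Hᶜ (¬ b) M P Q where
  left_nonempty := h.left_nonempty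
  right_nonempty := h.right_nonempty
  disjoint := h.disjoint
  union := h.union
  adj := fun x hx y hy => by
    have : x ≠ y := fun e => Set.disjoint_left.1 h.disjoint hx (e ▸ hy)
    rw [SimpleGraph.compl_adj, h.adj x hx y hy]
    tauto

theorem Split.left_subset (h : Split H b M P Q) : P ⊆ M := h.union ▸ Set.subset_union_left

theorem Split.right_subset (h : Split H b M P Q) : Q ⊆ M := h.union ▸ Set.subset_union_right

theorem Split.ncard [Finite V] (h : Split H b M P Q) : M.ncard = P.ncard + Q.ncard := by
  rw [← h.union, Set.ncard_union_eq h.disjoint]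

theorem Split.ncard_left_lt [Finite V] (h : Split H b M P Q) : P.ncard < M.ncard := by
  have := (Set.ncard_pos (Set.toFinite Q)).2 h.right_nonempty
  have := h.ncard
  omega

theorem Split.ncard_right_lt [Finite V] (h : Split H b M P Q) : Q.ncard < M.ncard :=
  h.symm.ncard_left_lt

theorem Split.isModule_left (h : Split H b M P Q) (hM : IsModule H M) : IsModule H P := by
  intro x hx y hy z hz
  by_cases hzM : z ∈ M
  · have : z ∈ Q := by
      rw [← h.union] at hzM
      exact hzM.resolve_left hz
    rw [h.adj x hx z this, h.adj y hy z this]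
  · exact hM x (h.left_subset hx) y (h.left_subset hy) z hzM

theorem Split.isModule_right (h : Split H b M P Q) (hM : IsModule H M) : IsModule H Q :=
  h.symm.isModule_left hM

/-- Unless `v` is joined to all of `M`, take the component `D` of a non-neighbour of `v`. If `v` has
neighbours both in `D` and outside `D`, then an edge of `D` from a non-neighbour to a neighbour of
`v` extends through `v` to an induced path. Otherwise `D` or `M \ D` splits off. -/
theorem exists_split_insert_of_disconnected [Finite V] {v : V} (hv : v ∉ M)
    (hP4 : P4FreeOn H (insert v M)) (h : Split H False M P Q) :
    ∃ b P' Q', Split H b (insert v M) P' Q' := by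
  by_cases hall : ∀ z ∈ M, H.Adj v z
  · exact ⟨True, {v}, M, ⟨v, rfl⟩, h.left_nonempty.mono h.left_subset, by simpa using hv, rfl,
      fun x hx y hy => by rw [hx]; simp [hall y hy]⟩
  push Not at hall
  obtain ⟨z₀, hz₀, hvz₀⟩ := hall
  wlog hz₀P : z₀ ∈ P generalizing P Q
  · refine this h.symm ?_
    rw [← h.union] at hz₀
    exact hz₀.resolve_left hz₀P
  -- Minimality among the sets without edges to the rest of `M` plays the role of connectedness.
  obtain ⟨D, ⟨hzD, hDP, hDcl⟩, hDmin⟩ := Set.exists_min_image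
    {D : Set V | z₀ ∈ D ∧ D ⊆ P ∧ ∀ x ∈ D, ∀ y ∈ M, y ∉ D → ¬ H.Adj x y} Set.ncard
    (Set.toFinite _) ⟨P, hz₀P, subset_rfl, fun x hx y hy hyP hxy =>
      (h.adj x hx y (by rw [← h.union] at hy; exact hy.resolve_left hyP)).1 hxy⟩
  have hDM : D ⊆ M := hDP.trans h.left_subset
  have hrest : (M \ D).Nonempty := by
    obtain ⟨q, hq⟩ := h.right_nonempty
    exact ⟨q, h.right_subset hq, fun e => Set.disjoint_left.1 h.disjoint (hDP e) hq⟩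
  by_cases hB : ∃ y ∈ D, H.Adj v y
  swap
  · refine ⟨False, D, insert v (M \ D), ⟨z₀, hzD⟩, Set.insert_nonempty _ _, ?_, ?_, ?_⟩
    · rw [Set.disjoint_left]
      rintro x hx (rfl | hx')
      · exact hv (hDM hx)
      · exact hx'.2 hx
    · rw [Set.union_insert, Set.union_sdiff_cancel hDM]
    · rintro x hx y (rfl | hy)
      · simp only [iff_false]
        exact fun e => hB ⟨x, hx, e.symm⟩
      · simp only [iff_false]
        exact hDcl x hx y hy.1 hy.2
  by_cases hC : ∃ x ∈ M \ D, H.Adj v x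
  swap
  · refine ⟨False, M \ D, insert v D, hrest, Set.insert_nonempty _ _, ?_, ?_, ?_⟩
    · rw [Set.disjoint_left]
      rintro x hx (rfl | hx')
      · exact hv hx.1
      · exact hx.2 hx'
    · rw [Set.union_insert, Set.union_comm, Set.union_sdiff_cancel hDM]
    · rintro x hx y (rfl | hy)
      · simp only [iff_false]
        exact fun e => hC ⟨x, hx, e.symm⟩
      · simp only [iff_false]
        exact fun e => hDcl y hy x hx.1 hx.2 e.symm
  obtain ⟨y₀, hy₀, hvy₀⟩ := hB
  obtain ⟨x, hx, hvx⟩ := hC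
  exfalso
  by_cases hE : ∃ y ∈ D, ∃ z ∈ D, H.Adj v y ∧ ¬ H.Adj v z ∧ H.Adj z y
  · obtain ⟨y, hy, z, hz, hvy, hvz, hzy⟩ := hE
    rcases hP4 z (Or.inr (hDM hz)) y (Or.inr (hDM hy)) v (Or.inl rfl) x (Or.inr hx.1)
      hzy hvy.symm hvx with e | e | e
    · exact hvz e.symm
    · exact hDcl z hz x hx.1 hx.2 e
    · exact hDcl y hy x hx.1 hx.2 e
  · push Not at hE
    -- Without such an edge the non-neighbours of `v` in `D` would be a smaller closed set
    -- containing `z₀`.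
    have hlt : {z ∈ D | ¬ H.Adj v z}.ncard < D.ncard := by
      refine Set.ncard_lt_ncard ⟨fun z hz => hz.1, fun hs => ?_⟩
      exact (hs hy₀).2 hvy₀
    refine absurd (hDmin {z ∈ D | ¬ H.Adj v z} ⟨⟨hzD, hvz₀⟩, fun z hz => hDP hz.1, ?_⟩)
      (not_le.2 hlt)
    intro z hz y hy hyn
    by_cases hyD : y ∈ D
    · exact hE y hyD z hz.1 (by by_contra hn; exact hyn ⟨hyD, hn⟩) hz.2
    · exact hDcl z hz.1 y hy hyD

/-- A cograph with at least two vertices is disconnected or its complement is. -/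
theorem exists_split [Finite V] (hP4 : P4FreeOn H M) (hM : 2 ≤ M.ncard) :
    ∃ b P Q, Split H b M P Q := by
  induction M, Set.toFinite M using Set.Finite.induction_on with
  | empty => simp at hM
  | @insert v M hv hfin ih =>
    rw [Set.ncard_insert_of_notMem hv] at hM
    by_cases h1 : M.ncard = 1
    · obtain ⟨w, rfl⟩ := Set.ncard_eq_one.1 h1
      refine ⟨H.Adj v w, {v}, {w}, Set.singleton_nonempty _, Set.singleton_nonempty _,
        by simpa using hv, rfl, ?_⟩
      rintro x rfl y rfl
      rfl
    · obtain ⟨b, P, Q, h⟩ := ih (hP4.mono (Set.subset_insert v M)) (by omega)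
      -- A join is a disjoint union in the complement, where induced paths on four vertices are
      -- forbidden as well.
      by_cases hb : b
      · have h' := h.compl
        simp only [hb, not_true] at h'
        obtain ⟨b', P', Q', h''⟩ := exists_split_insert_of_disconnected hv hP4.compl h'
        have := h''.compl
        rw [compl_compl] at this
        exact ⟨_, _, _, this⟩
      · simp only [hb] at h
        exact exists_split_insert_of_disconnected hv hP4 h

/-- A nonempty set in which no split leaves an unaffected part can be reached by removing one
unaffected part. -/
theorem exists_peel [Finite V] (b : Prop) (F : Set V) (hMF : (M ∩ F).Nonempty) :
    ∃ X N : Set V, X ∪ N = M ∧ Disjoint X N ∧ Disjoint X F ∧ (X.Nonempty → Split H b M X N) ∧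
      ∀ P Q, Split H b N P Q → (P ∩ F).Nonempty ∧ (Q ∩ F).Nonempty := by
  -- With `X` maximal, a part of the remainder that avoids `F` could be added to `X`.
  obtain ⟨X, ⟨hXM, hXF, hX⟩, hmax⟩ := Set.exists_max_image
    {X : Set V | X ⊆ M ∧ Disjoint X F ∧ ∀ x ∈ X, ∀ y ∈ M \ X, (H.Adj x y ↔ b)} Set.ncard
    (Set.toFinite _) ⟨∅, by simp, by simp, by simp⟩
  have key : ∀ P Q, Split H b (M \ X) P Q → (P ∩ F).Nonempty := by
    intro P Q h
    by_contra hn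
    rw [Set.not_nonempty_iff_eq_empty, ← Set.disjoint_iff_inter_eq_empty] at hn
    have hd : Disjoint X P :=
      Set.disjoint_left.2 fun x hx hp => (h.left_subset hp).2 hx
    have := hmax (X ∪ P) ⟨Set.union_subset hXM (h.left_subset.trans Set.sdiff_subset),
      Set.disjoint_union_left.2 ⟨hXF, hn⟩, ?_⟩
    · rw [Set.ncard_union_eq hd] at this
      have := (Set.ncard_pos (Set.toFinite P)).2 h.left_nonempty
      omega
    · rintro x hx y ⟨hy, hyn⟩
      have hyX : y ∉ X := fun e => hyn (Or.inl e)
      rcases hx with hx | hx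
      · exact hX x hx y ⟨hy, hyX⟩
      · refine h.adj x hx y ?_
        have : y ∈ P ∪ Q := by rw [h.union]; exact ⟨hy, hyX⟩
        exact this.resolve_left fun e => hyn (Or.inr e)
  refine ⟨X, M \ X, Set.union_sdiff_cancel hXM, Set.disjoint_sdiff_right, hXF, ?_,
    fun P Q h => ⟨key P Q h, key Q P h.symm⟩⟩
  intro hne
  obtain ⟨f, hfM, hfF⟩ := hMF
  exact ⟨hne, ⟨f, hfM, fun e => Set.disjoint_left.1 hXF e hfF⟩, Set.disjoint_sdiff_right,
    Set.union_sdiff_cancel hXM, hX⟩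

end

/-! ### Nested approximate modules -/

/-- The pairs leaving `X` that have to be edited so that every vertex of `X` is joined to the
outside as `a₀` is. -/
def defect {V : Type*} (G : SimpleGraph V) (a₀ : V) (X : Set V) : Set (V × V) :=
  {p | p.1 ∈ X ∧ p.2 ∉ X ∧ ¬ (G.Adj p.1 p.2 ↔ G.Adj a₀ p.2)}

/-- The vertices in the layer `Y \ X` that are joined to all of `X` (if `b`) or to none of `X`
(if not `b`), and to the outside of `Z` as `a₀` is. -/
def layer {V : Type*} (G : SimpleGraph V) (b : Prop) (a₀ : V) (X Y Z : Set V) : Set V :=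
  {v | v ∈ Y ∧ v ∉ X ∧ (∀ x ∈ X, (G.Adj v x ↔ b)) ∧ ∀ z ∉ Z, (G.Adj v z ↔ G.Adj a₀ z)}

/-- Three nested sets `A₁ ⊆ A₂ ⊆ A₃` with at most `t` defects each, with `A₁` and the two layers
between them large. -/
structure Nested {V : Type*} (G : SimpleGraph V) (k t : ℕ) (a₀ : V) (A₁ A₂ A₃ : Set V) : Prop where
  mem : a₀ ∈ A₁
  subset₁₂ : A₁ ⊆ A₂
  subset₂₃ : A₂ ⊆ A₃
  card : k + t < A₁.ncard
  defect₁ : (defect G a₀ A₁).ncard ≤ t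
  defect₂ : (defect G a₀ A₂).ncard ≤ t
  defect₃ : (defect G a₀ A₃).ncard ≤ t
  layer₁₂_true : 3 * t + 1 ≤ (layer G True a₀ A₁ A₂ A₃).ncard
  layer₁₂_false : 3 * t + 1 ≤ (layer G False a₀ A₁ A₂ A₃).ncard
  layer₂₃_true : 3 * t + 1 ≤ (layer G True a₀ A₂ A₃ A₃).ncard
  layer₂₃_false : 3 * t + 1 ≤ (layer G False a₀ A₂ A₃ A₃).ncard

section

variable {V : Type*} {G H : SimpleGraph V} {X : Set V} {k t : ℕ} {a₀ : V}

/-- An optimal edit changes at most `t` pairs leaving a large set with at most `t` defects. -/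
theorem ncard_cross_le_of_optimal [Finite V] (hH : P4Free H) (hk : (diff G H).ncard ≤ 2 * k)
    (hmin : ∀ H', P4Free H' → (diff G H).ncard ≤ (diff G H').ncard)
    (ht : (defect G a₀ X).ncard ≤ t) (hX : k + t < X.ncard) : (cross G H X).ncard ≤ t := by
  have h1 := ncard_diff_eq G H X
  have h2 := Set.ncard_union_le (cross G H X) (defect G a₀ X)
  -- At most `k` edits and `t` defects leave `X`, so some `r` starts neither. Making all of `X` look
  -- like `r` costs only the defects across `X`, and optimality of `H` gives the bound.
  obtain ⟨r, hr, h⟩ := exists_notMem_image_fst X (cross G H X ∪ defect G a₀ X) (by omega)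
  have h3 := hmin _ (substAt_P4Free hr (hH.on X) hH)
  rw [ncard_diff_eq _ _ X, ncard_diff_eq _ _ X, uncrossed_substAt_self] at h3
  have h4 : (cross G (substAt X r H H) X).ncard ≤ (defect G a₀ X).ncard := by
    refine Set.ncard_le_ncard ?_
    rintro ⟨x, z⟩ ⟨h4, h5, h6⟩
    refine ⟨h5, h6, ?_⟩
    dsimp only at h5 h6 ⊢
    rw [mem_diff, substAt_adj_cross h5 h6] at h4
    have h7 : G.Adj r z ↔ H.Adj r z := by
      by_contra hn; exact h z (Or.inl ⟨hn, hr, h6⟩)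
    have h8 : G.Adj r z ↔ G.Adj a₀ z := by
      by_contra hn; exact h z (Or.inr ⟨hr, h6, hn⟩)
    rwa [← h8, h7]
  omega

/-- An edit between a vertex of the layer and `X` leaves `X`, and an edit between it and the outside
of `Y` leaves `Y`. These are at most `2 * t` pairs, fewer than the vertices of the layer. -/
theorem exists_mem_layer_unedited [Finite V] {b : Prop} {Y Z : Set V}
    (hl : 3 * t + 1 ≤ (layer G b a₀ X Y Z).ncard) (hX : (cross G H X).ncard ≤ t)
    (hY : (cross G H Y).ncard ≤ t) :
    ∃ v ∈ layer G b a₀ X Y Z, (∀ x ∈ X, (H.Adj v x ↔ b)) ∧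
      ∀ z ∉ Y, z ∉ Z → (H.Adj v z ↔ G.Adj a₀ z) := by
  have h1 : (Prod.swap '' cross G H X).ncard ≤ (cross G H X).ncard := Set.ncard_image_le
  have h2 := Set.ncard_union_le (Prod.swap '' cross G H X) (cross G H Y)
  obtain ⟨v, hv, h⟩ := exists_notMem_image_fst (layer G b a₀ X Y Z)
    (Prod.swap '' cross G H X ∪ cross G H Y) (by omega)
  refine ⟨v, hv, fun x hx => ?_, fun z hz hz' => ?_⟩
  · rw [← hv.2.2.1 x hx, iff_comm]
    by_contra hn
    exact h x (Or.inl ⟨(x, v), ⟨mem_diff_swap.2 hn, hx, hv.2.1⟩, rfl⟩)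
  · rw [← hv.2.2.2 z hz', iff_comm]
    by_contra hn
    exact h z (Or.inr ⟨hn, hv.1, hz⟩)

/-- In an optimal edit, the smallest of three nested sets is joined uniformly to the outside of
the largest. -/
theorem Nested.adj_iff_of_optimal [Finite V] {A₁ A₂ A₃ : Set V} (h : Nested G k t a₀ A₁ A₂ A₃)
    (hH : P4Free H) (hk : (diff G H).ncard ≤ 2 * k)
    (hmin : ∀ H', P4Free H' → (diff G H).ncard ≤ (diff G H').ncard) {x y : V} (hx : x ∈ A₁)
    (hy : y ∉ A₃) : H.Adj x y ↔ G.Adj a₀ y := by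
  have l₂ := h.card.trans_le (Set.ncard_le_ncard h.subset₁₂)
  have l₃ := l₂.trans_le (Set.ncard_le_ncard h.subset₂₃)
  have c₁ := ncard_cross_le_of_optimal hH hk hmin h.defect₁ h.card
  have c₂ := ncard_cross_le_of_optimal hH hk hmin h.defect₂ l₂
  have c₃ := ncard_cross_le_of_optimal hH hk hmin h.defect₃ l₃
  have hy₂ : y ∉ A₂ := fun e => hy (h.subset₂₃ e)
  by_cases hay : G.Adj a₀ y
  · simp only [hay, iff_true]
    -- In the path `x b y c` the pairs `x c` and `b c` are non-adjacent, so the chord `x y` must be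
    -- present.
    obtain ⟨b, hb, hb₁, hb₂⟩ := exists_mem_layer_unedited h.layer₁₂_true c₁ c₂
    obtain ⟨c, hc, hc₁, hc₂⟩ := exists_mem_layer_unedited h.layer₂₃_false c₂ c₃
    have hbx := (hb₁ x hx).2 trivial
    have hby := (hb₂ y hy₂ hy).2 hay
    have hcy := (hc₂ y hy hy).2 hay
    have hcx := (hc₁ x (h.subset₁₂ hx)).1
    have hcb := (hc₁ b hb.1).1
    rcases hH x b y c hbx.symm hby hcy.symm with e | e | e
    · exact e
    · exact (hcx e.symm).elim
    · exact (hcb e.symm).elim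
  · simp only [hay, iff_false]
    intro hxy
    -- If `x` and `y` were adjacent, then `y x c b` would be an induced path.
    obtain ⟨b, hb, hb₁, hb₂⟩ := exists_mem_layer_unedited h.layer₁₂_false c₁ c₂
    obtain ⟨c, hc, hc₁, hc₂⟩ := exists_mem_layer_unedited h.layer₂₃_true c₂ c₃
    have hbx := (hb₁ x hx).1
    have hby := (hb₂ y hy₂ hy).1
    have hcy := (hc₂ y hy hy).1
    have hcx := (hc₁ x (h.subset₁₂ hx)).2 trivial
    have hcb := (hc₁ b hb.1).2 trivial
    rcases hH y x c b hxy.symm hcx.symm hcb with e | e | e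
    · exact hay (hcy e.symm)
    · exact hay (hby e.symm)
    · exact hbx e.symm

end

theorem exists_optimal {V : Type*} [Finite V] (G H₀ : SimpleGraph V) (h₀ : P4Free H₀) :
    ∃ H, P4Free H ∧ (diff G H).ncard ≤ (diff G H₀).ncard ∧
      ∀ H', P4Free H' → (diff G H).ncard ≤ (diff G H').ncard := by
  obtain ⟨H, hH, hmin⟩ := Set.exists_min_image {H : SimpleGraph V | P4Free H}
    (fun H => (diff G H).ncard) (Set.toFinite _) ⟨H₀, h₀⟩
  exact ⟨H, hH, hmin H₀ h₀, hmin⟩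

theorem diff_flip {V : Type*} {G H : SimpleGraph V} {x y : V} :
    diff (editBy G {s(x, y)}) H \ {(x, y), (y, x)} = diff G H \ {(x, y), (y, x)} := by
  ext ⟨a, b⟩
  simp only [Set.mem_sdiff, Set.mem_insert_iff, Prod.mk.injEq, Set.mem_singleton_iff, mem_diff,
    editBy_adj, Finset.mem_singleton, Sym2.eq_iff]
  by_cases hab : a = b
  · subst hab; simp
  · tauto

/-- A pair that is edited in every optimal solution can be edited. -/
theorem Nested.cographEditable_flip_iff {V : Type*} [Fintype V] {G : SimpleGraph V} {k t : ℕ}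
    {a₀ : V} {A₁ A₂ A₃ : Set V} (h : Nested G k t a₀ A₁ A₂ A₃) (hk : 1 ≤ k) {x y : V}
    (hx : x ∈ A₁) (hy : y ∉ A₃) (hxy : ¬ (G.Adj x y ↔ G.Adj a₀ y)) :
    CographEditable G k ↔ CographEditable (editBy G {s(x, y)}) (k - 1) := by
  have hne : x ≠ y := by
    rintro rfl
    exact hy (h.subset₂₃ (h.subset₁₂ hx))
  have hpair : ({(x, y), (y, x)} : Set (V × V)).ncard = 2 :=
    Set.ncard_pair (by simp [hne])
  rw [cographEditable_iff, cographEditable_iff]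
  constructor
  · rintro ⟨H₀, hH₀, hk₀⟩
    obtain ⟨H, hH, hle, hmin⟩ := exists_optimal G H₀ hH₀
    have hadj := h.adj_iff_of_optimal hH (hle.trans hk₀) hmin hx hy
    refine ⟨H, hH, ?_⟩
    have h1 : ({(x, y), (y, x)} : Set (V × V)) ⊆ diff G H := by
      have : (x, y) ∈ diff G H := by rw [mem_diff, hadj]; exact hxy
      rintro p (rfl | rfl)
      · exact this
      · exact mem_diff_swap.2 this
    have h2 : diff (editBy G {s(x, y)}) H ⊆ diff G H \ {(x, y), (y, x)} := by
      rw [← diff_flip]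
      refine fun p hp => ⟨hp, ?_⟩
      have h3 : (x, y) ∉ diff (editBy G {s(x, y)}) H := by
        rw [mem_diff, editBy_adj, hadj]
        simp only [Finset.mem_singleton, hne, ne_eq, not_false_eq_true, and_true]
        tauto
      rintro (rfl | rfl)
      · exact h3 hp
      · exact h3 (mem_diff_swap.1 hp)
    have h3 := Set.ncard_le_ncard h2
    rw [Set.ncard_sdiff h1] at h3
    omega
  · rintro ⟨H, hH, hk'⟩
    refine ⟨H, hH, ?_⟩
    have h1 : diff G H ⊆ diff (editBy G {s(x, y)}) H ∪ {(x, y), (y, x)} := by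
      intro p hp
      by_cases hp' : p ∈ ({(x, y), (y, x)} : Set (V × V))
      · exact Or.inr hp'
      · have : p ∈ diff (editBy G {s(x, y)}) H \ {(x, y), (y, x)} := by
          rw [diff_flip]; exact ⟨hp, hp'⟩
        exact Or.inl this.1
    have h2 := Set.ncard_le_ncard h1
    have h3 := Set.ncard_union_le (diff (editBy G {s(x, y)}) H) {(x, y), (y, x)}
    omega

/-! ### Irreducible graphs and complete bipartite modules -/

/-- The union of the twin classes of the adjacent vertices `x` and `y` is a module. -/
def TwinModule {V : Type*} (G : SimpleGraph V) (x y : V) : Prop :=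
  G.Adj x y ∧ ∀ z, z ∉ twins G x → z ∉ twins G y → (G.Adj x z ↔ G.Adj y z)

theorem TwinModule.isModule {V : Type*} {G : SimpleGraph V} {x y : V} (h : TwinModule G x y) :
    IsModule G (twins G x ∪ twins G y) := by
  have key : ∀ p ∈ twins G x ∪ twins G y, ∀ z ∉ twins G x ∪ twins G y,
      (G.Adj p z ↔ G.Adj x z) := by
    rintro p (hp | hp) z hz
    · exact hp z
    · exact (hp z).trans (h.2 z (fun e => hz (Or.inl e)) (fun e => hz (Or.inr e))).symm
  exact fun p hp q hq z hz => (key p hp z hz).trans (key q hq z hz).symm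

/-- The two classes are independent and completely joined. A path with three edges alternates
between them, so its ends lie in different classes and are adjacent. -/
theorem TwinModule.p4FreeOn {V : Type*} {G : SimpleGraph V} {x y : V} (h : TwinModule G x y) :
    P4FreeOn G (twins G x ∪ twins G y) := by
  have hxy : ∀ p ∈ twins G x, ∀ q ∈ twins G y, G.Adj p q := by
    intro p hp q hq
    rw [hp q, G.adj_comm, hq x]
    exact h.1.symm
  rintro a ha b hb c hc d hd hab hbc hcd
  refine Or.inr (Or.inl ?_)
  rcases ha with ha | ha <;> rcases hb with hb | hb <;> rcases hc with hc | hc <;>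
    rcases hd with hd | hd <;>
    first
    | exact (twins_not_adj ha hb hab).elim
    | exact (twins_not_adj hb hc hbc).elim
    | exact (twins_not_adj hc hd hcd).elim
    | exact hxy _ ha _ hd
    | exact (hxy _ hd _ ha).symm

/-- Deleting the edges between the two twin classes of a complete bipartite module. -/
theorem TwinModule.cographEditable_iff {V : Type*} [Fintype V] {G G' : SimpleGraph V} {x y : V}
    {k : ℕ} (h : TwinModule G x y)
    (hG' : ∀ p q, G'.Adj p q ↔
      G.Adj p q ∧ ¬ (p ∈ twins G x ∪ twins G y ∧ q ∈ twins G x ∪ twins G y)) :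
    CographEditable G k ↔ CographEditable G' k := by
  refine cographEditable_replace_module_iff ⟨x, Or.inl fun z => Iff.rfl⟩ h.isModule h.p4FreeOn
    (fun a ha b hb _ _ _ _ hab => absurd ⟨ha, hb⟩ ((hG' a b).1 hab).2)
    fun p q hpq => by rw [hG', and_iff_left hpq]

/-- If no two twin classes form a complete bipartite module, then modules inducing cographs are
independent. -/
theorem not_adj_of_no_twinModule {V : Type*} [Finite V] {G : SimpleGraph V}
    (h : ∀ x y, ¬ TwinModule G x y) {X : Set V} (hm : IsModule G X) (hc : P4FreeOn G X) :
    ∀ x ∈ X, ∀ y ∈ X, ¬ G.Adj x y := by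
  by_contra! hn
  -- In a smallest module with an edge, both parts of a split are smaller modules, hence
  -- independent. The split is then a join of two sets of twins, which is excluded by hypothesis.
  obtain ⟨Y, ⟨hYX, hYm, u, hu, v, hv, huv⟩, hmin⟩ := Set.exists_min_image
    {Y : Set V | Y ⊆ X ∧ IsModule G Y ∧ ∃ x ∈ Y, ∃ y ∈ Y, G.Adj x y} Set.ncard
    (Set.toFinite _) ⟨X, subset_rfl, hm, hn⟩
  have h2 : 2 ≤ Y.ncard := by
    rw [← Set.ncard_pair huv.ne]
    exact Set.ncard_le_ncard (Set.insert_subset hu (Set.singleton_subset_iff.2 hv))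
  obtain ⟨b, P, Q, hs⟩ := exists_split (hc.mono hYX) h2
  have hind : ∀ P Q, Split G b Y P Q → ∀ x ∈ P, ∀ y ∈ P, ¬ G.Adj x y := by
    intro P Q hs x hx y hy hxy
    exact absurd (hmin P ⟨hs.left_subset.trans hYX, hs.isModule_left hYm, x, hx, y, hy, hxy⟩)
      (not_le.2 hs.ncard_left_lt)
  have hP := hind P Q hs
  have hQ := hind Q P hs.symm
  have hmem : ∀ z ∈ Y, z ∈ P ∨ z ∈ Q := fun z hz => by rwa [← hs.union] at hz
  by_cases hb : b
  · have hadj : ∀ x ∈ P, ∀ y ∈ Q, G.Adj x y := fun x hx y hy => (hs.adj x hx y hy).2 hb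
    have htw : ∀ P Q, Split G b Y P Q → (∀ x ∈ P, ∀ y ∈ P, ¬ G.Adj x y) → ∀ x ∈ P,
        P ⊆ twins G x := by
      intro P Q hs hP x hx p hp z
      by_cases hz : z ∈ P
      · simp only [hP p hp z hz, hP x hx z hz]
      · exact hs.isModule_left hYm p hp x hx z hz
    obtain ⟨x, hx⟩ := hs.left_nonempty
    obtain ⟨y, hy⟩ := hs.right_nonempty
    refine h x y ⟨hadj x hx y hy, fun z hz hz' => ?_⟩
    refine hYm x (hs.left_subset hx) y (hs.right_subset hy) z fun hzY => ?_
    rcases hmem z hzY with e | e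
    · exact hz (htw P Q hs hP x hx e)
    · exact hz' (htw Q P hs.symm hQ y hy e)
  · have hadj : ∀ x ∈ P, ∀ y ∈ Q, ¬ G.Adj x y := fun x hx y hy e => hb ((hs.adj x hx y hy).1 e)
    rcases hmem u hu with hu | hu <;> rcases hmem v hv with hv | hv
    · exact hP u hu v hv huv
    · exact hadj u hu v hv huv
    · exact hadj v hv u hu huv.symm
    · exact hQ u hu v hv huv

/-! ### Rungs of an edited cograph -/

/-- The neighbours of `u` that are not neighbours of `w`. -/
def nbrDiff {V : Type*} (G : SimpleGraph V) (u w : V) : Set V :=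
  {x | G.Adj u x ∧ ¬ G.Adj w x}

/-- A family of pairs of unedited vertices in `M` whose neighbourhood differences form a laminar
family of modules of `H` with at least `m` vertices each. -/
structure IsRungFamily {V : Type*} (G H : SimpleGraph V) (F : Set V) (m : ℕ) (M : Set V)
    (U : Finset (V × V)) : Prop where
  mem : ∀ e ∈ U, e.1 ∈ M ∧ e.2 ∈ M ∧ e.1 ∉ F ∧ e.2 ∉ F ∧ ¬ G.Adj e.1 e.2
  subset : ∀ e ∈ U, nbrDiff G e.1 e.2 ⊆ M
  isModule : ∀ e ∈ U, IsModule H (nbrDiff G e.1 e.2)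
  card : ∀ e ∈ U, m ≤ (nbrDiff G e.1 e.2).ncard
  laminar : ∀ e ∈ U, ∀ e' ∈ U, e = e' ∨ Disjoint (nbrDiff G e.1 e.2) (nbrDiff G e'.1 e'.2) ∨
    (nbrDiff G e.1 e.2 ⊆ nbrDiff G e'.1 e'.2 ∧ e.1 ∈ nbrDiff G e'.1 e'.2 ∧
      e.2 ∈ nbrDiff G e'.1 e'.2) ∨
    (nbrDiff G e'.1 e'.2 ⊆ nbrDiff G e.1 e.2 ∧ e'.1 ∈ nbrDiff G e.1 e.2 ∧
      e'.2 ∈ nbrDiff G e.1 e.2)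

section

variable {V : Type*} {G H : SimpleGraph V} {F M N P Q : Set V} {m k : ℕ} {U U' : Finset (V × V)}

theorem isRungFamily_empty : IsRungFamily G H F m M ∅ where
  mem := by simp
  subset := by simp
  isModule := by simp
  card := by simp
  laminar := by simp

theorem IsRungFamily.mono (h : IsRungFamily G H F m N U) (hNM : N ⊆ M) :
    IsRungFamily G H F m M U where
  mem := fun e he => ⟨hNM (h.mem e he).1, hNM (h.mem e he).2.1, (h.mem e he).2.2⟩
  subset := fun e he => (h.subset e he).trans hNM
  isModule := h.isModule
  card := h.card
  laminar := h.laminar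

theorem IsRungFamily.union (h : IsRungFamily G H F m P U) (h' : IsRungFamily G H F m Q U')
    (hd : Disjoint P Q) : ∃ W, IsRungFamily G H F m (P ∪ Q) W ∧ W.card = U.card + U'.card := by
  classical
  refine ⟨U ∪ U', ⟨?_, ?_, ?_, ?_, ?_⟩, ?_⟩
  · intro e he
    rcases Finset.mem_union.1 he with he | he
    · exact (h.mono Set.subset_union_left).mem e he
    · exact (h'.mono Set.subset_union_right).mem e he
  · intro e he
    rcases Finset.mem_union.1 he with he | he
    · exact (h.mono Set.subset_union_left).subset e he
    · exact (h'.mono Set.subset_union_right).subset e he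
  · intro e he
    rcases Finset.mem_union.1 he with he | he
    · exact h.isModule e he
    · exact h'.isModule e he
  · intro e he
    rcases Finset.mem_union.1 he with he | he
    · exact h.card e he
    · exact h'.card e he
  · intro e he e' he'
    rcases Finset.mem_union.1 he with he | he <;> rcases Finset.mem_union.1 he' with he' | he'
    · exact h.laminar e he e' he'
    · exact Or.inr (Or.inl (hd.mono (h.subset e he) (h'.subset e' he')))
    · exact Or.inr (Or.inl (hd.symm.mono (h'.subset e he) (h.subset e' he')))
    · exact h'.laminar e he e' he'
  · refine Finset.card_union_of_disjoint (Finset.disjoint_left.2 fun e he he' => ?_)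
    exact Set.disjoint_left.1 hd (h.mem e he).1 (h'.mem e he').1

/-- The new difference is `N` itself, which contains the vertices and the differences of all earlier
pairs. Since `u ∉ N`, the new pair is distinct from them. -/
theorem IsRungFamily.insert (h : IsRungFamily G H F m N U) (hNM : N ⊆ M) {u w : V}
    (hN : nbrDiff G u w = N) (hmod : IsModule H N) (hm : m ≤ N.ncard) (hu : u ∈ M) (hw : w ∈ M)
    (huF : u ∉ F) (hwF : w ∉ F) (huw : ¬ G.Adj u w) :
    ∃ W, IsRungFamily G H F m M W ∧ W.card = U.card + 1 := by
  classical
  have huN : u ∉ N := by rw [← hN]; exact fun e => G.loopless.irrefl _ e.1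
  refine ⟨Insert.insert (u, w) U, ⟨?_, ?_, ?_, ?_, ?_⟩, ?_⟩
  · intro e he
    rcases Finset.mem_insert.1 he with rfl | he
    · exact ⟨hu, hw, huF, hwF, huw⟩
    · exact (h.mono hNM).mem e he
  · intro e he
    rcases Finset.mem_insert.1 he with rfl | he
    · rwa [hN]
    · exact (h.mono hNM).subset e he
  · intro e he
    rcases Finset.mem_insert.1 he with rfl | he
    · rwa [hN]
    · exact h.isModule e he
  · intro e he
    rcases Finset.mem_insert.1 he with rfl | he
    · rwa [hN]
    · exact h.card e he
  · intro e he e' he'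
    rcases Finset.mem_insert.1 he with rfl | he <;> rcases Finset.mem_insert.1 he' with rfl | he'
    · exact Or.inl rfl
    · rw [hN]
      exact Or.inr (Or.inr (Or.inr ⟨h.subset e' he', (h.mem e' he').1, (h.mem e' he').2.1⟩))
    · rw [hN]
      exact Or.inr (Or.inr (Or.inl ⟨h.subset e he, (h.mem e he).1, (h.mem e he).2.1⟩))
    · exact h.laminar e he e' he'
  · exact Finset.card_insert_of_notMem fun he => huN (h.mem _ he).1

/-- Modules of the edited graph without edited vertices are small and independent. -/
theorem small_of_unedited (hF : ∀ u ∉ F, ∀ y, (G.Adj u y ↔ H.Adj u y)) (hH : P4Free H)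
    (h₁ : ∀ X, IsModule G X → P4FreeOn G X → (∀ x ∈ X, ∀ y ∈ X, ¬ G.Adj x y) ∧ X.ncard ≤ k + 1)
    {X : Set V} (hX : IsModule H X) (hXF : Disjoint X F) :
    (∀ x ∈ X, ∀ y ∈ X, ¬ G.Adj x y) ∧ X.ncard ≤ k + 1 := by
  have hXF' : ∀ x ∈ X, ∀ y, (G.Adj x y ↔ H.Adj x y) :=
    fun x hx => hF x (Set.disjoint_left.1 hXF hx)
  refine h₁ X ?_ ((hH.on X).congr fun a ha b _ => hXF' a ha b)
  intro x hx y hy z hz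
  rw [hXF' x hx, hXF' y hy]
  exact hX x hx y hy z hz

/-- The two bounds on the number of vertices in terms of the number of rungs. -/
theorem exists_rungs [Finite V] (hF : ∀ u ∉ F, ∀ y, (G.Adj u y ↔ H.Adj u y)) (hH : P4Free H)
    (h₁ : ∀ X, IsModule G X → P4FreeOn G X → (∀ x ∈ X, ∀ y ∈ X, ¬ G.Adj x y) ∧ X.ncard ≤ k + 1)
    (n : ℕ) : ∀ M, M.ncard ≤ n → IsModule H M → (M ∩ F).Nonempty →
      (∃ U, IsRungFamily G H F (2 * k + 2) M U ∧
        M.ncard + 3 * (k + 1) ≤ (k + 1) * (2 * U.card + 8 * (M ∩ F).ncard)) ∧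
      ((∀ P Q, ¬ Split H True M P Q) → ∃ U, IsRungFamily G H F (2 * k + 2) M U ∧
        M.ncard + 4 * (k + 1) ≤ (k + 1) * (2 * U.card + 8 * (M ∩ F).ncard)) := by
  induction n with
  | zero =>
    intro M hM _ hne
    have := (Set.ncard_pos (Set.toFinite M)).2 (hne.mono Set.inter_subset_left)
    omega
  | succ n ih =>
    -- Peeling loses at most `k + 1` vertices, because the peeled set is a module of `H` that avoids
    -- `F`.
    have hpeel : ∀ (b : Prop) M, IsModule H M → (M ∩ F).Nonempty → ∃ X N : Set V, X ⊆ M ∧ N ⊆ M ∧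
        (∀ x ∈ M, x ∈ X ∨ x ∈ N) ∧ Disjoint X F ∧
        (∀ x ∈ X, ∀ y ∈ X, ¬ G.Adj x y) ∧ M.ncard = X.ncard + N.ncard ∧
        X.ncard ≤ k + 1 ∧ IsModule H N ∧ N ∩ F = M ∩ F ∧ (X = ∅ → N = M) ∧
        (X.Nonempty → Split H b M X N) ∧
        ∀ P Q, Split H b N P Q → (P ∩ F).Nonempty ∧ (Q ∩ F).Nonempty := by
      intro b M hM hne
      obtain ⟨X, N, hXN, hd, hXF, hs, hPQ⟩ := exists_peel (H := H) b F hne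
      have hu : ∀ x ∈ M, x ∈ X ∨ x ∈ N := fun x hx => by rwa [← hXN] at hx
      have hmods : IsModule H X ∧ IsModule H N := by
        rcases X.eq_empty_or_nonempty with rfl | hX
        · rw [Set.empty_union] at hXN
          exact ⟨fun x hx => absurd hx (by simp), hXN ▸ hM⟩
        · exact ⟨(hs hX).isModule_left hM, (hs hX).isModule_right hM⟩
      obtain ⟨hi, hc⟩ := small_of_unedited hF hH h₁ hmods.1 hXF
      refine ⟨X, N, hXN ▸ Set.subset_union_left, hXN ▸ Set.subset_union_right, hu, hXF, hi, ?_, hc,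
        hmods.2, ?_, ?_, hs, hPQ⟩
      · rw [← hXN, Set.ncard_union_eq hd]
      · rw [← hXN, Set.union_inter_distrib_right, Set.disjoint_iff_inter_eq_empty.1 hXF,
          Set.empty_union]
      · rintro rfl
        rwa [Set.empty_union] at hXN
    -- Two parts that both meet `F` bring a slack of `3 * (k + 1)` each. Their sum `6 * (k + 1)`
    -- pays for up to two peelings and leaves the `4 * (k + 1)` that is claimed.
    have hcomb : ∀ (b : Prop) N P Q, N.ncard ≤ n + 1 → IsModule H N → Split H b N P Q →
        (P ∩ F).Nonempty → (Q ∩ F).Nonempty → ∃ U, IsRungFamily G H F (2 * k + 2) N U ∧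
          N.ncard + 6 * (k + 1) ≤ (k + 1) * (2 * U.card + 8 * (N ∩ F).ncard) := by
      intro b N P Q hN hNm hs hP hQ
      have := hs.ncard_left_lt
      have := hs.ncard_right_lt
      obtain ⟨U, hU, hUc⟩ := (ih P (by omega) (hs.isModule_left hNm) hP).1
      obtain ⟨U', hU', hUc'⟩ := (ih Q (by omega) (hs.isModule_right hNm) hQ).1
      obtain ⟨W, hW, hWc⟩ := hU.union hU' hs.disjoint
      have hF' : (N ∩ F).ncard = (P ∩ F).ncard + (Q ∩ F).ncard := by
        rw [← hs.union, Set.union_inter_distrib_right, Set.ncard_union_eq]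
        exact hs.disjoint.mono Set.inter_subset_left Set.inter_subset_left
      refine ⟨W, hs.union ▸ hW, ?_⟩
      rw [hs.ncard, hWc, hF']
      linarith
    have hC : ∀ M, M.ncard ≤ n + 1 → IsModule H M → (M ∩ F).Nonempty →
        (∀ P Q, ¬ Split H True M P Q) → ∃ U, IsRungFamily G H F (2 * k + 2) M U ∧
          M.ncard + 4 * (k + 1) ≤ (k + 1) * (2 * U.card + 8 * (M ∩ F).ncard) := by
      intro M hMn hM hne hser
      -- The coefficient `8` is `4 + 4`: one vertex of `F` pays for a small set and for the slack.
      -- If `M` is larger, two peelings leave more than `2 * k + 2` vertices, as needed for a rung.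
      by_cases hsmall : M.ncard ≤ 4 * (k + 1)
      · refine ⟨∅, isRungFamily_empty, ?_⟩
        have h1 : 1 ≤ (M ∩ F).ncard := (Set.ncard_pos (Set.toFinite _)).2 hne
        have h2 := Nat.mul_le_mul_left (k + 1) h1
        simp only [Finset.card_empty]
        linarith
      obtain ⟨X, N, hXM, hNM, hXN, hXF, hXi, hMc, hXc, hNm, hNF, hXe, hXs, hXPQ⟩ :=
        hpeel False M hM hne
      by_cases hpar : ∃ P Q, Split H False N P Q
      · obtain ⟨P, Q, hs⟩ := hpar
        obtain ⟨hP, hQ⟩ := hXPQ P Q hs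
        obtain ⟨U, hU, hUc⟩ := hcomb False N P Q (by omega) hNm hs hP hQ
        refine ⟨U, hU.mono hNM, ?_⟩
        rw [← hNF]
        linarith
      push Not at hpar
      obtain ⟨Y, L, hYN, hLN, hYL, hYF, hYi, hNc, hYc, hLm, hLF, hYe, hYs, hYPQ⟩ :=
        hpeel True N hNm (hNF ▸ hne)
      by_cases hser' : ∃ P Q, Split H True L P Q
      · obtain ⟨P, Q, hs⟩ := hser'
        obtain ⟨hP, hQ⟩ := hYPQ P Q hs
        obtain ⟨U, hU, hUc⟩ := hcomb True L P Q (by omega) hLm hs hP hQ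
        refine ⟨U, hU.mono (hLN.trans hNM), ?_⟩
        rw [← hNF, ← hLF]
        linarith
      push Not at hser'
      have split_iff : ∀ b A P Q, Split H b A P Q → Split H True A P Q ∨ Split H False A P Q := by
        intro b A P Q hs
        by_cases hb : b
        · left; simpa only [hb] using hs
        · right; simpa only [hb] using hs
      -- An empty `Y` would leave `L = N`, with no split of either kind, although a cograph with two
      -- vertices splits. The same argument with `N = M` applies to `X`.
      have hYne : Y.Nonempty := by
        by_contra hY
        have hLN' := hYe (Set.not_nonempty_iff_eq_empty.1 hY)
        obtain ⟨b, P, Q, hs⟩ := exists_split (hH.on L) (by omega)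
        rcases split_iff _ _ _ _ hs with hs | hs
        · exact hser' P Q hs
        · exact hpar P Q (hLN' ▸ hs)
      have hXne : X.Nonempty := by
        by_contra hX
        have hNM' := hXe (Set.not_nonempty_iff_eq_empty.1 hX)
        obtain ⟨b, P, Q, hs⟩ := exists_split (hH.on N) (by omega)
        rcases split_iff _ _ _ _ hs with hs | hs
        · exact hser P Q (hNM' ▸ hs)
        · exact hpar P Q hs
      have hXpos := (Set.ncard_pos (Set.toFinite X)).2 hXne
      have hXs := hXs hXne
      have hYs := hYs hYne
      obtain ⟨u, hu⟩ := hYne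
      obtain ⟨w, hw⟩ := hXne
      have huF : u ∉ F := Set.disjoint_left.1 hYF hu
      have hwF : w ∉ F := Set.disjoint_left.1 hXF hw
      have huw : ¬ G.Adj u w := by
        rw [G.adj_comm, hF w hwF]
        exact (hXs.adj w hw u (hYN hu)).1
      -- `u` and `w` agree outside the module `M`. Inside it, `w` has no neighbours in `N`, while
      -- `u` is joined to `L` but has none in `X` or in the independent set `Y`.
      have hL : nbrDiff G u w = L := by
        ext x
        change G.Adj u x ∧ ¬ G.Adj w x ↔ x ∈ L
        rw [hF u huF, hF w hwF]
        constructor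
        · rintro ⟨hux, hwx⟩
          by_cases hxM : x ∈ M
          · rcases hXN x hxM with hx | hx
            · exact ((hXs.adj x hx u (hYN hu)).1 hux.symm).elim
            · rcases hYL x hx with hx | hx
              · rw [← hF u huF] at hux
                exact (hYi u hu x hx hux).elim
              · exact hx
          · exact (hwx ((hM u (hNM (hYN hu)) w (hXM hw) x hxM).1 hux)).elim
        · exact fun hx => ⟨(hYs.adj u hu x hx).2 trivial, (hXs.adj w hw x (hLN hx)).1⟩
      -- `L` has no join split, so the stronger bound passes down unchanged, and the new rung pays
      -- `2 * (k + 1)` for `X` and `Y`.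
      obtain ⟨U, hU, hUc⟩ := (ih L (by omega) hLm (by rw [hLF, hNF]; exact hne)).2 hser'
      obtain ⟨W, hW, hWc⟩ := hU.insert (hLN.trans hNM) hL hLm (by omega) (hNM (hYN hu)) (hXM hw)
        huF hwF huw
      refine ⟨W, hW, ?_⟩
      rw [hWc, ← hNF, ← hLF]
      linarith
    refine fun M hMn hM hne => ⟨?_, hC M hMn hM hne⟩
    obtain ⟨X, N, hXM, hNM, hXN, hXF, hXi, hMc, hXc, hNm, hNF, hXe, hXs, hXPQ⟩ :=
      hpeel True M hM hne
    -- In general one peeling of joined vertices comes before the case without join splits. This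
    -- costs one `k + 1` and turns the slack of `4` into `3`.
    by_cases hser : ∃ P Q, Split H True N P Q
    · obtain ⟨P, Q, hs⟩ := hser
      obtain ⟨hP, hQ⟩ := hXPQ P Q hs
      obtain ⟨U, hU, hUc⟩ := hcomb True N P Q (by omega) hNm hs hP hQ
      refine ⟨U, hU.mono hNM, ?_⟩
      rw [← hNF]
      linarith
    · push Not at hser
      obtain ⟨U, hU, hUc⟩ := hC N (by omega) hNm (hNF ▸ hne) hser
      refine ⟨U, hU.mono hNM, ?_⟩
      rw [← hNF]
      linarith

end

/-! ### The number of rungs and the size of irreducible positive instances -/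

theorem exists_strictMono_enum {α : Type*} [Nonempty α] (Q : Finset α) (f : α → ℕ)
    (hf : Set.InjOn f (Q : Set α)) (m : ℕ) (hm : m ≤ Q.card) :
    ∃ g : ℕ → α, (∀ i < m, g i ∈ Q) ∧ ∀ i j, i < j → j < m → f (g i) < f (g j) := by
  classical
  have hcard : (Q.image f).card = Q.card := Finset.card_image_of_injOn hf
  have hex : ∀ i : ℕ, ∃ a, ∀ h : i < m, a ∈ Q ∧
      f a = (Q.image f).orderEmbOfFin hcard ⟨i, h.trans_le hm⟩ := by
    intro i
    by_cases h : i < m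
    · obtain ⟨a, ha, ha'⟩ := Finset.mem_image.1
        ((Q.image f).orderEmbOfFin_mem hcard ⟨i, h.trans_le hm⟩)
      exact ⟨a, fun _ => ⟨ha, ha'⟩⟩
    · exact ⟨Classical.arbitrary α, fun h' => absurd h' h⟩
  choose g hg using hex
  refine ⟨g, fun i hi => (hg i hi).1, fun i j hij hj => ?_⟩
  rw [(hg i (hij.trans hj)).2, (hg j hj).2]
  exact ((Q.image f).orderEmbOfFin hcard).strictMono hij

/-- Summation by parts: the extreme case has eight elements of every value up to `k`. The term `8 -
|E| / k` records the unused capacity and makes the induction go through. -/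
theorem sum_inv_le_harmonic {α : Type*} (k : ℕ) (hk : 1 ≤ k) : ∀ (E : Finset α) (t : α → ℕ),
    (∀ e ∈ E, 1 ≤ t e ∧ t e ≤ k) → (∀ s, 1 ≤ s → s ≤ k → {e ∈ E | t e ≤ s}.card ≤ 8 * s) →
    ∑ e ∈ E, (t e : ℚ)⁻¹ + 8 - (E.card : ℚ) / k ≤ 8 * harmonic k := by
  induction k, hk using Nat.le_induction with
  | base =>
    intro E t h _
    have : ∑ e ∈ E, (t e : ℚ)⁻¹ = ∑ e ∈ E, (1 : ℚ) := Finset.sum_congr rfl fun e he => by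
      have := h e he
      rw [show t e = 1 by omega]
      simp
    rw [this]
    simp [harmonic]
  | succ k hk ih =>
    intro E t h hc
    have ih' := ih {e ∈ E | t e ≤ k} t
      (fun e he => ⟨(h e (Finset.mem_filter.1 he).1).1, (Finset.mem_filter.1 he).2⟩)
      (fun s hs hsk => by
        rw [Finset.filter_filter]
        refine le_trans (Finset.card_le_card ?_) (hc s hs (by omega))
        intro e he
        simp only [Finset.mem_filter] at he ⊢
        exact ⟨he.1, he.2.2⟩)
    have h1 : ∑ e ∈ E, (t e : ℚ)⁻¹ = ∑ e ∈ E with t e ≤ k, (t e : ℚ)⁻¹ +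
        ({e ∈ E | ¬ t e ≤ k}.card : ℚ) / ((k + 1 : ℕ) : ℚ) := by
      rw [← Finset.sum_filter_add_sum_filter_not E (fun e => t e ≤ k)]
      congr 1
      rw [Finset.sum_congr rfl (g := fun _ => ((k + 1 : ℕ) : ℚ)⁻¹), Finset.sum_const,
        nsmul_eq_mul, div_eq_mul_inv]
      intro e he
      have h2 := h e (Finset.mem_filter.1 he).1
      have h3 := (Finset.mem_filter.1 he).2
      rw [show t e = k + 1 by omega]
    have h2 : (E.card : ℚ) = ({e ∈ E | t e ≤ k}.card : ℚ) + ({e ∈ E | ¬ t e ≤ k}.card : ℚ) := by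
      rw [← Nat.cast_add, Finset.card_filter_add_card_filter_not]
    have h3 : ({e ∈ E | t e ≤ k}.card : ℚ) ≤ 8 * k := by
      exact_mod_cast hc k hk (by omega)
    have hk0 : (0 : ℚ) < k := by exact_mod_cast hk
    rw [h1, h2, harmonic_succ]
    generalize ({e ∈ E | t e ≤ k}.card : ℚ) = a at *
    generalize ({e ∈ E | ¬ t e ≤ k}.card : ℚ) = b at *
    have h4 : a / k - a / ((k + 1 : ℕ) : ℚ) ≤ 8 * ((k + 1 : ℕ) : ℚ)⁻¹ := by
      push_cast
      rw [div_sub_div _ _ hk0.ne' (by positivity), ← div_eq_mul_inv,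
        div_le_div_iff₀ (by positivity) (by positivity)]
      nlinarith
    rw [add_div]
    linarith

/-- The number of pairs of positive integers with product at most `k`. -/
def divisorSum (k : ℕ) : ℕ := ∑ a ∈ Finset.range k, k / (a + 1)

/-- Rounding down each of the `k` quotients costs less than one. `divisorSum` thus replaces `k *
harmonic k` by an integer that bounded sums can compute. -/
theorem mul_harmonic_le (k : ℕ) : (k : ℚ) * harmonic k ≤ divisorSum k + k := by
  rw [harmonic, Finset.mul_sum, divisorSum]
  push_cast
  have : (k : ℚ) = ∑ _a ∈ Finset.range k, (1 : ℚ) := by simp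
  conv_rhs => rw [this]
  rw [← Finset.sum_add_distrib]
  refine Finset.sum_le_sum fun a _ => ?_
  rw [← div_eq_mul_inv, div_le_iff₀ (by positivity)]
  have h := Nat.lt_div_mul_add (a := k) (b := a + 1) (by omega)
  have h' : k ≤ (k / (a + 1) + 1) * (a + 1) := by
    rw [add_mul, one_mul]; exact h.le
  exact_mod_cast h'

theorem divisorSum_le (k : ℕ) : (divisorSum k : ℚ) ≤ k * harmonic k := by
  rw [harmonic, Finset.mul_sum, divisorSum]
  push_cast
  refine Finset.sum_le_sum fun a _ => ?_
  rw [← div_eq_mul_inv]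
  exact_mod_cast Nat.cast_div_le (α := ℚ) (m := k) (n := a + 1)

theorem divisorSum_mono {j k : ℕ} (h : j ≤ k) : divisorSum j ≤ divisorSum k := by
  unfold divisorSum
  refine (Finset.sum_le_sum fun a _ => Nat.div_le_div_right h).trans ?_
  exact Finset.sum_le_sum_of_subset (Finset.range_mono h)

section

variable {V : Type*} {G H : SimpleGraph V} {F : Set V} {k : ℕ} {U : Finset (V × V)}

theorem notMem_nbrDiff_left (u w : V) : u ∉ nbrDiff G u w :=
  fun h => G.loopless.irrefl _ h.1

theorem notMem_nbrDiff_right {u w : V} (h : ¬ G.Adj u w) : w ∉ nbrDiff G u w :=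
  fun h' => h h'.1

/-- The neighbourhood differences of rungs crossed by one edited pair form a chain, and few of
them have a given small number of edited pairs. -/
theorem card_rungs_le [Finite V] (hF : ∀ u ∉ F, ∀ y, (G.Adj u y ↔ H.Adj u y))
    (hFc : F.ncard ≤ 2 * k) (hU : IsRungFamily G H F (2 * k + 2) Set.univ U)
    (h₃ : ∀ t a₀ u₁ w₁ u₂ w₂ u₃ w₃, ¬ G.Adj u₃ w₃ →
      Nested G k t a₀ (nbrDiff G u₁ w₁) (nbrDiff G u₂ w₂) (nbrDiff G u₃ w₃) →
      ∀ x ∈ nbrDiff G u₁ w₁, ∀ y ∉ nbrDiff G u₃ w₃, (G.Adj x y ↔ G.Adj a₀ y))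
    {x y : V} (hxy : (x, y) ∈ diff G H) {s : ℕ} (hs : s ≤ k) (Q : Finset (V × V)) (hQU : Q ⊆ U)
    (hQ : ∀ e ∈ Q, (x, y) ∈ cross G H (nbrDiff G e.1 e.2) ∧
      (cross G H (nbrDiff G e.1 e.2)).ncard ≤ s) : Q.card ≤ 6 * s + 2 := by
  by_contra! hcard
  -- All these sets contain `x`, so no two are disjoint and laminarity makes them a chain.
  have hnest : ∀ e ∈ Q, ∀ e' ∈ Q, e = e' ∨
      (nbrDiff G e.1 e.2 ⊆ nbrDiff G e'.1 e'.2 ∧ e.1 ∈ nbrDiff G e'.1 e'.2 ∧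
        e.2 ∈ nbrDiff G e'.1 e'.2) ∨
      (nbrDiff G e'.1 e'.2 ⊆ nbrDiff G e.1 e.2 ∧ e'.1 ∈ nbrDiff G e.1 e.2 ∧
        e'.2 ∈ nbrDiff G e.1 e.2) := by
    intro e he e' he'
    rcases hU.laminar e (hQU he) e' (hQU he') with h | h | h
    · exact Or.inl h
    · exact (Set.disjoint_left.1 h (hQ e he).1.2.1 (hQ e' he').1.2.1).elim
    · exact Or.inr h
  have hlt : ∀ e e' : V × V, nbrDiff G e.1 e.2 ⊆ nbrDiff G e'.1 e'.2 →
      e.1 ∈ nbrDiff G e'.1 e'.2 → (nbrDiff G e.1 e.2).ncard < (nbrDiff G e'.1 e'.2).ncard :=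
    fun e e' h h' => Set.ncard_lt_ncard ⟨h, fun h'' => notMem_nbrDiff_left _ _ (h'' h')⟩
  have hinj : Set.InjOn (fun e : V × V => (nbrDiff G e.1 e.2).ncard) (Q : Set (V × V)) := by
    intro e he e' he' hee
    rcases hnest e he e' he' with h | h | h
    · exact h
    · exact absurd hee (hlt e e' h.1 h.2.1).ne
    · exact absurd hee (hlt e' e h.1 h.2.1).ne'
  have : Nonempty (V × V) := ⟨(x, y)⟩
  -- The sets numbered `0`, `3 * s + 1` and `6 * s + 2` will be the nested ones, with the vertices
  -- of `3 * s + 1` rungs in each layer between them.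
  obtain ⟨g, hgQ, hg⟩ := exists_strictMono_enum Q _ hinj (6 * s + 3) (by omega)
  set A : ℕ → Set V := fun i => nbrDiff G (g i).1 (g i).2 with hA
  have hgA : ∀ i j, i < j → j < 6 * s + 3 → A i ⊆ A j ∧ (g i).1 ∈ A j ∧ (g i).2 ∈ A j := by
    intro i j hij hj
    have h1 := hg i j hij hj
    rcases hnest (g i) (hgQ i (by omega)) (g j) (hgQ j hj) with h | h | h
    · rw [h] at h1; exact absurd h1 (lt_irrefl _)
    · exact h
    · exact absurd (hlt _ _ h.1 h.2.1) (by simpa using h1.le)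
  have hmono : ∀ i j, i ≤ j → j < 6 * s + 3 → A i ⊆ A j := by
    intro i j hij hj
    rcases hij.eq_or_lt with rfl | h
    · exact subset_rfl
    · exact (hgA i j h hj).1
  have hmem := fun i (hi : i < 6 * s + 3) => hU.mem (g i) (hQU (hgQ i hi))
  have hmod : ∀ i, i < 6 * s + 3 → IsModule H (A i) := fun i hi => hU.isModule _ (hQU (hgQ i hi))
  have hA0 : 2 * k + 2 ≤ (A 0).ncard := hU.card _ (hQU (hgQ 0 (by omega)))
  -- The smallest set has at least `2 * k + 2` vertices, more than `F`, so it contains an untouched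
  -- one.
  obtain ⟨a₀, ha₀, ha₀F⟩ := Set.exists_mem_notMem_of_ncard_lt_ncard (s := F) (t := A 0) (by omega)
  -- `A i` is a module of `H` and `a₀` is untouched, so a vertex of `A i` that differs in `G` from
  -- `a₀` towards the outside does so through an edit.
  have hdef : ∀ i, i < 6 * s + 3 → (defect G a₀ (A i)).ncard ≤ s := by
    intro i hi
    refine le_trans (Set.ncard_le_ncard ?_) (hQ (g i) (hgQ i hi)).2
    rintro ⟨p, q⟩ ⟨hp, hq, hpq⟩
    refine ⟨?_, hp, hq⟩
    dsimp only at hp hq hpq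
    rw [mem_diff]
    rwa [hF a₀ ha₀F, ← hmod i hi p hp a₀ (hmono 0 i (by omega) hi ha₀) q hq] at hpq
  have hout : ∀ v ∈ A (6 * s + 2), v ∉ F → ∀ z ∉ A (6 * s + 2), (G.Adj v z ↔ G.Adj a₀ z) := by
    intro v hv hvF z hz
    rw [hF v hvF, hF a₀ ha₀F]
    exact hmod _ (by omega) v hv a₀ (hmono 0 _ (by omega) (by omega) ha₀) z hz
  have hnot : ∀ i j, i ≤ j → j < 6 * s + 3 → (g j).1 ∉ A i ∧ (g j).2 ∉ A i := by
    intro i j hij hj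
    exact ⟨fun h => notMem_nbrDiff_left _ _ (hmono i j hij hj h),
      fun h => notMem_nbrDiff_right (hmem j hj).2.2.2.2 (hmono i j hij hj h)⟩
  have hinj₁ : ∀ i < 6 * s + 3, ∀ j < 6 * s + 3, (g i).1 = (g j).1 → i = j := by
    intro i hi j hj h
    rcases lt_trichotomy i j with hij | hij | hij
    · exact absurd (hgA i j hij hj).2.1 (h ▸ (hnot j j le_rfl hj).1)
    · exact hij
    · exact absurd (hgA j i hij hi).2.1 (h ▸ (hnot i i le_rfl hi).1)
  have hinj₂ : ∀ i < 6 * s + 3, ∀ j < 6 * s + 3, (g i).2 = (g j).2 → i = j := by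
    intro i hi j hj h
    rcases lt_trichotomy i j with hij | hij | hij
    · exact absurd (hgA i j hij hj).2.2 (h ▸ (hnot j j le_rfl hj).2)
    · exact hij
    · exact absurd (hgA j i hij hi).2.2 (h ▸ (hnot i i le_rfl hi).2)
  -- The first vertices of the rungs `p, …, p + 3 * s` lie between `A p` and `A q`, are joined to `A
  -- p`, and are untouched. The second vertices play the same role for the non-adjacent layer in
  -- `hl₂`.
  have hl₁ : ∀ p q, q < 6 * s + 3 → p + (3 * s + 1) ≤ q →
      3 * s + 1 ≤ (layer G True a₀ (A p) (A q) (A (6 * s + 2))).ncard := by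
    intro p q hq hpq
    refine Set.le_ncard_of_inj_on_range (fun i => (g (p + i)).1) (fun i hi => ?_) ?_
    · refine ⟨(hgA (p + i) q (by omega) hq).2.1, (hnot p (p + i) (by omega) (by omega)).1, ?_,
        hout _ (hgA (p + i) _ (by omega) (by omega)).2.1 (hmem (p + i) (by omega)).2.2.1⟩
      intro v hv
      simp only [iff_true]
      exact (hmono p (p + i) (by omega) (by omega) hv).1
    · intro i hi j hj h
      have := hinj₁ _ (by omega) _ (by omega) h
      omega
  have hl₂ : ∀ p q, q < 6 * s + 3 → p + (3 * s + 1) ≤ q →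
      3 * s + 1 ≤ (layer G False a₀ (A p) (A q) (A (6 * s + 2))).ncard := by
    intro p q hq hpq
    refine Set.le_ncard_of_inj_on_range (fun i => (g (p + i)).2) (fun i hi => ?_) ?_
    · refine ⟨(hgA (p + i) q (by omega) hq).2.2, (hnot p (p + i) (by omega) (by omega)).2, ?_,
        hout _ (hgA (p + i) _ (by omega) (by omega)).2.2 (hmem (p + i) (by omega)).2.2.2.1⟩
      intro v hv
      simp only [iff_false]
      exact (hmono p (p + i) (by omega) (by omega) hv).2
    · intro i hi j hj h
      have := hinj₂ _ (by omega) _ (by omega) h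
      omega
  have hN : Nested G k s a₀ (A 0) (A (3 * s + 1)) (A (6 * s + 2)) :=
    { mem := ha₀
      subset₁₂ := hmono _ _ (by omega) (by omega)
      subset₂₃ := hmono _ _ (by omega) (by omega)
      card := by omega
      defect₁ := hdef _ (by omega)
      defect₂ := hdef _ (by omega)
      defect₃ := hdef _ (by omega)
      layer₁₂_true := hl₁ _ _ (by omega) (by omega)
      layer₁₂_false := hl₂ _ _ (by omega) (by omega)
      layer₂₃_true := hl₁ _ _ (by omega) (by omega)
      layer₂₃_false := hl₂ _ _ (by omega) (by omega) }
  have hx0 : x ∈ A 0 := (hQ _ (hgQ 0 (by omega))).1.2.1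
  have hyl : y ∉ A (6 * s + 2) := (hQ _ (hgQ _ (by omega))).1.2.2
  have h := h₃ s a₀ _ _ _ _ _ _ (hmem (6 * s + 2) (by omega)).2.2.2.2 hN x hx0 y hyl
  -- Irreducibility makes `x` agree in `G` with `a₀` at `y`, and the module of `H` makes it agree in
  -- `H`. Hence the pair is not edited after all.
  rw [mem_diff, h, hF a₀ ha₀F,
    hmod _ (by omega) a₀ (hmono 0 (6 * s + 2) (by omega) (by omega) ha₀) x
      (hmono 0 (6 * s + 2) (by omega) (by omega) hx0) y hyl] at hxy
  exact hxy Iff.rfl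

/-- The number of rungs. -/
theorem card_rungs_le_divisorSum [Finite V] (hF : ∀ u ∉ F, ∀ y, (G.Adj u y ↔ H.Adj u y))
    (hFc : F.ncard ≤ 2 * k) (hk : (diff G H).ncard ≤ 2 * k)
    (hU : IsRungFamily G H F (2 * k + 2) Set.univ U)
    (h₂ : ∀ u w, ¬ G.Adj u w → IsModule G (nbrDiff G u w) → (nbrDiff G u w).ncard ≤ k + 1)
    (h₃ : ∀ t a₀ u₁ w₁ u₂ w₂ u₃ w₃, ¬ G.Adj u₃ w₃ →
      Nested G k t a₀ (nbrDiff G u₁ w₁) (nbrDiff G u₂ w₂) (nbrDiff G u₃ w₃) →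
      ∀ x ∈ nbrDiff G u₁ w₁, ∀ y ∉ nbrDiff G u₃ w₃, (G.Adj x y ↔ G.Adj a₀ y)) :
    U.card ≤ 16 * (divisorSum k + k) := by
  classical
  have := Fintype.ofFinite V
  set t : V × V → ℕ := fun e => (cross G H (nbrDiff G e.1 e.2)).ncard with ht
  -- With no crossing edit the difference would be a module of `G`, and `h₂` would limit it to `k +
  -- 1` vertices.
  have ht1 : ∀ e ∈ U, 1 ≤ t e := by
    intro e he
    rw [ht, Nat.one_le_iff_ne_zero]
    intro h0
    rw [Set.ncard_eq_zero] at h0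
    have hm : IsModule G (nbrDiff G e.1 e.2) := by
      have heq : ∀ x ∈ nbrDiff G e.1 e.2, ∀ z ∉ nbrDiff G e.1 e.2, (G.Adj x z ↔ H.Adj x z) := by
        intro x hx z hz
        by_contra hn
        have : (x, z) ∈ cross G H (nbrDiff G e.1 e.2) := ⟨hn, hx, hz⟩
        rw [h0] at this
        exact this
      intro x hx y hy z hz
      rw [heq x hx z hz, heq y hy z hz]
      exact hU.isModule e he x hx y hy z hz
    have h1 := h₂ _ _ (hU.mem e he).2.2.2.2 hm
    have h2 := hU.card e he
    omega
  have htk : ∀ e, t e ≤ k := by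
    intro e
    have := ncard_diff_eq G H (nbrDiff G e.1 e.2)
    simp only [ht]
    omega
  rcases U.eq_empty_or_nonempty with rfl | ⟨e₀, he₀⟩
  · simp
  have hk1 : 1 ≤ k := (ht1 e₀ he₀).trans (htk e₀)
  have key : (U.card : ℚ) ≤ (2 * k) * (8 * harmonic k) := by
    -- Double counting: every rung gives the weight `1 / t e` to each of its `t e` crossing edits.
    have h1 : (U.card : ℚ) = ∑ e ∈ U, ∑ p ∈ (diff G H).toFinset,
        if p ∈ cross G H (nbrDiff G e.1 e.2) then (t e : ℚ)⁻¹ else 0 := by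
      rw [Finset.card_eq_sum_ones, Nat.cast_sum]
      refine Finset.sum_congr rfl fun e he => ?_
      rw [← Finset.sum_filter, Finset.sum_const, nsmul_eq_mul]
      have : {p ∈ (diff G H).toFinset | p ∈ cross G H (nbrDiff G e.1 e.2)}.card = t e := by
        rw [← Set.ncard_coe_finset]
        congr 1
        ext p
        simp only [Finset.coe_filter, Set.mem_toFinset, Set.mem_ofPred_eq]
        exact ⟨fun h => h.2, fun h => ⟨h.1, h⟩⟩
      rw [this]
      have := ht1 e he
      rw [mul_inv_cancel₀ (by positivity)]
      simp
    rw [h1, Finset.sum_comm]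
    have h2 : ∀ p ∈ (diff G H).toFinset, (∑ e ∈ U,
        if p ∈ cross G H (nbrDiff G e.1 e.2) then (t e : ℚ)⁻¹ else 0) ≤ 8 * harmonic k := by
      rintro ⟨x, y⟩ hp
      rw [Set.mem_toFinset] at hp
      rw [← Finset.sum_filter]
      have hcount : ∀ s, 1 ≤ s → s ≤ k →
          {e ∈ {e ∈ U | (x, y) ∈ cross G H (nbrDiff G e.1 e.2)} | t e ≤ s}.card ≤ 8 * s := by
        intro s hs hsk
        -- `6 * s + 2 ≤ 8 * s` as `s` is positive.
        refine (card_rungs_le hF hFc hU h₃ hp hsk _ ?_ ?_).trans (by omega)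
        · exact (Finset.filter_subset _ _).trans (Finset.filter_subset _ _)
        · intro e he
          simp only [Finset.mem_filter] at he
          exact ⟨he.1.2, he.2⟩
      have h3 := sum_inv_le_harmonic k hk1 {e ∈ U | (x, y) ∈ cross G H (nbrDiff G e.1 e.2)} t
        (fun e he => ⟨ht1 e (Finset.mem_filter.1 he).1, htk e⟩) hcount
      have h4 := hcount k hk1 le_rfl
      rw [Finset.filter_true_of_mem (fun e _ => htk e)] at h4
      have h5 : (({e ∈ U | (x, y) ∈ cross G H (nbrDiff G e.1 e.2)}.card : ℕ) : ℚ) / k ≤ 8 := by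
        rw [div_le_iff₀ (by exact_mod_cast hk1)]
        exact_mod_cast h4
      linarith
    refine (Finset.sum_le_card_nsmul _ _ _ h2).trans ?_
    rw [nsmul_eq_mul, ← Set.ncard_eq_toFinset_card']
    have : (0 : ℚ) ≤ harmonic k := by
      unfold harmonic; positivity
    gcongr
    exact_mod_cast hk
  have h6 := mul_harmonic_le k
  have h7 : (U.card : ℚ) ≤ 16 * (divisorSum k + k) := by nlinarith
  exact_mod_cast h7

end

/-- The size bound of the kernel before padding. -/
def kernelBound (k : ℕ) : ℕ := (k + 1) * (32 * divisorSum k + 48 * k + 1)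

theorem kernelBound_mono {j k : ℕ} (h : j ≤ k) : kernelBound j ≤ kernelBound k := by
  have := divisorSum_mono h
  unfold kernelBound
  gcongr

/-- The three hypotheses are the common consequences of being reduced and of being irreducible for
the algorithm, so that both parts of the main theorem rest on this bound. -/
theorem card_le_kernelBound {V : Type*} [Fintype V] {G : SimpleGraph V} {k : ℕ}
    (hpos : CographEditable G k)
    (h₁ : ∀ X, IsModule G X → P4FreeOn G X → (∀ x ∈ X, ∀ y ∈ X, ¬ G.Adj x y) ∧ X.ncard ≤ k + 1)
    (h₂ : ∀ u w, ¬ G.Adj u w → IsModule G (nbrDiff G u w) → (nbrDiff G u w).ncard ≤ k + 1)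
    (h₃ : 1 ≤ k → ∀ t a₀ u₁ w₁ u₂ w₂ u₃ w₃, ¬ G.Adj u₃ w₃ →
      Nested G k t a₀ (nbrDiff G u₁ w₁) (nbrDiff G u₂ w₂) (nbrDiff G u₃ w₃) →
      ∀ x ∈ nbrDiff G u₁ w₁, ∀ y ∉ nbrDiff G u₃ w₃, (G.Adj x y ↔ G.Adj a₀ y)) :
    Fintype.card V ≤ kernelBound k := by
  obtain ⟨H, hH, hk⟩ := (cographEditable_iff G k).1 hpos
  set F : Set V := Prod.fst '' diff G H with hFdef
  have hF : ∀ u ∉ F, ∀ y, (G.Adj u y ↔ H.Adj u y) := by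
    intro u hu y
    by_contra hn
    exact hu ⟨(u, y), hn, rfl⟩
  have hFc : F.ncard ≤ 2 * k := (Set.ncard_image_le).trans hk
  have hmod : IsModule H Set.univ := fun x _ y _ z hz => absurd (Set.mem_univ z) hz
  have hcard : (Set.univ : Set V).ncard = Fintype.card V := by simp
  rcases F.eq_empty_or_nonempty with hF0 | hF0
  -- Without edits the whole vertex set is an untouched module with at most `k + 1` vertices. The
  -- summand `1` in `kernelBound` covers this case when `k = 0`.
  · have h := (small_of_unedited hF hH h₁ hmod (by simp [hF0])).2
    rw [hcard] at h
    refine h.trans ?_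
    unfold kernelBound
    exact Nat.le_mul_of_pos_right _ (by omega)
  · have hk1 : 1 ≤ k := by
      have := (Set.ncard_pos (Set.toFinite F)).2 hF0
      omega
    obtain ⟨U, hU, hUc⟩ := (exists_rungs hF hH h₁ _ Set.univ le_rfl hmod
      (by rwa [Set.univ_inter])).1
    rw [hcard, Set.univ_inter] at hUc
    have h4 := card_rungs_le_divisorSum hF hFc hk hU h₂ (h₃ hk1)
    unfold kernelBound
    -- `32 = 2 * 16`, and `48 = 2 * 16 + 8 * 2`.
    have h5 : (k + 1) * (2 * U.card + 8 * F.ncard) ≤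
        (k + 1) * (32 * divisorSum k + 48 * k) := Nat.mul_le_mul_left _ (by omega)
    rw [mul_add (k + 1) _ 1]
    omega

/-! ### Reduced instances -/

section

variable {V : Type*} {G : SimpleGraph V} {X : Set V} {k t : ℕ}

theorem IsUnionOfComponents.mem_of_adj (h : IsUnionOfComponents G X) {x y : V} (hx : x ∈ X)
    (hxy : G.Adj x y) : y ∈ X := by
  obtain ⟨𝒞, rfl⟩ := h
  simp only [Set.mem_iUnion, SimpleGraph.ConnectedComponent.mem_supp_iff, exists_prop] at hx ⊢
  obtain ⟨c, hc, rfl⟩ := hx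
  exact ⟨_, hc, SimpleGraph.ConnectedComponent.sound hxy.symm.reachable⟩

theorem IsUnionOfComponents.exists_supp_subset (h : IsUnionOfComponents G X) {x : V}
    (hx : x ∈ X) : ∃ c : G.ConnectedComponent, c.supp ⊆ X := by
  obtain ⟨𝒞, rfl⟩ := h
  simp only [Set.mem_iUnion, exists_prop] at hx
  obtain ⟨c, hc, _⟩ := hx
  exact ⟨c, Set.subset_biUnion_of_mem hc⟩

/-- Editing the defects makes every vertex of `X` see the outside as `a₀` does. -/
theorem isTModule_of_defect [Finite V] {a₀ : V} (h : (defect G a₀ X).ncard ≤ t) :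
    IsTModule G t X := by
  classical
  have := Fintype.ofFinite V
  refine ⟨(defect G a₀ X).toFinset.image fun p => s(p.1, p.2), ?_, ?_, ?_⟩
  · intro e he
    obtain ⟨⟨x, z⟩, hp, rfl⟩ := Finset.mem_image.1 he
    rw [Set.mem_toFinset] at hp
    rw [Sym2.mk_isDiag_iff]
    exact fun e => hp.2.1 (e ▸ hp.1)
  · refine Finset.card_image_le.trans ?_
    rwa [← Set.ncard_eq_toFinset_card']
  · have key : ∀ x ∈ X, ∀ z ∉ X, ((editBy G ((defect G a₀ X).toFinset.image
        fun p => s(p.1, p.2))).Adj x z ↔ G.Adj a₀ z) := by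
      intro x hx z hz
      have hne : x ≠ z := fun e => hz (e ▸ hx)
      have hmem : s(x, z) ∈ (defect G a₀ X).toFinset.image (fun p => s(p.1, p.2)) ↔
          ¬ (G.Adj x z ↔ G.Adj a₀ z) := by
        simp only [Finset.mem_image, Set.mem_toFinset, Prod.exists, Sym2.eq_iff]
        constructor
        · rintro ⟨a, b, hab, ⟨rfl, rfl⟩ | ⟨rfl, rfl⟩⟩
          · exact hab.2.2
          · exact absurd hab.1 hz
        · exact fun h => ⟨x, z, ⟨hx, hz, h⟩, Or.inl ⟨rfl, rfl⟩⟩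
      rw [editBy_adj, hmem]
      tauto
    exact fun x hx y hy z hz => (key x hx z hz).trans (key y hy z hz).symm

/-- Three nested sets with few defects and large layers form a nested `t`-module. -/
theorem Nested.isNestedTModule [Finite V] {a₀ u w : V} {A₁ A₂ : Set V} (huw : ¬ G.Adj u w)
    (h : Nested G k t a₀ A₁ A₂ (nbrDiff G u w)) :
    IsNestedTModule G k t A₁ (A₂ \ A₁) (nbrDiff G u w \ A₂)
      {z | z ∉ nbrDiff G u w ∧ G.Adj a₀ z} {z | z ∉ nbrDiff G u w ∧ ¬ G.Adj a₀ z} := by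
  have ha₀ : a₀ ∈ nbrDiff G u w := h.subset₂₃ (h.subset₁₂ h.mem)
  have h12 : A₁ ∪ A₂ \ A₁ = A₂ := Set.union_sdiff_cancel h.subset₁₂
  have h23 : A₂ ∪ nbrDiff G u w \ A₂ = nbrDiff G u w := Set.union_sdiff_cancel h.subset₂₃
  refine ⟨⟨⟨a₀, h.mem⟩, ?_, ?_, ⟨u, notMem_nbrDiff_left u w, ha₀.1.symm⟩,
    ⟨w, notMem_nbrDiff_right huw, fun e => ha₀.2 e.symm⟩⟩, ?_, ?_, isTModule_of_defect h.defect₁,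
    ?_, ?_, h.card, ?_, ?_, ?_, ?_⟩
  · obtain ⟨v, hv⟩ := Set.nonempty_of_ncard_ne_zero
      (Nat.ne_of_gt (Nat.lt_of_lt_of_le (Nat.succ_pos _) h.layer₁₂_true))
    exact ⟨v, hv.1, hv.2.1⟩
  · obtain ⟨v, hv⟩ := Set.nonempty_of_ncard_ne_zero
      (Nat.ne_of_gt (Nat.lt_of_lt_of_le (Nat.succ_pos _) h.layer₂₃_true))
    exact ⟨v, hv.1, hv.2.1⟩
  · simp only [List.pairwise_cons, List.mem_cons, List.not_mem_nil, or_false, forall_eq_or_imp,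
      forall_eq, Set.disjoint_left, false_imp_iff, implies_true, List.Pairwise.nil, and_true]
    refine ⟨⟨fun a ha hb => hb.2 ha, fun a ha hb => hb.2 (h.subset₁₂ ha),
      fun a ha hb => hb.1 (h.subset₂₃ (h.subset₁₂ ha)),
      fun a ha hb => hb.1 (h.subset₂₃ (h.subset₁₂ ha))⟩,
      ⟨fun a ha hb => hb.2 ha.1, fun a ha hb => hb.1 (h.subset₂₃ ha.1),
      fun a ha hb => hb.1 (h.subset₂₃ ha.1)⟩,
      ⟨fun a ha hb => hb.1 ha.1, fun a ha hb => hb.1 ha.1⟩, fun a ha hb => hb.2 ha.2⟩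
  · rw [h12, h23]
    ext z
    simp only [Set.mem_union, Set.mem_ofPred_eq, Set.mem_univ, iff_true]
    tauto
  · rw [h12]; exact isTModule_of_defect h.defect₂
  · rw [h12, h23]; exact isTModule_of_defect h.defect₃
  · refine h.layer₁₂_true.trans (Set.ncard_le_ncard fun v hv => ⟨⟨hv.1, hv.2.1⟩, ?_, ?_⟩)
    · rintro x (hx | hx)
      · exact (hv.2.2.1 x hx).2 trivial
      · exact (hv.2.2.2 x hx.1).2 hx.2
    · exact fun x hx e => hx.2 ((hv.2.2.2 x hx.1).1 e)
  · refine h.layer₁₂_false.trans (Set.ncard_le_ncard fun v hv => ⟨⟨hv.1, hv.2.1⟩, ?_, ?_⟩)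
    · exact fun x hx => (hv.2.2.2 x hx.1).2 hx.2
    · rintro x (hx | hx)
      · exact (hv.2.2.1 x hx).1
      · exact fun e => hx.2 ((hv.2.2.2 x hx.1).1 e)
  · rw [h12]
    refine h.layer₂₃_true.trans (Set.ncard_le_ncard fun v hv => ⟨⟨hv.1, hv.2.1⟩, ?_, ?_⟩)
    · rintro x (hx | hx)
      · exact (hv.2.2.1 x hx).2 trivial
      · exact (hv.2.2.2 x hx.1).2 hx.2
    · exact fun x hx e => hx.2 ((hv.2.2.2 x hx.1).1 e)
  · rw [h12]
    refine h.layer₂₃_false.trans (Set.ncard_le_ncard fun v hv => ⟨⟨hv.1, hv.2.1⟩, ?_, ?_⟩)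
    · exact fun x hx => (hv.2.2.2 x hx.1).2 hx.2
    · rintro x (hx | hx)
      · exact (hv.2.2.1 x hx).1
      · exact fun e => hx.2 ((hv.2.2.2 x hx.1).1 e)

end

/-- A cograph module with an edge would, by the extraction rule, be a union of components of `G` or
of its complement. It would then contain a comodule inducing a cograph, which the comodule rule
excludes. -/
theorem card_le_kernelBound_of_isReducedInstance {V : Type*} [Fintype V] {G : SimpleGraph V}
    {k : ℕ} (hred : IsReducedInstance G k) (hpos : CographEditable G k) :
    Fintype.card V ≤ kernelBound k := by
  obtain ⟨r₁, r₂, r₃, r₄⟩ := hred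
  refine card_le_kernelBound hpos ?_ ?_ ?_
  · intro X hX hc
    have hi : ∀ x ∈ X, ∀ y ∈ X, ¬ G.Adj x y := by
      intro x hx y hy hxy
      by_contra
      have : IsUnionOfComponents G X ∨ IsUnionOfComponents Gᶜ X := by
        by_contra! hn
        exact r₃ ⟨X, hX, ⟨x, hx, y, hy, hxy⟩, hn.1, hn.2⟩
      rcases this with h | h
      · obtain ⟨c, hcX⟩ := IsUnionOfComponents.exists_supp_subset h hx
        exact r₁ ⟨c.supp, Or.inl ⟨c, rfl⟩, (isCograph_induce_iff _ _).2 (hc.mono hcX)⟩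
      · obtain ⟨c, hcX⟩ := IsUnionOfComponents.exists_supp_subset h hx
        exact r₁ ⟨c.supp, Or.inr ⟨c, rfl⟩, (isCograph_induce_iff _ _).2 (hc.mono hcX)⟩
    refine ⟨hi, ?_⟩
    by_contra! hn
    exact r₂ ⟨X, hX, hi, hn⟩
  · intro u w huw hX
    by_contra! hn
    refine r₂ ⟨_, hX, ?_, hn⟩
    intro x hx y hy hxy
    -- A nonempty `N(u) \ N(w)` is never a union of components: `u` lies outside and is joined to
    -- all of it, and `w` lies outside and is joined to none of it.
    refine r₃ ⟨_, hX, ⟨x, hx, y, hy, hxy⟩, ?_, ?_⟩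
    · exact fun h => notMem_nbrDiff_left u w
        (IsUnionOfComponents.mem_of_adj h hx hx.1.symm)
    · refine fun h => notMem_nbrDiff_right huw (IsUnionOfComponents.mem_of_adj h hx ?_)
      rw [SimpleGraph.compl_adj]
      refine ⟨?_, fun e => hx.2 e.symm⟩
      rintro rfl
      exact notMem_nbrDiff_right huw hx
  · intro _ t a₀ u₁ w₁ u₂ w₂ u₃ w₃ huw hN x hx y hy
    by_contra hn
    refine r₄ ⟨t, _, _, _, _, _, hN.isNestedTModule huw, ?_⟩
    by_cases hay : G.Adj a₀ y
    · exact Or.inr ⟨x, hx, y, ⟨hy, hay⟩, by tauto⟩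
    · exact Or.inl ⟨x, hx, y, ⟨hy, hay⟩, by tauto⟩

/-! ### Numerical bounds -/

/-- The size bound of the kernel. -/
def kernelSize (k : ℕ) : ℕ := kernelBound k + 4 * (k + 1)

theorem kernelSize_le_log {k : ℕ} (hk : 1 ≤ k) :
    (kernelSize k : ℝ) ≤ (k : ℝ) ^ 2 * (170 + 64 * Real.log k) := by
  have h1 : (divisorSum k : ℝ) ≤ k * (1 + Real.log k) := by
    have h2 : ((divisorSum k : ℚ) : ℝ) ≤ ((k * harmonic k : ℚ) : ℝ) := by
      exact_mod_cast divisorSum_le k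
    push_cast at h2
    exact h2.trans (mul_le_mul_of_nonneg_left (harmonic_le_one_add_log k) (by positivity))
  have hk' : (1 : ℝ) ≤ k := by exact_mod_cast hk
  have hL : 0 ≤ Real.log k := Real.log_nonneg hk'
  unfold kernelSize kernelBound
  push_cast
  -- The right side is `k² (162 + 64 log k)`, and the remaining `4 (k + 1)` is at most `8 k²`.
  have h3 : ((k : ℝ) + 1) * (32 * divisorSum k + 48 * k + 1) ≤
      (2 * k) * (32 * (k * (1 + Real.log k)) + 49 * k) := by
    apply mul_le_mul _ _ (by positivity) (by positivity) <;> linarith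
  nlinarith

theorem log_le_logb_two {x : ℝ} (hx : 1 ≤ x) : Real.log x ≤ Real.logb 2 x := by
  rw [Real.logb, le_div_iff₀ (Real.log_pos (by norm_num))]
  have := Real.log_two_lt_d9
  nlinarith [Real.log_nonneg hx]

theorem kernelSize_le {k : ℕ} (hk : 1 ≤ k) :
    (kernelSize k : ℝ) ≤ 409 * (k : ℝ) ^ 2 * (1 + Real.logb 2 (2 * (k : ℝ))) := by
  have hk' : (1 : ℝ) ≤ k := by exact_mod_cast hk
  refine (kernelSize_le_log hk).trans ?_
  rw [Real.logb_mul (by norm_num) (by positivity), Real.logb_self_eq_one (by norm_num)]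
  have h1 := log_le_logb_two hk'
  have h2 := Real.log_nonneg hk'
  rw [mul_comm (409 : ℝ), mul_assoc]
  refine mul_le_mul_of_nonneg_left ?_ (by positivity)
  linarith

theorem kernelSize_isBigO : Asymptotics.IsBigO Filter.atTop (fun k : ℕ => (kernelSize k : ℝ))
    (fun k : ℕ => (k : ℝ) ^ 2 * Real.log (k : ℝ)) := by
  -- `404 = 64 + 2 * 170`, since `log k ≥ log 2 > 1 / 2`.
  refine Asymptotics.IsBigO.of_bound 404 ?_
  filter_upwards [Filter.eventually_ge_atTop 2] with k hk
  have hk' : (2 : ℝ) ≤ k := by exact_mod_cast hk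
  have hL : Real.log 2 ≤ Real.log k := Real.log_le_log (by norm_num) hk'
  have := Real.log_two_gt_d9
  rw [Real.norm_of_nonneg (by positivity), Real.norm_of_nonneg
    (mul_nonneg (by positivity) (by linarith))]
  refine (kernelSize_le_log (by omega)).trans ?_
  rw [mul_left_comm]
  refine mul_le_mul_of_nonneg_left ?_ (by positivity)
  linarith

/-! ### Padding with paths on four vertices -/

/-- The disjoint union of `G` and of `D` paths on four vertices. -/
def padGraph {V : Type*} (G : SimpleGraph V) (D : ℕ) : SimpleGraph (V ⊕ Fin D × Fin 4) where
  Adj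
    | .inl a, .inl b => G.Adj a b
    | .inr (r, i), .inr (s, j) => r = s ∧ ((i : ℕ) + 1 = j ∨ (j : ℕ) + 1 = i)
    | _, _ => False
  symm := ⟨by
    rintro (a | ⟨r, i⟩) (b | ⟨s, j⟩) h
    · exact G.symm.symm _ _ h
    · exact h
    · exact h
    · exact ⟨h.1.symm, h.2.symm⟩⟩
  loopless := ⟨by
    rintro (a | ⟨r, i⟩) h
    · exact G.loopless.irrefl _ h
    · have := h.2; omega⟩

/-- The disjoint union of `H` and of `2 * D` edges. -/
def matchGraph {V : Type*} (H : SimpleGraph V) (D : ℕ) : SimpleGraph (V ⊕ Fin D × Fin 4) where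
  Adj
    | .inl a, .inl b => H.Adj a b
    | .inr (r, i), .inr (s, j) => r = s ∧ i ≠ j ∧ (i : ℕ) / 2 = (j : ℕ) / 2
    | _, _ => False
  symm := ⟨by
    rintro (a | ⟨r, i⟩) (b | ⟨s, j⟩) h
    · exact H.symm.symm _ _ h
    · exact h
    · exact h
    · exact ⟨h.1.symm, h.2.1.symm, h.2.2.symm⟩⟩
  loopless := ⟨by
    rintro (a | ⟨r, i⟩) h
    · exact H.loopless.irrefl _ h
    · exact h.2.1 rfl⟩

theorem matchGraph_P4Free {V : Type*} {H : SimpleGraph V} (h : P4Free H) (D : ℕ) :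
    P4Free (matchGraph H D) := by
  rintro (a | ⟨r, i⟩) (b | ⟨s, j⟩) (c | ⟨p, l⟩) (d | ⟨q, m⟩) hab hbc hcd <;>
    first
    | exact h _ _ _ _ hab hbc hcd
    | exact hab.elim
    | exact hbc.elim
    | exact hcd.elim
    | skip
  obtain ⟨rfl, h1, h2⟩ := hab
  obtain ⟨rfl, h3, h4⟩ := hbc
  obtain ⟨rfl, h5, h6⟩ := hcd
  refine Or.inr (Or.inl ⟨rfl, ?_, h2.trans (h4.trans h6)⟩)
  omega

/-- Each path needs an edit between two of its own vertices, and these edits are disjoint from each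
other and from those in `G`. Deleting the middle edge of each path suffices. -/
theorem cographEditable_padGraph_iff {V : Type*} [Fintype V] (G : SimpleGraph V) (D K : ℕ) :
    CographEditable (padGraph G D) K ↔ D ≤ K ∧ CographEditable G (K - D) := by
  rw [cographEditable_iff, cographEditable_iff]
  have hboth : ∀ {α : Type _} (P Q : Set α), (P ∪ Q).ncard ≤ P.ncard + Q.ncard :=
    Set.ncard_union_le
  have hfin : Nat.card (Fin D × Bool) = 2 * D := by simp [mul_comm]
  constructor
  · rintro ⟨H, hH, hk⟩
    have hex : ∀ r : Fin D, ∃ i j : Fin 4, i ≠ j ∧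
        ((Sum.inr (r, i), Sum.inr (r, j)) : (V ⊕ Fin D × Fin 4) × _) ∈ diff (padGraph G D) H := by
      intro r
      by_contra! hn
      have hadj : ∀ i j : Fin 4, i ≠ j → (H.Adj (Sum.inr (r, i)) (Sum.inr (r, j)) ↔
          ((i : ℕ) + 1 = j ∨ (j : ℕ) + 1 = i)) := by
        intro i j hij
        have h1 := hn i j hij
        rw [mem_diff, not_not] at h1
        rw [← h1]
        exact and_iff_right rfl
      have := hH (.inr (r, 0)) (.inr (r, 1)) (.inr (r, 2)) (.inr (r, 3))
        ((hadj _ _ (by decide)).2 (by simp)) ((hadj _ _ (by decide)).2 (by simp))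
        ((hadj _ _ (by decide)).2 (by simp))
      rw [hadj _ _ (by decide), hadj _ _ (by decide), hadj _ _ (by decide)] at this
      simp at this
    choose i j hij hd using hex
    -- Both orientations of one edited pair in each path.
    let f : Fin D × Bool → (V ⊕ Fin D × Fin 4) × (V ⊕ Fin D × Fin 4) := fun p =>
      if p.2 then (Sum.inr (p.1, i p.1), Sum.inr (p.1, j p.1))
      else (Sum.inr (p.1, j p.1), Sum.inr (p.1, i p.1))
    have hf : Function.Injective f := by
      rintro ⟨r, b⟩ ⟨s, c⟩ h
      cases b <;> cases c <;> simp [f] at h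
      · simp [h]
      · obtain ⟨⟨rfl, h1⟩, _⟩ := h
        exact absurd h1.symm (hij r)
      · obtain ⟨⟨rfl, h1⟩, _⟩ := h
        exact absurd h1 (hij r)
      · simp [h]
    have h1 : (Set.range f).ncard = 2 * D := by
      rw [← Set.image_univ, Set.ncard_image_of_injective _ hf, Set.ncard_univ, hfin]
    have hinl : Function.Injective (Prod.map Sum.inl Sum.inl :
        V × V → (V ⊕ Fin D × Fin 4) × (V ⊕ Fin D × Fin 4)) :=
      Sum.inl_injective.prodMap Sum.inl_injective
    have h2 : Disjoint (Prod.map Sum.inl Sum.inl '' diff G (H.comap Sum.inl)) (Set.range f) := by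
      rw [Set.disjoint_left]
      rintro _ ⟨⟨a, b⟩, _, rfl⟩ ⟨⟨r, c⟩, h⟩
      cases c <;> simp [f] at h
    have h3 : Prod.map Sum.inl Sum.inl '' diff G (H.comap Sum.inl) ∪ Set.range f ⊆
        diff (padGraph G D) H := by
      rintro p (⟨⟨a, b⟩, hab, rfl⟩ | ⟨⟨r, c⟩, rfl⟩)
      · exact hab
      · cases c
        · exact mem_diff_swap.2 (hd r)
        · exact hd r
    have h4 := Set.ncard_le_ncard h3
    rw [Set.ncard_union_eq h2, h1, Set.ncard_image_of_injective _ hinl] at h4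
    exact ⟨by omega, _, hH.comap Sum.inl, by omega⟩
  · rintro ⟨hDK, H, hH, hk⟩
    refine ⟨matchGraph H D, matchGraph_P4Free hH D, ?_⟩
    let f : Fin D × Bool → (V ⊕ Fin D × Fin 4) × (V ⊕ Fin D × Fin 4) := fun p =>
      if p.2 then (Sum.inr (p.1, 1), Sum.inr (p.1, 2)) else (Sum.inr (p.1, 2), Sum.inr (p.1, 1))
    have h1 : (Set.range f).ncard ≤ 2 * D := by
      rw [← Set.image_univ, ← hfin, ← Set.ncard_univ]
      exact Set.ncard_image_le
    have h2 : diff (padGraph G D) (matchGraph H D) ⊆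
        Prod.map Sum.inl Sum.inl '' diff G H ∪ Set.range f := by
      rintro ⟨a | ⟨r, i⟩, b | ⟨s, j⟩⟩ h
      · exact Or.inl ⟨(a, b), h, rfl⟩
      · exact (h Iff.rfl).elim
      · exact (h Iff.rfl).elim
      · have h' : ¬ (r = s ∧ ((i : ℕ) + 1 = j ∨ (j : ℕ) + 1 = i) ↔
            r = s ∧ i ≠ j ∧ (i : ℕ) / 2 = (j : ℕ) / 2) := h
        have hrs : r = s := by
          by_contra hn
          exact h' (by simp [hn])
        subst hrs
        have h'' : (i = 1 ∧ j = 2) ∨ (i = 2 ∧ j = 1) := by omega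
        right
        rcases h'' with ⟨rfl, rfl⟩ | ⟨rfl, rfl⟩
        · exact ⟨(r, true), by simp [f]⟩
        · exact ⟨(r, false), by simp [f]⟩
    have h3 := Set.ncard_le_ncard h2
    have h4 := hboth (Prod.map Sum.inl Sum.inl '' diff G H) (Set.range f)
    have h5 : (Prod.map Sum.inl Sum.inl '' diff G H :
      Set ((V ⊕ Fin D × Fin 4) × (V ⊕ Fin D × Fin 4))).ncard ≤ _ := Set.ncard_image_le
    omega

theorem cographEditable_of_equiv {V W : Type*} [Fintype V] [Fintype W] {G : SimpleGraph V}
    {G' : SimpleGraph W} {k : ℕ} (e : V ≃ W) (h : ∀ a b, G'.Adj (e a) (e b) ↔ G.Adj a b) :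
    CographEditable G k ↔ CographEditable G' k := by
  have h1 : G = G'.comap e := by ext a b; exact (h a b).symm
  have h2 : G' = G.comap e.symm := by
    ext a b
    rw [SimpleGraph.comap_adj, ← h, e.apply_symm_apply, e.apply_symm_apply]
  exact ⟨fun hG => h2 ▸ cographEditable_comap e.symm.injective hG,
    fun hG => h1 ▸ cographEditable_comap e.injective hG⟩

/-- Padding in the numbering of vertices used by the algorithm. -/
theorem cographEditable_pad_iff {N D K : ℕ} {G : SimpleGraph (Fin N)}
    {G' : SimpleGraph (Fin (N + 4 * D))} (hG' : ∀ i j, G'.Adj i j ↔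
      (∃ (hi : (i : ℕ) < N) (hj : (j : ℕ) < N), G.Adj ⟨i, hi⟩ ⟨j, hj⟩) ∨
      (N ≤ (i : ℕ) ∧ (j : ℕ) = i + D) ∨ (N ≤ (j : ℕ) ∧ (i : ℕ) = j + D)) :
    CographEditable G' K ↔ D ≤ K ∧ CographEditable G (K - D) := by
  rw [← cographEditable_padGraph_iff]
  have hlt : ∀ (r : Fin D) (i : Fin 4), N + (i : ℕ) * D + r < N + 4 * D := by
    intro r i
    have h1 : ((i : ℕ) + 1) * D ≤ 4 * D := Nat.mul_le_mul_right _ (by omega)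
    have h2 := r.2
    rw [add_mul, one_mul] at h1
    omega
  -- The `i`-th vertex of path `r` gets the number `N + i * D + r`. Consecutive vertices of a path
  -- then differ by `D`, which is tested by a single addition.
  let f : Fin N ⊕ Fin D × Fin 4 → Fin (N + 4 * D) :=
    Sum.elim (fun a => ⟨a, by omega⟩) (fun p => ⟨N + (p.2 : ℕ) * D + p.1, hlt p.1 p.2⟩)
  have hf : Function.Injective f := by
    rintro (a | ⟨r, i⟩) (b | ⟨s, j⟩) h
    · simp only [f, Sum.elim_inl, Fin.mk.injEq] at h
      rw [Fin.ext h]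
    · simp only [f, Sum.elim_inl, Sum.elim_inr, Fin.mk.injEq] at h
      have := a.2; omega
    · simp only [f, Sum.elim_inl, Sum.elim_inr, Fin.mk.injEq] at h
      have := b.2; omega
    · simp only [f, Sum.elim_inr, Fin.mk.injEq] at h
      have hr := r.2
      have hs := s.2
      have : r = s ∧ i = j := by
        fin_cases i <;> fin_cases j <;> simp at h ⊢ <;> omega
      rw [this.1, this.2]
  have hcard : Fintype.card (Fin N ⊕ Fin D × Fin 4) = Fintype.card (Fin (N + 4 * D)) := by
    simp [mul_comm]
  refine (cographEditable_of_equiv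
    (Equiv.ofBijective f ((Fintype.bijective_iff_injective_and_card f).2 ⟨hf, hcard⟩)) ?_).symm
  intro a b
  simp only [Equiv.ofBijective_apply, hG']
  rcases a with a | ⟨r, i⟩ <;> rcases b with b | ⟨s, j⟩
  · have ha := a.2
    have hb := b.2
    simp only [f, Sum.elim_inl, padGraph]
    constructor
    · rintro (⟨_, _, h⟩ | h | h)
      · exact h
      · omega
      · omega
    · exact fun h => Or.inl ⟨ha, hb, h⟩
  · have ha := a.2
    simp only [f, Sum.elim_inl, Sum.elim_inr, padGraph, iff_false]
    rintro (⟨_, h, _⟩ | h | h) <;> have := s.2 <;> omega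
  · have hb := b.2
    simp only [f, Sum.elim_inl, Sum.elim_inr, padGraph, iff_false]
    rintro (⟨h, _, _⟩ | h | h) <;> have := r.2 <;> omega
  · have hr := r.2
    have hs := s.2
    simp only [f, Sum.elim_inr, padGraph, Fin.ext_iff]
    constructor
    · rintro (⟨h, _, _⟩ | ⟨_, h⟩ | ⟨_, h⟩)
      · omega
      · fin_cases i <;> fin_cases j <;> simp at h ⊢ <;> omega
      · fin_cases i <;> fin_cases j <;> simp at h ⊢ <;> omega
    · rintro ⟨h, h' | h'⟩
      · refine Or.inr (Or.inl ⟨by omega, ?_⟩)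
        rw [← h', h]; ring
      · refine Or.inr (Or.inr ⟨by omega, ?_⟩)
        rw [← h', h]; ring

/-! ### Total correctness of programs with time bounds -/

/-- Started on `σ`, the program `p` halts after at most `t` steps on a memory satisfying `Q`. -/
def Terminates (p : RAM.Prog) (σ : RAM.Store) (t : ℕ) (Q : RAM.Store → Prop) : Prop :=
  ∃ t' τ, RAM.Runs p σ t' τ ∧ t' ≤ t ∧ Q τ

section

variable {p q : RAM.Prog} {σ : RAM.Store} {t u : ℕ} {Q R : RAM.Store → Prop}

theorem Terminates.mono (h : Terminates p σ t Q) (htu : t ≤ u) (hQR : ∀ τ, Q τ → R τ) :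
    Terminates p σ u R := by
  obtain ⟨t', τ, hr, ht, hQ⟩ := h
  exact ⟨t', τ, hr, ht.trans htu, hQR τ hQ⟩

theorem Terminates.seq (h : Terminates p σ t Q) (h' : ∀ τ, Q τ → Terminates q τ u R) :
    Terminates (.seq p q) σ (t + u) R := by
  obtain ⟨t', τ, hr, ht, hQ⟩ := h
  obtain ⟨u', υ, hr', hu, hR⟩ := h' τ hQ
  exact ⟨t' + u', υ, .seq hr hr', by omega, hR⟩

theorem terminates_skip (h : Q σ) : Terminates .skip σ 1 Q := ⟨1, σ, .skip σ, le_rfl, h⟩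

theorem terminates_const {d c : ℕ} (h : Q (σ.setReg d c)) : Terminates (.const d c) σ 1 Q :=
  ⟨1, _, .const σ d c, le_rfl, h⟩

theorem terminates_add {d x y : ℕ} (h : Q (σ.setReg d (σ.reg x + σ.reg y))) :
    Terminates (.add d x y) σ 1 Q := ⟨1, _, .add σ d x y, le_rfl, h⟩

theorem terminates_sub {d x y : ℕ} (h : Q (σ.setReg d (σ.reg x - σ.reg y))) :
    Terminates (.sub d x y) σ 1 Q := ⟨1, _, .sub σ d x y, le_rfl, h⟩

theorem terminates_load {d a i j : ℕ} (h : Q (σ.setReg d (σ.arr a (σ.reg i) (σ.reg j)))) :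
    Terminates (.load d a i j) σ 1 Q := ⟨1, _, .load σ d a i j, le_rfl, h⟩

theorem terminates_store {a i j s : ℕ} (h : Q (σ.setArr a (σ.reg i) (σ.reg j) (σ.reg s))) :
    Terminates (.store a i j s) σ 1 Q := ⟨1, _, .store σ a i j s, le_rfl, h⟩

theorem terminates_ite {x y : ℕ} (h₁ : σ.reg x < σ.reg y → Terminates p σ t Q)
    (h₂ : ¬ σ.reg x < σ.reg y → Terminates q σ t Q) : Terminates (.ite x y p q) σ (t + 1) Q := by
  by_cases h : σ.reg x < σ.reg y
  · obtain ⟨t', τ, hr, ht, hQ⟩ := h₁ h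
    exact ⟨_, τ, .ite_true h hr, by omega, hQ⟩
  · obtain ⟨t', τ, hr, ht, hQ⟩ := h₂ h
    exact ⟨_, τ, .ite_false h hr, by omega, hQ⟩

/-- A loop whose counter runs up to `n`. -/
theorem terminates_counter {x y n c : ℕ} (I : ℕ → RAM.Store → Prop)
    (hI : ∀ i τ, I i τ → τ.reg x = i ∧ τ.reg y = n)
    (hstep : ∀ i < n, ∀ τ, I i τ → Terminates p τ c (I (i + 1))) (h0 : I 0 σ) :
    Terminates (.while x y p) σ (n * (c + 1) + 1) (I n) := by
  have key : ∀ m i τ, i + m = n → I i τ → Terminates (.while x y p) τ (m * (c + 1) + 1) (I n) := by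
    intro m
    induction m with
    | zero =>
      intro i τ hi hτ
      obtain rfl : i = n := by omega
      obtain ⟨h1, h2⟩ := hI _ _ hτ
      exact ⟨1, τ, .while_false (by omega), by omega, hτ⟩
    | succ m ih =>
      intro i τ hi hτ
      obtain ⟨h1, h2⟩ := hI _ _ hτ
      obtain ⟨t', υ, hr, ht, hυ⟩ := hstep i (by omega) τ hτ
      obtain ⟨u', ω, hr', hu, hω⟩ := ih (i + 1) υ (by omega) hυ
      refine ⟨_, ω, .while_true (by omega) hr hr', ?_, hω⟩
      rw [add_mul, one_mul]
      omega
  exact key n 0 σ (by omega) h0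

/-- A loop that decreases a potential whenever it is continued. -/
theorem terminates_while_potential {x y c : ℕ} (J : ℕ → RAM.Store → Prop)
    (hstep : ∀ n τ, J n τ → τ.reg x < τ.reg y → Terminates p τ c
      (fun υ => ∃ m, J m υ ∧ (υ.reg x < υ.reg y → m < n))) :
    ∀ n τ, J n τ → Terminates (.while x y p) τ ((n + 1) * (c + 1) + 1)
      (fun υ => (∃ m, J m υ) ∧ ¬ υ.reg x < υ.reg y) := by
  intro n
  induction n using Nat.strong_induction_on with
  | _ n ih =>
    intro τ hJ
    by_cases h : τ.reg x < τ.reg y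
    · obtain ⟨t', υ, hr, ht, m, hm, hlt⟩ := hstep n τ hJ h
      by_cases h' : υ.reg x < υ.reg y
      · obtain ⟨u', ω, hr', hu, hω⟩ := ih m (hlt h') υ hm
        refine ⟨_, ω, .while_true h hr hr', ?_, hω⟩
        have h1 : (m + 1) * (c + 1) ≤ n * (c + 1) := Nat.mul_le_mul_right _ (hlt h')
        rw [add_mul n, one_mul]
        omega
      · refine ⟨_, υ, .while_true h hr (.while_false h'), ?_, ⟨m, hm⟩, h'⟩
        rw [add_mul n, one_mul]
        have : 0 ≤ n * (c + 1) := Nat.zero_le _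
        omega
    · exact ⟨1, τ, .while_false h, by omega, ⟨n, hJ⟩, h⟩

end

@[simp] theorem setReg_reg (σ : RAM.Store) (d v r : ℕ) :
    (σ.setReg d v).reg r = if r = d then v else σ.reg r := rfl

@[simp] theorem setReg_arr (σ : RAM.Store) (d v : ℕ) : (σ.setReg d v).arr = σ.arr := rfl

@[simp] theorem setArr_reg (σ : RAM.Store) (a i j v : ℕ) : (σ.setArr a i j v).reg = σ.reg := rfl

@[simp] theorem setArr_arr (σ : RAM.Store) (a i j v a' i' j' : ℕ) :
    (σ.setArr a i j v).arr a' i' j' = if a' = a ∧ i' = i ∧ j' = j then v else σ.arr a' i' j' := rfl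

/-! ### Expressions -/

/-- Expressions over registers and the adjacency matrix in array `0`. Sums range over the numbers
below the content of register `0`. -/
inductive Expr where
  | var (i : ℕ)
  | const (c : ℕ)
  | add (a b : Expr)
  | sub (a b : Expr)
  | lt (a b : Expr)
  | adj (a b : Expr)
  | ite (c a b : Expr)
  | sum (x : ℕ) (b : Expr)

namespace Expr

/-- The value of an expression. -/
def eval (M : ℕ → ℕ → ℕ) : Expr → (ℕ → ℕ) → ℕ
  | var i, e => e i
  | const c, _ => c
  | add a b, e => a.eval M e + b.eval M e
  | sub a b, e => a.eval M e - b.eval M e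
  | lt a b, e => if a.eval M e < b.eval M e then 1 else 0
  | adj a b, e => M (a.eval M e) (b.eval M e)
  | ite c a b, e => if 0 < c.eval M e then a.eval M e else b.eval M e
  | sum x b, e => ∑ v ∈ Finset.range (e 0), b.eval M (Function.update e x v)

/-- All variables are registers below `60`, and register `0` is not bound. -/
def Ok : Expr → Prop
  | var i => i < 60
  | const _ => True
  | add a b => a.Ok ∧ b.Ok
  | sub a b => a.Ok ∧ b.Ok
  | lt a b => a.Ok ∧ b.Ok
  | adj a b => a.Ok ∧ b.Ok
  | ite c a b => c.Ok ∧ a.Ok ∧ b.Ok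
  | sum x b => (x ≠ 0 ∧ x < 60) ∧ b.Ok

/-- A program that computes the value of an expression in register `d`, and changes no register
below `d`. -/
def compile : Expr → ℕ → RAM.Prog
  | var i, d => .seq (.const d 0) (.add d d i)
  | const c, d => .const d c
  | add a b, d => .seq (a.compile d) (.seq (b.compile (d + 1)) (.add d d (d + 1)))
  | sub a b, d => .seq (a.compile d) (.seq (b.compile (d + 1)) (.sub d d (d + 1)))
  | lt a b, d => .seq (a.compile d) (.seq (b.compile (d + 1))
      (.ite d (d + 1) (.const d 1) (.const d 0)))
  | adj a b, d => .seq (a.compile d) (.seq (b.compile (d + 1)) (.load d 0 d (d + 1)))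
  | ite c a b, d => .seq (c.compile d) (.seq (.const (d + 1) 0)
      (.ite (d + 1) d (a.compile d) (b.compile d)))
  -- Register `d` accumulates the sum and `d + 1` saves `x`. Register `d + 2` holds `0` for copying
  -- by addition and `1` for the increments.
  | sum x b, d => .seq (.const d 0) (.seq (.const (d + 2) 0) (.seq (.add (d + 1) x (d + 2))
      (.seq (.const x 0) (.seq (.const (d + 2) 1)
      (.seq (.while x 0 (.seq (b.compile (d + 3)) (.seq (.add d d (d + 3)) (.add x x (d + 2)))))
      (.seq (.const (d + 2) 0) (.add x (d + 1) (d + 2))))))))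

/-- A bound on the time for computing the value of an expression. -/
noncomputable def cost : Expr → Polynomial ℕ
  | var _ => 2
  | const _ => 1
  | add a b => a.cost + b.cost + 1
  | sub a b => a.cost + b.cost + 1
  | lt a b => a.cost + b.cost + 2
  | adj a b => a.cost + b.cost + 1
  | ite c a b => c.cost + a.cost + b.cost + 2
  | sum _ b => Polynomial.X * (b.cost + 3) + 8

theorem eval_congr (M : ℕ → ℕ → ℕ) (a : Expr) (ha : a.Ok) : ∀ e e' : ℕ → ℕ,
    (∀ r < 60, e r = e' r) → a.eval M e = a.eval M e' := by
  induction a with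
  | var i => exact fun e e' h => h i ha
  | const c => exact fun _ _ _ => rfl
  | add a b iha ihb | sub a b iha ihb | lt a b iha ihb | adj a b iha ihb =>
    intro e e' h
    simp only [eval, iha ha.1 e e' h, ihb ha.2 e e' h]
  | ite c a b ihc iha ihb =>
    intro e e' h
    simp only [eval, ihc ha.1 e e' h, iha ha.2.1 e e' h, ihb ha.2.2 e e' h]
  | sum x b ihb =>
    intro e e' h
    simp only [eval, h 0 (by norm_num)]
    refine Finset.sum_congr rfl fun v _ => ihb ha.2 _ _ fun r hr => ?_
    by_cases hrx : r = x
    · subst hrx; simp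
    · simp [hrx, h r hr]

/-- The outcome of computing the value of an expression. -/
def Computes (M : ℕ → ℕ → ℕ) (a : Expr) (d : ℕ) (σ τ : RAM.Store) : Prop :=
  τ.arr = σ.arr ∧ (∀ r < d, τ.reg r = σ.reg r) ∧ τ.reg d = a.eval M σ.reg

/-- Evaluation into register `d` spares everything below `d`, so stored partial results survive.
Values depend only on registers below `60 ≤ d`, so scratch registers do not affect them. -/
theorem terminates_compile (a : Expr) (ha : a.Ok) : ∀ d, 60 ≤ d → ∀ σ : RAM.Store,
    Terminates (a.compile d) σ (a.cost.eval (σ.reg 0)) (Computes (σ.arr 0) a d σ) := by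
  have hbin : ∀ a b : Expr, a.Ok → b.Ok →
      (∀ d, 60 ≤ d → ∀ σ : RAM.Store,
        Terminates (a.compile d) σ (a.cost.eval (σ.reg 0)) (Computes (σ.arr 0) a d σ)) →
      (∀ d, 60 ≤ d → ∀ σ : RAM.Store,
        Terminates (b.compile d) σ (b.cost.eval (σ.reg 0)) (Computes (σ.arr 0) b d σ)) →
      ∀ d, 60 ≤ d → ∀ (σ : RAM.Store) (p : RAM.Prog) (c : ℕ) (Q : RAM.Store → Prop),
      (∀ τ : RAM.Store, τ.arr = σ.arr → (∀ r < d, τ.reg r = σ.reg r) →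
        τ.reg d = a.eval (σ.arr 0) σ.reg → τ.reg (d + 1) = b.eval (σ.arr 0) σ.reg →
        Terminates p τ c Q) →
      Terminates (.seq (a.compile d) (.seq (b.compile (d + 1)) p)) σ
        (a.cost.eval (σ.reg 0) + (b.cost.eval (σ.reg 0) + c)) Q := by
    intro a b ha hb iha ihb d hd σ p c Q h
    refine (iha d hd σ).seq fun τ hτ => ?_
    obtain ⟨h1, h2, h3⟩ := hτ
    have h4 := ihb (d + 1) (by omega) τ
    rw [h2 0 (by omega), h1] at h4
    refine h4.seq fun υ hυ => ?_
    obtain ⟨h5, h6, h7⟩ := hυ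
    refine h υ (h5.trans h1) (fun r hr => (h6 r (by omega)).trans (h2 r hr))
      ((h6 d (by omega)).trans h3) (h7.trans ?_)
    exact eval_congr _ b hb _ _ fun r hr => h2 r (by omega)
  induction a with
  | var i =>
    intro d hd σ
    have hi : i < 60 := ha
    have hid : i ≠ d := by omega
    refine Terminates.mono (Terminates.seq (terminates_const rfl) fun τ hτ => ?_)
      (t := 1 + 1) (by simp [cost]) (fun _ h => h)
    subst hτ
    refine terminates_add ⟨rfl, fun r hr => ?_, ?_⟩
    · simp [hr.ne]
    · simp [eval, hid]
  | const c =>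
    intro d hd σ
    refine Terminates.mono (terminates_const ⟨rfl, fun r hr => ?_, ?_⟩) (by simp [cost])
      (fun _ h => h)
    · simp [hr.ne]
    · simp [eval]
  | add a b iha ihb =>
    intro d hd σ
    refine Terminates.mono (hbin a b ha.1 ha.2 (iha ha.1) (ihb ha.2) d hd σ _ 1 _ ?_)
      (by simp [cost, add_assoc]) (fun _ h => h)
    intro τ h1 h2 h3 h4
    refine terminates_add ⟨h1, fun r hr => ?_, ?_⟩
    · simp [hr.ne, h2 r hr]
    · simp [eval, h3, h4]
  | sub a b iha ihb =>
    intro d hd σ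
    refine Terminates.mono (hbin a b ha.1 ha.2 (iha ha.1) (ihb ha.2) d hd σ _ 1 _ ?_)
      (by simp [cost, add_assoc]) (fun _ h => h)
    intro τ h1 h2 h3 h4
    refine terminates_sub ⟨h1, fun r hr => ?_, ?_⟩
    · simp [hr.ne, h2 r hr]
    · simp [eval, h3, h4]
  | lt a b iha ihb =>
    intro d hd σ
    refine Terminates.mono (hbin a b ha.1 ha.2 (iha ha.1) (ihb ha.2) d hd σ _ 2 _ ?_)
      (by simp [cost, add_assoc]) (fun _ h => h)
    intro τ h1 h2 h3 h4
    refine terminates_ite (fun h => ?_) fun h => ?_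
    · refine terminates_const ⟨h1, fun r hr => by simp [hr.ne, h2 r hr], ?_⟩
      rw [h3, h4] at h
      simp [eval, h]
    · refine terminates_const ⟨h1, fun r hr => by simp [hr.ne, h2 r hr], ?_⟩
      rw [h3, h4] at h
      simp [eval, h]
  | adj a b iha ihb =>
    intro d hd σ
    refine Terminates.mono (hbin a b ha.1 ha.2 (iha ha.1) (ihb ha.2) d hd σ _ 1 _ ?_)
      (by simp [cost, add_assoc]) (fun _ h => h)
    intro τ h1 h2 h3 h4
    refine terminates_load ⟨h1, fun r hr => ?_, ?_⟩
    · simp [hr.ne, h2 r hr]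
    · simp [eval, h1, h3, h4]
  | ite c a b ihc iha ihb =>
    intro d hd σ
    refine Terminates.mono (t := c.cost.eval (σ.reg 0) +
      (1 + ((a.cost.eval (σ.reg 0) + b.cost.eval (σ.reg 0)) + 1)))
      (((ihc ha.1 d hd σ).seq (R := Computes (σ.arr 0) (ite c a b) d σ) fun τ hτ => ?_))
      (by simp only [cost, Polynomial.eval_add, Polynomial.eval_ofNat]; omega) (fun _ h => h)
    obtain ⟨h1, h2, h3⟩ := hτ
    refine (terminates_const (Q := fun υ => υ = τ.setReg (d + 1) 0) rfl).seq fun υ hυ => ?_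
    subst hυ
    have hcongr : ∀ e : Expr, e.Ok → e.eval (σ.arr 0) (τ.setReg (d + 1) 0).reg =
        e.eval (σ.arr 0) σ.reg := by
      intro e he
      refine eval_congr _ e he _ _ fun r hr => ?_
      rw [setReg_reg, if_neg (by omega), h2 r (by omega)]
    have h0 : (τ.setReg (d + 1) 0).reg 0 = σ.reg 0 := by
      rw [setReg_reg, if_neg (by omega), h2 0 (by omega)]
    have hcond : (τ.setReg (d + 1) 0).reg (d + 1) < (τ.setReg (d + 1) 0).reg d ↔
        0 < c.eval (σ.arr 0) σ.reg := by
      simp [h3]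
    refine terminates_ite (fun h => ?_) fun h => ?_
    · have h4 := iha ha.2.1 d hd (τ.setReg (d + 1) 0)
      rw [h0, setReg_arr, h1] at h4
      refine h4.mono (by omega) fun υ hυ => ⟨hυ.1.trans h1, fun r hr => ?_, ?_⟩
      · rw [hυ.2.1 r hr, setReg_reg, if_neg (by omega), h2 r hr]
      · rw [hυ.2.2, hcongr a ha.2.1]
        simp only [eval, if_pos (hcond.1 h)]
    · have h4 := ihb ha.2.2 d hd (τ.setReg (d + 1) 0)
      rw [h0, setReg_arr, h1] at h4
      refine h4.mono (by omega) fun υ hυ => ⟨hυ.1.trans h1, fun r hr => ?_, ?_⟩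
      · rw [hυ.2.1 r hr, setReg_reg, if_neg (by omega), h2 r hr]
      · rw [hυ.2.2, hcongr b ha.2.2]
        simp only [eval, if_neg (fun h' => h (hcond.2 h'))]
  | sum x b ihb =>
    intro d hd σ
    obtain ⟨⟨hx0, hx⟩, hb⟩ := ha
    refine Terminates.mono (t := 1 + (1 + (1 + (1 + (1 +
      ((σ.reg 0 * ((b.cost.eval (σ.reg 0) + (1 + 1)) + 1) + 1) + (1 + 1)))))))
      (Q := Computes (σ.arr 0) (sum x b) d σ) ?_
      (by
        simp only [cost, Polynomial.eval_add, Polynomial.eval_mul, Polynomial.eval_X,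
          Polynomial.eval_ofNat, show ∀ c, c + (1 + 1) + 1 = c + 3 from fun _ => rfl]
        omega) (fun _ h => h)
    have hxd : x ≠ d := by omega
    have hxd1 : x ≠ d + 1 := by omega
    have hxd2 : x ≠ d + 2 := by omega
    refine (terminates_const (Q := fun υ => υ = σ.setReg d 0) rfl).seq ?_
    rintro _ rfl
    refine (terminates_const (Q := fun υ => υ = (σ.setReg d 0).setReg (d + 2) 0) rfl).seq ?_
    rintro _ rfl
    refine (terminates_add (σ := (σ.setReg d 0).setReg (d + 2) 0)
      (Q := fun υ => υ.arr = σ.arr ∧ (∀ r < d, υ.reg r = σ.reg r) ∧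
      υ.reg d = 0 ∧ υ.reg (d + 1) = σ.reg x) ⟨rfl, ?_, ?_, ?_⟩).seq ?_
    · intro r hr
      simp [show r ≠ d by omega, show r ≠ d + 1 by omega, show r ≠ d + 2 by omega]
    · simp
    · simp [hxd, hxd2]
    rintro τ ⟨h1, h2, h3, h4⟩
    refine (terminates_const (Q := fun υ => υ = τ.setReg x 0) rfl).seq ?_
    rintro _ rfl
    refine (terminates_const (Q := fun υ => υ = (τ.setReg x 0).setReg (d + 2) 1) rfl).seq ?_
    rintro _ rfl
    let I : ℕ → RAM.Store → Prop := fun i υ => υ.arr = σ.arr ∧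
      (∀ r < d, υ.reg r = Function.update σ.reg x i r) ∧
      υ.reg d = ∑ v ∈ Finset.range i, b.eval (σ.arr 0) (Function.update σ.reg x v) ∧
      υ.reg (d + 1) = σ.reg x ∧ υ.reg (d + 2) = 1
    refine (terminates_counter (n := σ.reg 0) I ?_ ?_ ?_).seq ?_
    · rintro i υ ⟨_, h6, _⟩
      refine ⟨?_, ?_⟩
      · rw [h6 x (by omega), Function.update_self]
      · rw [h6 0 (by omega), Function.update_of_ne hx0.symm]
    · rintro i hi υ ⟨h5, h6, h7, h8, h9⟩
      have h10 := ihb hb (d + 3) (by omega) υ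
      rw [h6 0 (by omega), Function.update_of_ne hx0.symm, h5] at h10
      refine h10.seq ?_
      rintro ω ⟨h11, h12, h13⟩
      change Terminates _ ω (1 + 1) _
      refine (terminates_add (Q := fun ξ => ξ = ω.setReg d (ω.reg d + ω.reg (d + 3))) rfl).seq ?_
      rintro _ rfl
      refine terminates_add ⟨h11.trans h5, fun r hr => ?_, ?_, ?_, ?_⟩
      · by_cases hrx : r = x
        · subst hrx
          simp [hxd, h12 r (by omega), h12 (d + 2) (by omega), h6 r hr, h9]
        · simp [hrx, hr.ne, h12 r (by omega), h6 r hr]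
      · simp only [setReg_reg, hxd.symm, if_false, if_true, Finset.sum_range_succ]
        rw [h12 d (by omega), h7, h13]
        congr 1
        exact eval_congr _ b hb _ _ fun r hr => h6 r (by omega)
      · simp [hxd1.symm, h12 (d + 1) (by omega), h8]
      · simp [hxd2.symm, h12 (d + 2) (by omega), h9]
    · refine ⟨h1, fun r hr => ?_, ?_, ?_, ?_⟩
      · by_cases hrx : r = x
        · subst hrx; simp [hxd2]
        · simp [hrx, h2 r hr, show r ≠ d + 2 by omega]
      · simp [hxd.symm, h3]
      · simp [hxd1.symm, h4]
      · simp
    · rintro υ ⟨h5, h6, h7, h8, h9⟩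
      refine (terminates_const (Q := fun ω => ω = υ.setReg (d + 2) 0) rfl).seq ?_
      rintro _ rfl
      refine terminates_add ⟨h5, fun r hr => ?_, ?_⟩
      · by_cases hrx : r = x
        · subst hrx; simp [h8]
        · simp [hrx, h6 r hr, show r ≠ d + 2 by omega]
      · simp [hxd.symm, h7, eval]

theorem eval_cost_mono (p : Polynomial ℕ) {m n : ℕ} (h : m ≤ n) : p.eval m ≤ p.eval n := by
  rw [Polynomial.eval_eq_sum_range, Polynomial.eval_eq_sum_range]
  exact Finset.sum_le_sum fun i _ => Nat.mul_le_mul_left _ (Nat.pow_le_pow_left h i)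

end Expr

/-! ### Rewriting the adjacency matrix -/

/-- Run `body` for all values of registers `6` and `7` below the content of register `60`, where
register `62` contains one. -/
def matrixLoop (body : RAM.Prog) : RAM.Prog :=
  .seq (.const 6 0) (.while 6 60 (.seq (.const 7 0)
    (.seq (.while 7 60 (.seq body (.add 7 7 62))) (.add 6 6 62))))

/-- In the invariant `K P`, the relation `P` describes the positions treated so far. It grows in
row-major order, and `K` must not depend on the two counters. -/
theorem terminates_matrixLoop {body : RAM.Prog} {n c : ℕ} (K : (ℕ → ℕ → Prop) → RAM.Store → Prop)
    (hK : ∀ P σ, K P σ → σ.reg 60 = n ∧ σ.reg 62 = 1)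
    (hset : ∀ P σ r v, K P σ → r = 6 ∨ r = 7 → K P (σ.setReg r v))
    (hbody : ∀ i < n, ∀ j < n, ∀ P σ, K P σ → σ.reg 6 = i → σ.reg 7 = j → Terminates body σ c
      (fun τ => K (fun a b => P a b ∨ (a = i ∧ b = j)) τ ∧ τ.reg 6 = i ∧ τ.reg 7 = j))
    {σ : RAM.Store} (hσ : K (fun _ _ => False) σ) :
    Terminates (matrixLoop body) σ (1 + (n * ((1 + ((n * ((c + 1) + 1) + 1) + 1)) + 1) + 1))
      (K fun a b => a < n ∧ b < n) := by
  refine (terminates_const (Q := fun τ => τ.reg 6 = 0 ∧ K (fun a b => a < 0 ∧ b < n) τ)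
    ⟨by simp, ?_⟩).seq ?_
  · simp only [not_lt_zero, false_and]
    exact hset _ _ _ _ hσ (Or.inl rfl)
  rintro τ ⟨h1, h2⟩
  refine (terminates_counter (n := n) (fun i υ => υ.reg 6 = i ∧ K (fun a b => a < i ∧ b < n) υ)
    (fun i υ h => ⟨h.1, (hK _ _ h.2).1⟩) ?_ ⟨h1, h2⟩).mono le_rfl (fun υ h => h.2)
  rintro i hi υ ⟨h3, h4⟩
  let J : ℕ → RAM.Store → Prop := fun j ω => ω.reg 6 = i ∧ ω.reg 7 = j ∧
    K (fun a b => (a < i ∧ b < n) ∨ (a = i ∧ b < j)) ω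
  refine (terminates_const (Q := J 0) ⟨by simp [h3], by simp, ?_⟩).seq ?_
  · simp only [not_lt_zero, and_false, or_false]
    exact hset _ _ _ _ h4 (Or.inr rfl)
  intro ω hω
  refine (terminates_counter (n := n) J (fun j ξ h => ⟨h.2.1, (hK _ _ h.2.2).1⟩) ?_ hω).seq ?_
  · rintro j hj ξ ⟨h5, h6, h7⟩
    refine (hbody i hi j hj _ ξ h7 h5 h6).seq ?_
    rintro ζ ⟨h8, h9, h10⟩
    refine terminates_add ⟨by simp [h9], by simp [h10, (hK _ _ h8).2], ?_⟩
    have h11 : (fun a b => (a < i ∧ b < n) ∨ (a = i ∧ b < j + 1)) =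
        (fun a b => ((a < i ∧ b < n) ∨ (a = i ∧ b < j)) ∨ (a = i ∧ b = j)) := by
      funext a b
      apply propext
      omega
    rw [h11]
    exact hset _ _ _ _ h8 (Or.inr rfl)
  · rintro ξ ⟨h5, h6, h7⟩
    refine terminates_add ⟨by simp [h5, (hK _ _ h7).2], ?_⟩
    have h11 : (fun a b => a < i + 1 ∧ b < n) =
        (fun a b => (a < i ∧ b < n) ∨ (a = i ∧ b < n)) := by
      funext a b
      apply propext
      omega
    rw [h11]
    exact hset _ _ _ _ h7 (Or.inl rfl)

/-- Replace the number of vertices by `ν`, the parameter by `κ`, and the entry of the matrix at the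
position given by registers `6` and `7` by `μ`. -/
def updateProg (ν κ μ : Expr) : RAM.Prog :=
  -- The new matrix is built in array `1`, and registers `0` and `1` are overwritten last, because
  -- `μ` has to be evaluated on the old instance throughout.
  .seq (ν.compile 60) (.seq (κ.compile 61) (.seq (.const 62 1) (.seq (.const 63 0)
    (.seq (matrixLoop (.seq (μ.compile 64) (.store 1 6 7 64)))
    (.seq (matrixLoop (.seq (.load 64 1 6 7) (.store 0 6 7 64)))
    (.seq (.add 0 60 63) (.add 1 61 63)))))))

/-- A bound on the running time of `updateProg`. -/
noncomputable def updateCost (ν κ μ : Expr) : Polynomial ℕ :=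
  ν.cost + κ.cost + Polynomial.X * (Polynomial.X * (μ.cost + 3) + 4) +
    Polynomial.X * (Polynomial.X * 4 + 4) + 8

theorem terminates_updateProg {ν κ μ : Expr} (hν : ν.Ok) (hκ : κ.Ok) (hμ : μ.Ok)
    {σ : RAM.Store} {B : ℕ} (hB : σ.reg 0 ≤ B) (hB' : ν.eval (σ.arr 0) σ.reg ≤ B) :
    Terminates (updateProg ν κ μ) σ ((updateCost ν κ μ).eval B) (fun τ =>
      τ.reg 0 = ν.eval (σ.arr 0) σ.reg ∧ τ.reg 1 = κ.eval (σ.arr 0) σ.reg ∧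
      (∀ r < 60, r ≠ 0 → r ≠ 1 → r ≠ 6 → r ≠ 7 → τ.reg r = σ.reg r) ∧
      ∀ i < ν.eval (σ.arr 0) σ.reg, ∀ j < ν.eval (σ.arr 0) σ.reg, τ.arr 0 i j =
        μ.eval (σ.arr 0) (Function.update (Function.update σ.reg 6 i) 7 j)) := by
  set n := ν.eval (σ.arr 0) σ.reg with hn
  set k := κ.eval (σ.arr 0) σ.reg with hk
  set f : ℕ → ℕ → ℕ := fun i j =>
    μ.eval (σ.arr 0) (Function.update (Function.update σ.reg 6 i) 7 j) with hf
  refine Terminates.mono (t := ν.cost.eval B + (κ.cost.eval B + (1 + (1 +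
    ((1 + (n * ((1 + ((n * (((μ.cost.eval B + 1) + 1) + 1) + 1) + 1)) + 1) + 1)) +
    ((1 + (n * ((1 + ((n * (((1 + 1) + 1) + 1) + 1) + 1)) + 1) + 1)) + (1 + 1))))))) ?_ ?_
    (fun _ h => h)
  swap
  · simp only [updateCost, Polynomial.eval_add, Polynomial.eval_mul, Polynomial.eval_X,
      Polynomial.eval_ofNat]
    have h1 : n * (1 + (n * (μ.cost.eval B + 1 + 1 + 1) + 1 + 1) + 1) ≤
        B * (B * (μ.cost.eval B + 3) + 4) := by
      refine Nat.mul_le_mul hB' ?_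
      have := Nat.mul_le_mul_right (μ.cost.eval B + 3) hB'
      rw [show μ.cost.eval B + 1 + 1 + 1 = μ.cost.eval B + 3 from rfl]
      omega
    have h2 : n * (1 + (n * (1 + 1 + 1 + 1) + 1 + 1) + 1) ≤ B * (B * 4 + 4) :=
      Nat.mul_le_mul hB' (by omega)
    omega
  let Regs : RAM.Store → Prop := fun τ => (∀ r < 60, r ≠ 6 → r ≠ 7 → τ.reg r = σ.reg r) ∧
    τ.reg 60 = n ∧ τ.reg 61 = k ∧ τ.reg 62 = 1 ∧ τ.reg 63 = 0
  have hRset : ∀ τ r v, Regs τ → r = 6 ∨ r = 7 → Regs (τ.setReg r v) := by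
    rintro τ r v ⟨h1, h2, h3, h4, h5⟩ (rfl | rfl)
    · exact ⟨fun r hr h6 h7 => by simp [h6, h1 r hr h6 h7], by simpa, by simpa, by simpa, by simpa⟩
    · exact ⟨fun r hr h6 h7 => by simp [h7, h1 r hr h6 h7], by simpa, by simpa, by simpa, by simpa⟩
  have hR64 : ∀ (τ : RAM.Store) v, Regs τ → Regs (τ.setReg 64 v) := by
    rintro τ v ⟨h1, h2, h3, h4, h5⟩
    exact ⟨fun r hr h6 h7 => by simp [show r ≠ 64 by omega, h1 r hr h6 h7], by simpa, by simpa,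
      by simpa, by simpa⟩
  refine ((ν.terminates_compile hν 60 le_rfl σ).mono (Expr.eval_cost_mono _ hB)
    (fun _ h => h)).seq ?_
  rintro τ ⟨h1, h2, h3⟩
  have h4 := κ.terminates_compile hκ 61 (by norm_num) τ
  rw [h1, h2 0 (by norm_num)] at h4
  refine (h4.mono (Expr.eval_cost_mono _ hB) (fun _ h => h)).seq ?_
  rintro υ ⟨h5, h6, h7⟩
  rw [Expr.eval_congr _ κ hκ τ.reg σ.reg h2] at h7
  refine (terminates_const (Q := fun ω => ω = υ.setReg 62 1) rfl).seq ?_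
  rintro _ rfl
  refine (terminates_const (Q := fun ω => Regs ω ∧ ω.arr 0 = σ.arr 0) ⟨⟨?_, ?_, ?_, ?_, ?_⟩, ?_⟩).seq
    ?_
  · intro r hr _ _
    simp [show r ≠ 63 by omega, show r ≠ 62 by omega, h6 r (by omega), h2 r hr]
  · simp [h6 60 (by omega), h3, hn]
  · simp [h7, hk]
  · simp
  · simp
  · simp [h5, h1]
  rintro ω ⟨hω, hωM⟩
  refine (terminates_matrixLoop (n := n) (c := μ.cost.eval B + 1)
    (fun P ξ => Regs ξ ∧ ξ.arr 0 = σ.arr 0 ∧ ∀ a b, P a b → ξ.arr 1 a b = f a b)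
    (fun P ξ h => ⟨h.1.2.1, h.1.2.2.2.1⟩)
    (fun P ξ r v h hr => ⟨hRset ξ r v h.1 hr, h.2.1, h.2.2⟩) ?_
    ⟨hω, hωM, fun _ _ h => h.elim⟩).seq ?_
  · rintro i hi j hj P ξ ⟨hR, hM, hP⟩ h6i h7j
    have hc := μ.terminates_compile hμ 64 (by norm_num) ξ
    rw [hM, hR.1 0 (by norm_num) (by norm_num) (by norm_num)] at hc
    refine (hc.mono (Expr.eval_cost_mono _ hB) (fun _ h => h)).seq ?_
    rintro ζ ⟨z1, z2, z3⟩
    have hz : ζ.reg 64 = f i j := by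
      rw [z3, hf]
      refine Expr.eval_congr _ μ hμ _ _ fun r hr => ?_
      by_cases hr7 : r = 7
      · subst hr7; simp [h7j]
      by_cases hr6 : r = 6
      · subst hr6; simp [h6i]
      simp [hr7, hr6, hR.1 r hr hr6 hr7]
    have e6 : ζ.reg 6 = i := (z2 6 (by norm_num)).trans h6i
    have e7 : ζ.reg 7 = j := (z2 7 (by norm_num)).trans h7j
    refine terminates_store ⟨⟨?_, ?_, ?_⟩, by simpa using e6, by simpa using e7⟩
    · refine ⟨fun r hr hr6 hr7 => (z2 r (by omega)).trans (hR.1 r hr hr6 hr7),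
        (z2 60 (by norm_num)).trans hR.2.1, (z2 61 (by norm_num)).trans hR.2.2.1,
        (z2 62 (by norm_num)).trans hR.2.2.2.1, (z2 63 (by norm_num)).trans hR.2.2.2.2⟩
    · funext a b
      simp [z1, hM]
    · intro a b hab
      rw [setArr_arr, e6, e7, hz, z1]
      by_cases h : a = i ∧ b = j
      · simp [h]
      · rw [if_neg (fun h' => h h'.2)]
        exact hP a b (hab.resolve_right h)
  rintro ξ ⟨hξ, -, hξ1⟩
  refine (terminates_matrixLoop (n := n) (c := 1 + 1)
    (fun P ξ => Regs ξ ∧ (∀ a b, a < n ∧ b < n → ξ.arr 1 a b = f a b) ∧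
      ∀ a b, P a b → ξ.arr 0 a b = f a b)
    (fun P ξ h => ⟨h.1.2.1, h.1.2.2.2.1⟩)
    (fun P ξ r v h hr => ⟨hRset ξ r v h.1 hr, h.2.1, h.2.2⟩) ?_
    ⟨hξ, hξ1, fun _ _ h => h.elim⟩).seq ?_
  · rintro i hi j hj P ζ ⟨hR, hM, hP⟩ h6i h7j
    refine (terminates_load (σ := ζ) (Q := fun ω => ω = ζ.setReg 64 (f i j)) ?_).seq ?_
    · rw [h6i, h7j, hM i j ⟨hi, hj⟩]
    rintro _ rfl
    refine terminates_store ⟨⟨hR64 ζ _ hR, ?_, ?_⟩, by simpa using h6i, by simpa using h7j⟩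
    · intro a b hab
      simp [hM a b hab]
    · intro a b hab
      simp only [setArr_arr, setReg_reg, setReg_arr, h6i, h7j]
      by_cases h : a = i ∧ b = j
      · simp [h]
      · simp [h, hP a b (hab.resolve_right h)]
  rintro ζ ⟨⟨z1, z2, z3, z4, z5⟩, -, z6⟩
  refine (terminates_add (Q := fun ω => ω = ζ.setReg 0 (ζ.reg 60 + ζ.reg 63)) rfl).seq ?_
  rintro _ rfl
  refine terminates_add ⟨by simp [z2, z5], by simp [z3, z5], ?_, ?_⟩
  · intro r hr h0 h1 h6 h7
    simp [h0, h1, z1 r hr h6 h7]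
  · intro i hi j hj
    exact z6 i j ⟨hi, hj⟩

/-! ### Formulas -/

/-- An expression regarded as a formula is true if its value is positive. -/
def Holds (M : ℕ → ℕ → ℕ) (φ : Expr) (e : ℕ → ℕ) : Prop := 0 < φ.eval M e

namespace Expr

def not (a : Expr) : Expr := ite a (const 0) (const 1)
def and (a b : Expr) : Expr := ite a b (const 0)
def or (a b : Expr) : Expr := ite a (const 1) b
def iff (a b : Expr) : Expr := ite a b (not b)
def le (a b : Expr) : Expr := not (lt b a)
def eq (a b : Expr) : Expr := and (le a b) (le b a)
def all (x : ℕ) (a : Expr) : Expr := not (sum x (not a))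
/-- The truth value of a formula. -/
def ind (a : Expr) : Expr := ite a (const 1) (const 0)
/-- The number of values of `x` for which a formula is true. -/
def count (x : ℕ) (a : Expr) : Expr := sum x (ind a)
/-- The multiple of an expression by a constant. -/
def smul : ℕ → Expr → Expr
  | 0, _ => const 0
  | c + 1, a => add (smul c a) a

end Expr

section

variable {M : ℕ → ℕ → ℕ} {a b c : Expr} {e : ℕ → ℕ} {x : ℕ}

@[simp] theorem holds_not : Holds M a.not e ↔ ¬ Holds M a e := by
  unfold Holds Expr.not; simp only [Expr.eval]; split_ifs <;> simp_all

@[simp] theorem holds_and : Holds M (a.and b) e ↔ Holds M a e ∧ Holds M b e := by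
  unfold Holds Expr.and; simp only [Expr.eval]; split_ifs <;> simp_all

@[simp] theorem holds_or : Holds M (a.or b) e ↔ Holds M a e ∨ Holds M b e := by
  unfold Holds Expr.or; simp only [Expr.eval]; split_ifs <;> simp_all

@[simp] theorem holds_iff : Holds M (a.iff b) e ↔ (Holds M a e ↔ Holds M b e) := by
  have := holds_not (M := M) (a := b) (e := e)
  unfold Holds Expr.iff at *; simp only [Expr.eval]; split_ifs <;> simp_all

@[simp] theorem holds_lt : Holds M (a.lt b) e ↔ a.eval M e < b.eval M e := by
  unfold Holds; simp only [Expr.eval]; split_ifs <;> simp_all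

@[simp] theorem holds_le : Holds M (a.le b) e ↔ a.eval M e ≤ b.eval M e := by
  simp [Expr.le]

@[simp] theorem holds_eq : Holds M (a.eq b) e ↔ a.eval M e = b.eval M e := by
  simp [Expr.eq, le_antisymm_iff]

@[simp] theorem holds_adj :
    Holds M (a.adj b) e ↔ 0 < M (a.eval M e) (b.eval M e) := Iff.rfl

/-- A sum of natural numbers is positive iff some summand is, so bounded sums serve as existential
quantifiers. -/
theorem holds_sum {N : ℕ} (h : e 0 = N) : Holds M (.sum x a) e ↔
    ∃ v : Fin N, Holds M a (Function.update e x v) := by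
  subst h
  unfold Holds
  simp only [Expr.eval, pos_iff_ne_zero, ne_eq, Finset.sum_eq_zero_iff, Finset.mem_range,
    not_forall, Fin.exists_iff, exists_prop]

theorem holds_all {N : ℕ} (h : e 0 = N) : Holds M (.all x a) e ↔
    ∀ v : Fin N, Holds M a (Function.update e x v) := by
  simp [Expr.all, holds_sum h]

open Classical in
@[simp] theorem eval_ind : (Expr.ind a).eval M e = if Holds M a e then 1 else 0 := by
  unfold Expr.ind Holds
  simp only [Expr.eval]
  congr

theorem eval_ind_of_iff {p : Prop} {_ : Decidable p} (h : Holds M a e ↔ p) :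
    (Expr.ind a).eval M e = if p then 1 else 0 := by
  rw [eval_ind]
  by_cases hp : p <;> simp [h, hp]

@[simp] theorem eval_var {i : ℕ} : (Expr.var i).eval M e = e i := rfl

@[simp] theorem eval_const {i : ℕ} : (Expr.const i).eval M e = i := rfl

@[simp] theorem eval_add : (Expr.add a b).eval M e = a.eval M e + b.eval M e := rfl

@[simp] theorem eval_sub : (Expr.sub a b).eval M e = a.eval M e - b.eval M e := rfl

@[simp] theorem eval_smul {n : ℕ} : (Expr.smul n a).eval M e = n * a.eval M e := by
  induction n with
  | zero => simp [Expr.smul]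
  | succ n ih => simp [Expr.smul, ih, add_mul]

theorem eval_count {N : ℕ} (h : e 0 = N) : (Expr.count x a).eval M e =
    {v : Fin N | Holds M a (Function.update e x v)}.ncard := by
  classical
  subst h
  rw [Set.ncard_eq_toFinset_card']
  unfold Expr.count
  simp only [Expr.eval, eval_ind]
  rw [← Fin.sum_univ_eq_sum_range (fun v => if Holds M a (Function.update e x v) then 1 else 0),
    Finset.sum_boole]
  simp

theorem eval_count_pair {N : ℕ} {y : ℕ} (h : e 0 = N) (hx : x ≠ 0) :
    (Expr.sum x (Expr.count y a)).eval M e =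
    {p : Fin N × Fin N | Holds M a (Function.update (Function.update e x p.1) y p.2)}.ncard := by
  classical
  subst h
  rw [Set.ncard_eq_toFinset_card', Expr.eval,
    ← Fin.sum_univ_eq_sum_range (fun v => (Expr.count y a).eval M (Function.update e x v))]
  rw [Finset.card_eq_sum_card_fiberwise (f := Prod.fst) (t := Finset.univ) (by simp)]
  refine Finset.sum_congr rfl fun v _ => ?_
  rw [eval_count (N := e 0) (by simp [hx.symm]),
    ← Set.ncard_image_of_injective _ (Prod.mk_right_injective v), ← Set.ncard_coe_finset]
  congr 1
  ext ⟨p, q⟩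
  simp only [Set.mem_image, Set.mem_ofPred_eq, Prod.mk.injEq, Finset.coe_filter,
    Set.mem_toFinset]
  constructor
  · rintro ⟨w, hw, rfl, rfl⟩; exact ⟨hw, rfl⟩
  · rintro ⟨hw, rfl⟩; exact ⟨q, hw, rfl, rfl⟩

end

/-! ### Instances in memory and reduction rules -/

/-- An instance of cograph edge editing. -/
structure Inst where
  N : ℕ
  k : ℕ
  G : SimpleGraph (Fin N)

/-- `I` is a positive instance. -/
def Inst.Positive (I : Inst) : Prop := CographEditable I.G I.k

/-- The potential of an instance that was obtained from one with parameter `K`. -/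
noncomputable def Inst.potential (K : ℕ) (I : Inst) : ℕ :=
  -- The weight `K + 2` lets one lost adjacency pay for the `k + 1 ≤ K + 1` vertices added by an
  -- extraction. The factor `3` lets one unit of the parameter pay for the two ordered pairs that an
  -- edit may create.
  I.N + (K + 2) * ({p : Fin I.N × Fin I.N | I.G.Adj p.1 p.2}.ncard + 3 * I.k)

theorem Inst.N_le_potential (K : ℕ) (I : Inst) : I.N ≤ I.potential K := Nat.le_add_right _ _

open Classical in
/-- The registers `e` and the matrix `M` hold the instance `I`. -/
structure Rep (M : ℕ → ℕ → ℕ) (e : ℕ → ℕ) (K : ℕ) (I : Inst) : Prop where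
  N : e 0 = I.N
  k : e 1 = I.k
  K : e 2 = K
  adj : ∀ i j : Fin I.N, M i j = if I.G.Adj i j then 1 else 0

theorem Rep.pos_iff {M : ℕ → ℕ → ℕ} {e : ℕ → ℕ} {K : ℕ} {I : Inst} (h : Rep M e K I)
    (i j : Fin I.N) : 0 < M i j ↔ I.G.Adj i j := by
  rw [h.adj]; split_ifs <;> simp_all

theorem Rep.congr {M M' : ℕ → ℕ → ℕ} {e e' : ℕ → ℕ} {K : ℕ} {I : Inst} (h : Rep M e K I)
    (hM : M' = M) (h0 : e' 0 = e 0) (h1 : e' 1 = e 1) (h2 : e' 2 = e 2) : Rep M' e' K I :=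
  ⟨h0.trans h.N, h1.trans h.k, h2.trans h.K, hM ▸ h.adj⟩

/-- A reduction rule: if the condition `c` holds for two vertices in the registers `4` and `5`,
then rewrite the instance. -/
structure Rule where
  c : Expr
  ν : Expr
  κ : Expr
  μ : Expr

open Classical in
/-- The rule `r` applies to the vertices satisfying `P`, is safe, and decreases the potential. -/
structure Rule.Valid (r : Rule) (P : (I : Inst) → Fin I.N → Fin I.N → Prop) : Prop where
  ok : r.c.Ok ∧ r.ν.Ok ∧ r.κ.Ok ∧ r.μ.Ok
  holds_iff : ∀ M e K I (x y : Fin I.N), Rep M e K I → e 4 = x → e 5 = y →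
    (Holds M r.c e ↔ P I x y)
  apply : ∀ M e K I (x y : Fin I.N), Rep M e K I → e 4 = x → e 5 = y → I.k ≤ K → P I x y →
    ∃ I' : Inst, r.ν.eval M e = I'.N ∧ r.κ.eval M e = I'.k ∧
      (∀ i j : Fin I'.N, r.μ.eval M (Function.update (Function.update e 6 i) 7 j) =
        if I'.G.Adj i j then 1 else 0) ∧
      (I.Positive ↔ I'.Positive) ∧ I'.k ≤ I.k ∧ I'.potential K < I.potential K

/-- The least `x` for which the condition holds for some `y`. -/
def pickX (c : Expr) : Expr :=
  .sum 40 (.not (.sum 4 (.and (.le (.var 4) (.var 40)) (.sum 5 c))))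

/-- The least `y` for which the condition holds. -/
def pickY (c : Expr) : Expr := .sum 40 (.not (.sum 5 (.and (.le (.var 5) (.var 40)) c)))

/-- The numbers without a witness at or below them are those below the least witness, so counting
them computes it. -/
theorem card_filter_forall_not_eq {N : ℕ} {P : ℕ → Prop} [DecidablePred P]
    (h : ∃ v < N, P v) : ∃ m < N, P m ∧
      ∀ f : ℕ → ℕ, (∀ v < N, (f v = if ∃ w < N, w ≤ v ∧ P w then 0 else 1)) →
        ∑ v ∈ Finset.range N, f v = m := by
  refine ⟨Nat.find h, (Nat.find_spec h).1, (Nat.find_spec h).2, fun f hf => ?_⟩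
  have hlt := (Nat.find_spec h).1
  rw [Finset.sum_congr rfl (g := fun v => if v < Nat.find h then 1 else 0), Finset.sum_boole]
  · have : {v ∈ Finset.range N | v < Nat.find h} = Finset.range (Nat.find h) := by
      ext v; simp only [Finset.mem_filter, Finset.mem_range]; omega
    rw [this]; simp
  · intro v hv
    rw [hf v (Finset.mem_range.1 hv)]
    by_cases hv' : v < Nat.find h
    · rw [if_pos hv', if_neg]
      rintro ⟨w, hw, hwv, hP⟩
      exact Nat.find_min h (lt_of_le_of_lt hwv hv') ⟨hw, hP⟩
    · rw [if_neg hv', if_pos ⟨_, hlt, by omega, (Nat.find_spec h).2⟩]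

theorem eval_not_eq {M : ℕ → ℕ → ℕ} {a : Expr} {e : ℕ → ℕ} [Decidable (Holds M a e)] :
    a.not.eval M e = if Holds M a e then 0 else 1 := by
  unfold Expr.not Holds at *
  simp only [Expr.eval]
  congr

section

variable {r : Rule} {P : (I : Inst) → Fin I.N → Fin I.N → Prop}

theorem Rule.Valid.eval_pickX (hr : r.Valid P) {M : ℕ → ℕ → ℕ} {e : ℕ → ℕ} {K : ℕ} {I : Inst}
    (h : Rep M e K I) (hP : ∃ x y, P I x y) :
    ∃ x : Fin I.N, (pickX r.c).eval M e = x ∧ ∃ y, P I x y := by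
  classical
  obtain ⟨m, hm, ⟨hm', y, hy⟩, hsum⟩ := card_filter_forall_not_eq (N := I.N)
    (P := fun v => ∃ h : v < I.N, ∃ y, P I ⟨v, h⟩ y)
    (by obtain ⟨x, y, hxy⟩ := hP; exact ⟨x, x.2, x.2, y, hxy⟩)
  refine ⟨⟨m, hm⟩, ?_, y, hy⟩
  unfold pickX
  rw [Expr.eval, h.N]
  refine hsum _ fun v hv => ?_
  rw [eval_not_eq]
  congr 1
  rw [holds_sum (N := I.N) (by simp [h.N]), Fin.exists_iff]
  simp only [holds_and, holds_le, eval_var, exists_prop, eq_iff_iff]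
  refine exists_congr fun w => ?_
  constructor
  · rintro ⟨hw, h1, h2⟩
    rw [holds_sum (N := I.N) (by simp [h.N])] at h2
    obtain ⟨y, h2⟩ := h2
    rw [hr.holds_iff M _ K I ⟨w, hw⟩ y (h.congr rfl (by simp) (by simp) (by simp)) (by simp)
      (by simp)] at h2
    exact ⟨hw, by simpa using h1, hw, y, h2⟩
  · rintro ⟨hw, h1, _, y, h2⟩
    refine ⟨hw, by simpa using h1, ?_⟩
    rw [holds_sum (N := I.N) (by simp [h.N])]
    exact ⟨y, (hr.holds_iff M _ K I ⟨w, hw⟩ y (h.congr rfl (by simp) (by simp) (by simp)) (by simp)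
      (by simp)).2 h2⟩

theorem Rule.Valid.eval_pickY (hr : r.Valid P) {M : ℕ → ℕ → ℕ} {e : ℕ → ℕ} {K : ℕ} {I : Inst}
    (h : Rep M e K I) {x : Fin I.N} (hx : e 4 = x) (hP : ∃ y, P I x y) :
    ∃ y : Fin I.N, (pickY r.c).eval M e = y ∧ P I x y := by
  classical
  obtain ⟨m, hm, ⟨hm', hy⟩, hsum⟩ := card_filter_forall_not_eq (N := I.N)
    (P := fun v => ∃ h : v < I.N, P I x ⟨v, h⟩)
    (by obtain ⟨y, hxy⟩ := hP; exact ⟨y, y.2, y.2, hxy⟩)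
  refine ⟨⟨m, hm⟩, ?_, hy⟩
  unfold pickY
  rw [Expr.eval, h.N]
  refine hsum _ fun v hv => ?_
  rw [eval_not_eq]
  congr 1
  rw [holds_sum (N := I.N) (by simp [h.N]), Fin.exists_iff]
  simp only [holds_and, holds_le, eval_var, exists_prop, eq_iff_iff]
  refine exists_congr fun w => ?_
  have key : ∀ hw : w < I.N, (Holds M r.c (Function.update (Function.update e 40 v) 5 w) ↔
      P I x ⟨w, hw⟩) := fun hw =>
    hr.holds_iff M _ K I x ⟨w, hw⟩ (h.congr rfl (by simp) (by simp) (by simp)) (by simpa using hx)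
      (by simp)
  constructor
  · rintro ⟨hw, h1, h2⟩
    exact ⟨hw, by simpa using h1, hw, (key hw).1 h2⟩
  · rintro ⟨hw, h1, _, h2⟩
    exact ⟨hw, by simpa using h1, (key hw).2 h2⟩

/-- The condition of a rule together with the condition that its arguments are vertices. -/
def Rule.guard (r : Rule) : Expr :=
  -- If there is no witness, the count in `pickX` is the number of vertices itself, which this test
  -- rejects.
  .and (.lt (.var 4) (.var 0)) (.and (.lt (.var 5) (.var 0)) r.c)

/-- Apply a rule once if possible, and set register `3` if it is applied. -/
def Rule.step (r : Rule) : RAM.Prog :=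
  .seq ((pickX r.c).compile 60) (.seq (.const 61 0) (.seq (.add 4 60 61)
    (.seq ((pickY r.c).compile 60) (.seq (.const 61 0) (.seq (.add 5 60 61)
    (.seq (r.guard.compile 60) (.seq (.const 61 0)
    (.ite 61 60 (.seq (updateProg r.ν r.κ r.μ) (.const 3 1)) .skip))))))))

/-- A bound on the running time of `step`. -/
noncomputable def Rule.stepCost (r : Rule) : Polynomial ℕ :=
  (pickX r.c).cost + (pickY r.c).cost + r.guard.cost + updateCost r.ν r.κ r.μ + 9

/-- The memory during a pass over the rules, started with the instance `I`: either no rule has been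
applied and the ones considered so far do not apply, or the potential has decreased. -/
def PassState (K : ℕ) (I : Inst) (D : Prop) (σ : RAM.Store) : Prop :=
  σ.reg 10 = 0 ∧ ((σ.reg 3 = 0 ∧ Rep (σ.arr 0) σ.reg K I ∧ D) ∨
    (σ.reg 3 = 1 ∧ ∃ I' : Inst, Rep (σ.arr 0) σ.reg K I' ∧ (I.Positive ↔ I'.Positive) ∧
      I'.k ≤ I.k ∧ I'.potential K < I.potential K))

theorem Rule.Valid.terminates_step_aux (hr : r.Valid P) {K B : ℕ} {I : Inst} (hk : I.k ≤ K)
    (hB : I.potential K ≤ B) {σ : RAM.Store} (hσ : Rep (σ.arr 0) σ.reg K I) :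
    Terminates r.step σ (r.stepCost.eval B) (fun τ => τ.reg 10 = σ.reg 10 ∧
      ((τ.reg 3 = σ.reg 3 ∧ Rep (τ.arr 0) τ.reg K I ∧ ∀ x y, ¬ P I x y) ∨
      (τ.reg 3 = 1 ∧ ∃ I' : Inst, Rep (τ.arr 0) τ.reg K I' ∧ (I.Positive ↔ I'.Positive) ∧
        I'.k ≤ I.k ∧ I'.potential K < I.potential K))) := by
  classical
  obtain ⟨okc, okν, okκ, okμ⟩ := hr.ok
  have okX : (pickX r.c).Ok := by simp [pickX, Expr.Ok, Expr.not, Expr.and, Expr.le, okc]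
  have okY : (pickY r.c).Ok := by simp [pickY, Expr.Ok, Expr.not, Expr.and, Expr.le, okc]
  have okg : r.guard.Ok := by simp [Rule.guard, Expr.Ok, Expr.and, okc]
  have hNB : I.N ≤ B := (I.N_le_potential K).trans hB
  refine Terminates.mono (t := (pickX r.c).cost.eval B + (1 + (1 + ((pickY r.c).cost.eval B +
    (1 + (1 + (r.guard.cost.eval B + (1 + (((updateCost r.ν r.κ r.μ).eval B + 1) + 1)))))))))
    ?_ ?_ (fun _ h => h)
  swap
  · simp only [Rule.stepCost, Polynomial.eval_add, Polynomial.eval_ofNat]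
    omega
  have hcost : ∀ (e : Expr) (τ : RAM.Store), e.Ok → τ.reg 0 = I.N →
      Terminates (e.compile 60) τ (e.cost.eval B) (Expr.Computes (τ.arr 0) e 60 τ) :=
    fun e τ he h0 => (e.terminates_compile he 60 le_rfl τ).mono
      (Expr.eval_cost_mono _ (h0 ▸ hNB)) (fun _ h => h)
  refine (hcost _ σ okX hσ.N).seq ?_
  rintro τ ⟨a1, a2, a3⟩
  refine (terminates_const (Q := fun ω => ω = τ.setReg 61 0) rfl).seq ?_
  rintro _ rfl
  refine (terminates_add (σ := τ.setReg 61 0) (Q := fun υ => υ.arr = σ.arr ∧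
    (∀ r < 60, r ≠ 4 → υ.reg r = σ.reg r) ∧ υ.reg 4 = (pickX r.c).eval (σ.arr 0) σ.reg)
    ⟨a1, ?_, ?_⟩).seq ?_
  · intro r hr h4
    simp [h4, show r ≠ 61 by omega, a2 r hr]
  · simp [a3]
  rintro υ ⟨b1, b2, b3⟩
  have hυ : Rep (υ.arr 0) υ.reg K I := hσ.congr (by rw [b1]) (b2 0 (by norm_num) (by norm_num))
    (b2 1 (by norm_num) (by norm_num)) (b2 2 (by norm_num) (by norm_num))
  refine (hcost _ υ okY hυ.N).seq ?_
  rintro ω ⟨c1, c2, c3⟩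
  refine (terminates_const (Q := fun ξ => ξ = ω.setReg 61 0) rfl).seq ?_
  rintro _ rfl
  refine (terminates_add (σ := ω.setReg 61 0) (Q := fun ξ => ξ.arr = σ.arr ∧
    (∀ r < 60, r ≠ 4 → r ≠ 5 → ξ.reg r = σ.reg r) ∧
    ξ.reg 4 = (pickX r.c).eval (σ.arr 0) σ.reg ∧ ξ.reg 5 = (pickY r.c).eval (υ.arr 0) υ.reg)
    ⟨c1.trans b1, ?_, ?_, ?_⟩).seq ?_
  · intro r hr h4 h5
    simp [h5, show r ≠ 61 by omega, c2 r hr, b2 r hr h4]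
  · simp [c2 4 (by norm_num), b3]
  · simp [c3]
  rintro ξ ⟨d1, d2, d3, d4⟩
  have hξ : Rep (ξ.arr 0) ξ.reg K I := hσ.congr (by rw [d1])
    (d2 0 (by norm_num) (by norm_num) (by norm_num))
    (d2 1 (by norm_num) (by norm_num) (by norm_num))
    (d2 2 (by norm_num) (by norm_num) (by norm_num))
  have hguard : (∃ x y, P I x y) → Holds (ξ.arr 0) r.guard ξ.reg := by
    intro hP
    obtain ⟨x, hx, hxP⟩ := hr.eval_pickX hσ hP
    obtain ⟨y, hy, hxy⟩ := hr.eval_pickY hυ (b3.trans hx) hxP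
    have e4 := d3.trans hx
    have e5 := d4.trans hy
    simp only [Rule.guard, holds_and, holds_lt, eval_var, e4, e5, hξ.N]
    exact ⟨x.2, y.2, (hr.holds_iff _ _ K I x y hξ e4 e5).2 hxy⟩
  refine (hcost _ ξ okg hξ.N).seq ?_
  rintro ζ ⟨f1, f2, f3⟩
  refine (terminates_const (Q := fun η => η = ζ.setReg 61 0) rfl).seq ?_
  rintro _ rfl
  have hζ : ∀ r < 60, (ζ.setReg 61 0).reg r = ξ.reg r := by
    intro r hr
    rw [setReg_reg, if_neg (by omega), f2 r hr]
  have hrep : Rep ((ζ.setReg 61 0).arr 0) (ζ.setReg 61 0).reg K I :=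
    hξ.congr (by rw [setReg_arr, f1]) (hζ 0 (by norm_num)) (hζ 1 (by norm_num))
      (hζ 2 (by norm_num))
  have hcond : (ζ.setReg 61 0).reg 61 < (ζ.setReg 61 0).reg 60 ↔
      Holds (ξ.arr 0) r.guard ξ.reg := by
    simp [f3, Holds]
  have h10 : (ζ.setReg 61 0).reg 10 = σ.reg 10 :=
    (hζ 10 (by norm_num)).trans (d2 10 (by norm_num) (by norm_num) (by norm_num))
  have h3 : (ζ.setReg 61 0).reg 3 = σ.reg 3 :=
    (hζ 3 (by norm_num)).trans (d2 3 (by norm_num) (by norm_num) (by norm_num))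
  refine terminates_ite (fun h => ?_) fun h => ?_
  · rw [hcond] at h
    simp only [Rule.guard, holds_and, holds_lt, eval_var, hξ.N] at h
    obtain ⟨h4, h5, hc⟩ := h
    have hP : P I ⟨_, h4⟩ ⟨_, h5⟩ := (hr.holds_iff _ _ K I ⟨_, h4⟩ ⟨_, h5⟩ hξ rfl rfl).1 hc
    obtain ⟨I', hN, hk', hadj, hpos, hkk, hpot⟩ := hr.apply _ _ K I ⟨_, h4⟩ ⟨_, h5⟩ hrep
      (hζ 4 (by norm_num)) (hζ 5 (by norm_num)) hk hP
    refine (terminates_updateProg okν okκ okμ (B := B) ?_ ?_).seq ?_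
    · rw [hrep.N]; exact hNB
    · rw [hN]; exact (I'.N_le_potential K).trans (hpot.le.trans hB)
    rintro η ⟨g1, g2, g3, g4⟩
    refine terminates_const ⟨?_, Or.inr ⟨by simp, I', ⟨?_, ?_, ?_, ?_⟩, hpos, hkk, hpot⟩⟩
    · rw [setReg_reg, if_neg (by norm_num), g3 10 (by norm_num) (by norm_num) (by norm_num)
        (by norm_num) (by norm_num), h10]
    · exact g1.trans hN
    · exact g2.trans hk'
    · simp only [setReg_reg, show (2 : ℕ) ≠ 3 by norm_num, if_false]
      rw [g3 2 (by norm_num) (by norm_num) (by norm_num) (by norm_num) (by norm_num), hrep.K]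
    · intro i j
      rw [setReg_arr, ← hadj i j]
      exact g4 i (hN.symm ▸ i.2 : (i : ℕ) < _) j (hN.symm ▸ j.2 : (j : ℕ) < _)
  · refine Terminates.mono (t := 1) (terminates_skip ⟨h10, Or.inl ⟨h3, hrep, ?_⟩⟩) (by omega)
      (fun _ h => h)
    intro x y hxy
    exact h (hcond.2 (hguard ⟨x, y, hxy⟩))

theorem Rule.Valid.terminates_step (hr : r.Valid P) {K B : ℕ} {I : Inst} (hk : I.k ≤ K)
    (hB : I.potential K ≤ B) {D : Prop} {σ : RAM.Store} (hσ : PassState K I D σ) :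
    Terminates r.step σ (r.stepCost.eval B) (PassState K I (D ∧ ∀ x y, ¬ P I x y)) := by
  obtain ⟨h10, ⟨h3, hrep, hD⟩ | ⟨h3, I', hrep, hpos, hkk, hpot⟩⟩ := hσ
  · refine (hr.terminates_step_aux hk hB hrep).mono le_rfl ?_
    rintro τ ⟨h10', ⟨h3', hrep', hP⟩ | h⟩
    · exact ⟨h10'.trans h10, Or.inl ⟨h3'.trans h3, hrep', hD, hP⟩⟩
    · exact ⟨h10'.trans h10, Or.inr h⟩
  · refine (hr.terminates_step_aux (hkk.trans hk) (hpot.le.trans hB) hrep).mono le_rfl ?_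
    rintro τ ⟨h10', ⟨h3', hrep', _⟩ | ⟨h3', I'', hrep', hpos', hkk', hpot'⟩⟩
    · exact ⟨h10'.trans h10, Or.inr ⟨h3'.trans h3, I', hrep', hpos, hkk, hpot⟩⟩
    · exact ⟨h10'.trans h10, Or.inr ⟨h3', I'', hrep', hpos.trans hpos', hkk'.trans hkk,
        hpot'.trans hpot⟩⟩

end

/-! ### Formulas about sets of vertices -/

/-- The registers below `30` agree. -/
def Agree (e e' : ℕ → ℕ) : Prop := ∀ r < 30, e' r = e r

theorem Agree.refl (e : ℕ → ℕ) : Agree e e := fun _ _ => rfl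

theorem Agree.update {e e' : ℕ → ℕ} (h : Agree e e') {x : ℕ} (hx : 30 ≤ x) (v : ℕ) :
    Agree e (Function.update e' x v) := fun r hr => by
  rw [Function.update_of_ne (by omega), h r hr]

/-- For every register `x` below `39`, the formula `φ x` says that `x` holds an element of `S`. -/
def Defines (M : ℕ → ℕ → ℕ) (e : ℕ → ℕ) {I : Inst} (φ : ℕ → Expr) (S : Set (Fin I.N)) : Prop :=
  ∀ e', Agree e e' → ∀ x < 39, ∀ c : Fin I.N, e' x = c → (Holds M (φ x) e' ↔ c ∈ S)

namespace Expr

/-- Parameters are read from registers below `30`. Registers `30` to `32` are bound in the formulas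
that follow, and `39` is bound in `mem_twins`, so a register holding an element stays below `39`. -/
def mem_nbrDiff (u w x : ℕ) : Expr := and (adj (var u) (var x)) (not (adj (var w) (var x)))
def mem_twins (u x : ℕ) : Expr :=
  all 39 (iff (adj (var x) (var 39)) (adj (var u) (var 39)))
def card (φ : ℕ → Expr) : Expr := count 30 (φ 30)
def subset (φ ψ : ℕ → Expr) : Expr := all 30 (or (not (φ 30)) (ψ 30))
def isModule (φ : ℕ → Expr) : Expr :=
  all 30 (or (not (φ 30)) (all 31 (or (not (φ 31)) (all 32 (or (φ 32)
    (iff (adj (var 30) (var 32)) (adj (var 31) (var 32))))))))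
def defect (a : ℕ) (φ : ℕ → Expr) : Expr :=
  sum 30 (count 31 (and (φ 30) (and (not (φ 31))
    (not (iff (adj (var 30) (var 31)) (adj (var a) (var 31)))))))
def layer (b a : ℕ) (φ ψ χ : ℕ → Expr) : Expr :=
  count 30 (and (ψ 30) (and (not (φ 30))
    (and (all 31 (or (not (φ 31)) (iff (adj (var 30) (var 31)) (const b))))
      (all 31 (or (χ 31) (iff (adj (var 30) (var 31)) (adj (var a) (var 31))))))))
def nested (t a : ℕ) (φ ψ χ : ℕ → Expr) : Expr :=
  and (φ a) (and (subset φ ψ) (and (subset ψ χ) (and (lt (add (var 1) (var t)) (card φ))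
    (and (and (le (defect a φ) (var t)) (and (le (defect a ψ) (var t)) (le (defect a χ) (var t))))
      (and (and (le (add (smul 3 (var t)) (const 1)) (layer 1 a φ ψ χ))
        (le (add (smul 3 (var t)) (const 1)) (layer 0 a φ ψ χ)))
        (and (le (add (smul 3 (var t)) (const 1)) (layer 1 a ψ χ χ))
        (le (add (smul 3 (var t)) (const 1)) (layer 0 a ψ χ χ))))))))
def twinModule (x y : ℕ) : Expr :=
  and (adj (var x) (var y)) (all 30 (or (mem_twins x 30) (or (mem_twins y 30)
    (iff (adj (var x) (var 30)) (adj (var y) (var 30))))))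

end Expr

section

variable {M : ℕ → ℕ → ℕ} {e : ℕ → ℕ} {K : ℕ} {I : Inst} {φ ψ χ : ℕ → Expr}
  {S T U : Set (Fin I.N)}

@[simp] theorem holds_const {c : ℕ} : Holds M (.const c) e ↔ 0 < c := Iff.rfl

theorem Rep.holds_adj (h : Rep M e K I) {e' : ℕ → ℕ} {x y : ℕ} {a b : Fin I.N} (hx : e' x = a)
    (hy : e' y = b) : Holds M (.adj (.var x) (.var y)) e' ↔ I.G.Adj a b := by
  rw [CographKernel.holds_adj, eval_var, eval_var, hx, hy, h.pos_iff]

theorem Rep.update (h : Rep M e K I) {x : ℕ} (hx : 2 < x) (v : ℕ) :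
    Rep M (Function.update e x v) K I :=
  h.congr rfl (Function.update_of_ne (by omega) _ _) (Function.update_of_ne (by omega) _ _)
    (Function.update_of_ne (by omega) _ _)

theorem Rep.defines_nbrDiff (h : Rep M e K I) {u w : ℕ} {a b : Fin I.N} (hu : e u = a)
    (hw : e w = b) (hu' : u < 30) (hw' : w < 30) :
    Defines M e (Expr.mem_nbrDiff u w) (nbrDiff I.G a b) := by
  intro e' he x hx c hc
  rw [Expr.mem_nbrDiff, holds_and, holds_not, h.holds_adj ((he u hu').trans hu) hc,
    h.holds_adj ((he w hw').trans hw) hc]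
  rfl

theorem Rep.defines_twins (h : Rep M e K I) {u : ℕ} {a : Fin I.N} (hu : e u = a) (hu' : u < 30) :
    Defines M e (Expr.mem_twins u) (twins I.G a) := by
  intro e' he x hx c hc
  rw [Expr.mem_twins, holds_all ((he 0 (by norm_num)).trans h.N)]
  refine forall_congr' fun v => ?_
  rw [holds_iff, h.holds_adj (a := c) (b := v) (by rw [Function.update_of_ne hx.ne, hc]) (by simp),
    h.holds_adj (a := a) (b := v)
      (by rw [Function.update_of_ne (by omega), he u hu', hu]) (by simp)]

theorem Defines.congr {e' : ℕ → ℕ} (h : Defines M e φ S) (he : Agree e e') : Defines M e' φ S :=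
  fun _ he' => h _ fun r hr => (he' r hr).trans (he r hr)

theorem Defines.holds_update (h : Defines M e φ S) {x : ℕ} (hx : 30 ≤ x) (hx' : x < 39)
    (c : Fin I.N) : Holds M (φ x) (Function.update e x c) ↔ c ∈ S :=
  h _ ((Agree.refl e).update hx c) x hx' c (by simp)

theorem Rep.eval_card (h : Rep M e K I) (hφ : Defines M e φ S) :
    (Expr.card φ).eval M e = S.ncard := by
  rw [Expr.card, eval_count h.N]
  congr 1
  ext c
  exact hφ.holds_update (by norm_num) (by norm_num) c

theorem Rep.holds_subset (h : Rep M e K I) (hφ : Defines M e φ S) (hψ : Defines M e ψ T) :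
    Holds M (Expr.subset φ ψ) e ↔ S ⊆ T := by
  rw [Expr.subset, holds_all h.N]
  refine forall_congr' fun c => ?_
  rw [holds_or, holds_not, hφ.holds_update (by norm_num) (by norm_num),
    hψ.holds_update (by norm_num) (by norm_num), imp_iff_not_or]

theorem Rep.holds_isModule (h : Rep M e K I) (hφ : Defines M e φ S) :
    Holds M (Expr.isModule φ) e ↔ IsModule I.G S := by
  rw [Expr.isModule, holds_all h.N]
  refine forall_congr' fun a => ?_
  have h1 := h.update (x := 30) (by norm_num) a
  have hφ1 := hφ.congr ((Agree.refl e).update (x := 30) le_rfl a)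
  rw [holds_or, holds_not, hφ.holds_update (by norm_num) (by norm_num), holds_all h1.N,
    imp_iff_not_or]
  refine or_congr Iff.rfl (forall_congr' fun b => ?_)
  have h2 := h1.update (x := 31) (by norm_num) b
  have hφ2 := hφ1.congr ((Agree.refl _).update (x := 31) (by norm_num) b)
  rw [holds_or, holds_not, hφ1.holds_update (by norm_num) (by norm_num), holds_all h2.N,
    imp_iff_not_or]
  refine or_congr Iff.rfl (forall_congr' fun c => ?_)
  rw [holds_or, hφ2.holds_update (by norm_num) (by norm_num), holds_iff,
    h.holds_adj (a := a) (b := c) (by simp) (by simp),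
    h.holds_adj (a := b) (b := c) (by simp) (by simp)]
  tauto

theorem Rep.eval_defect (h : Rep M e K I) (hφ : Defines M e φ S) {a : ℕ} {a₀ : Fin I.N}
    (ha : e a = a₀) (ha' : a < 30) : (Expr.defect a φ).eval M e = (defect I.G a₀ S).ncard := by
  rw [Expr.defect, eval_count_pair h.N (by norm_num)]
  congr 1
  ext ⟨p, q⟩
  have he : Agree e (Function.update (Function.update e 30 p) 31 q) :=
    ((Agree.refl e).update (by norm_num) _).update (by norm_num) _
  rw [Set.mem_ofPred_eq, holds_and, holds_and, holds_not, holds_not, holds_iff,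
    hφ _ he 30 (by norm_num) p (by simp), hφ _ he 31 (by norm_num) q (by simp),
    h.holds_adj (a := p) (b := q) (by simp) (by simp),
    h.holds_adj (a := a₀) (b := q) ((he a ha').trans ha) (by simp)]
  rfl

theorem Rep.eval_layer (h : Rep M e K I) (hφ : Defines M e φ S) (hψ : Defines M e ψ T)
    (hχ : Defines M e χ U) {a b : ℕ} {a₀ : Fin I.N} (ha : e a = a₀) (ha' : a < 30) :
    (Expr.layer b a φ ψ χ).eval M e = (layer I.G (0 < b) a₀ S T U).ncard := by
  rw [Expr.layer, eval_count h.N]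
  congr 1
  ext v
  have h1 := h.update (x := 30) (by norm_num) v
  have he : ∀ z : Fin I.N, Agree e (Function.update (Function.update e 30 v) 31 z) := fun z =>
    ((Agree.refl e).update (by norm_num) _).update (by norm_num) _
  rw [Set.mem_ofPred_eq, holds_and, holds_and, holds_not, holds_and, holds_all h1.N,
    holds_all h1.N, hψ.holds_update (by norm_num) (by norm_num),
    hφ.holds_update (by norm_num) (by norm_num)]
  refine and_congr Iff.rfl (and_congr Iff.rfl (and_congr (forall_congr' fun z => ?_)
    (forall_congr' fun z => ?_)))
  · rw [holds_or, holds_not, holds_iff, holds_const, hφ _ (he z) 31 (by norm_num) z (by simp),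
      h.holds_adj (a := v) (b := z) (by simp) (by simp), imp_iff_not_or]
  · rw [holds_or, holds_iff, hχ _ (he z) 31 (by norm_num) z (by simp),
      h.holds_adj (a := v) (b := z) (by simp) (by simp),
      h.holds_adj (a := a₀) (b := z) ((he z a ha').trans ha) (by simp)]
    tauto

theorem Rep.holds_nested (h : Rep M e K I) (hφ : Defines M e φ S) (hψ : Defines M e ψ T)
    (hχ : Defines M e χ U) {t a : ℕ} {a₀ : Fin I.N} (ha : e a = a₀) (ha' : a < 30) :
    Holds M (Expr.nested t a φ ψ χ) e ↔ Nested I.G I.k (e t) a₀ S T U := by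
  have h1 : (0 < 1) = True := by simp
  have h0 : (0 < 0) = False := by simp
  rw [Expr.nested]
  simp only [holds_and, holds_lt, holds_le, eval_add, eval_smul, eval_var, eval_const,
    h.eval_card hφ, h.eval_defect hφ ha ha', h.eval_defect hψ ha ha', h.eval_defect hχ ha ha',
    h.eval_layer hφ hψ hχ ha ha', h.eval_layer hψ hχ hχ ha ha', h.holds_subset hφ hψ,
    h.holds_subset hψ hχ, hφ e (Agree.refl e) a (by omega) a₀ ha, h.k, h1, h0]
  constructor
  · rintro ⟨a1, a2, a3, a4, ⟨a5, a6, a7⟩, ⟨a8, a9⟩, a10, a11⟩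
    exact ⟨a1, a2, a3, a4, a5, a6, a7, a8, a9, a10, a11⟩
  · rintro ⟨a1, a2, a3, a4, a5, a6, a7, a8, a9, a10, a11⟩
    exact ⟨a1, a2, a3, a4, ⟨a5, a6, a7⟩, ⟨a8, a9⟩, a10, a11⟩

theorem Rep.holds_twinModule (h : Rep M e K I) {x y : ℕ} {a b : Fin I.N} (hx : e x = a)
    (hy : e y = b) (hx' : x < 30) (hy' : y < 30) :
    Holds M (Expr.twinModule x y) e ↔ TwinModule I.G a b := by
  rw [Expr.twinModule, holds_and, h.holds_adj hx hy, holds_all h.N]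
  refine and_congr Iff.rfl (forall_congr' fun z => ?_)
  rw [holds_or, holds_or, holds_iff,
    (h.defines_twins hx hx').holds_update (by norm_num) (by norm_num),
    (h.defines_twins hy hy').holds_update (by norm_num) (by norm_num),
    h.holds_adj (a := a) (b := z) (by rw [Function.update_of_ne (by omega), hx]) (by simp),
    h.holds_adj (a := b) (b := z) (by rw [Function.update_of_ne (by omega), hy]) (by simp)]
  tauto

end

/-! ### The rules of the algorithm -/

/-- If `x` has more than `k + 1` twins, delete `x` and move the last vertex to its place. -/
def twinRule : Rule where
  c := .lt (.add (.var 1) (.const 1)) (.card (.mem_twins 4))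
  ν := .sub (.var 0) (.const 1)
  κ := .var 1
  μ := .ind (.adj (.ite (.eq (.var 6) (.var 4)) (.sub (.var 0) (.const 1)) (.var 6))
    (.ite (.eq (.var 7) (.var 4)) (.sub (.var 0) (.const 1)) (.var 7)))

/-- If the union of the twin classes of `x` and `y` is a complete bipartite module, delete the
edges in this module. -/
def bipartiteRule : Rule where
  c := .twinModule 4 5
  ν := .var 0
  κ := .var 1
  μ := .ind (.and (.adj (.var 6) (.var 7))
    (.not (.and (.or (.mem_twins 4 6) (.mem_twins 5 6)) (.or (.mem_twins 4 7) (.mem_twins 5 7)))))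

/-- If the neighbours of `x` that are not neighbours of `y` form a module with more than `k + 1`
vertices, disconnect the module, and put `k + 1` independent vertices in its place. -/
def extractRule : Rule where
  c := .and (.isModule (.mem_nbrDiff 4 5))
    (.lt (.add (.var 1) (.const 1)) (.card (.mem_nbrDiff 4 5)))
  ν := .add (.var 0) (.add (.var 1) (.const 1))
  κ := .var 1
  μ := .ind (.ite (.lt (.var 6) (.var 0))
    (.ite (.lt (.var 7) (.var 0))
      (.and (.adj (.var 6) (.var 7)) (.iff (.mem_nbrDiff 4 5 6) (.mem_nbrDiff 4 5 7)))
      (.and (.not (.mem_nbrDiff 4 5 6))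
        -- A vertex outside a module is joined to all of it or to none, so it suffices to find one
        -- neighbour there.
        (.sum 30 (.and (.mem_nbrDiff 4 5 30) (.adj (.var 30) (.var 6))))))
    (.and (.lt (.var 7) (.var 0)) (.and (.not (.mem_nbrDiff 4 5 7))
      (.sum 30 (.and (.mem_nbrDiff 4 5 30) (.adj (.var 30) (.var 7)))))))

/-- If a nested approximate module shows that the pair of `x` and `y` is edited in every optimal
solution, edit this pair. -/
def nestedRule : Rule where
  c := .and (.lt (.const 0) (.var 1)) (.sum 11 (.sum 12 (.sum 13 (.sum 14 (.sum 15 (.sum 16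
    (.sum 17 (.sum 18 (.and
      (.nested 11 12 (.mem_nbrDiff 13 14) (.mem_nbrDiff 15 16) (.mem_nbrDiff 17 18))
      (.and (.mem_nbrDiff 13 14 4) (.and (.not (.mem_nbrDiff 17 18 5))
        (.not (.iff (.adj (.var 4) (.var 5)) (.adj (.var 12) (.var 5)))))))))))))))
  ν := .var 0
  κ := .sub (.var 1) (.const 1)
  μ := .ind (.iff (.adj (.var 6) (.var 7)) (.not (.or
    (.and (.eq (.var 6) (.var 4)) (.eq (.var 7) (.var 5)))
    (.and (.eq (.var 6) (.var 5)) (.eq (.var 7) (.var 4))))))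

def TwinRuleApplies (I : Inst) (x _y : Fin I.N) : Prop := I.k + 1 < (twins I.G x).ncard

def ExtractRuleApplies (I : Inst) (x y : Fin I.N) : Prop :=
  IsModule I.G (nbrDiff I.G x y) ∧ I.k + 1 < (nbrDiff I.G x y).ncard

def NestedRuleApplies (I : Inst) (x y : Fin I.N) : Prop :=
  0 < I.k ∧ ∃ t a₀ u₁ w₁ u₂ w₂ u₃ w₃ : Fin I.N,
    Nested I.G I.k t a₀ (nbrDiff I.G u₁ w₁) (nbrDiff I.G u₂ w₂) (nbrDiff I.G u₃ w₃) ∧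
    x ∈ nbrDiff I.G u₁ w₁ ∧ y ∉ nbrDiff I.G u₃ w₃ ∧ ¬ (I.G.Adj x y ↔ I.G.Adj a₀ y)

/-- The number of vertices of an instance to which no rule applies. -/
theorem card_le_kernelBound_of_irreducible (I : Inst) (hpos : I.Positive)
    (h₁ : ∀ x y, ¬ TwinRuleApplies I x y) (h₂ : ∀ x y, ¬ TwinModule I.G x y)
    (h₃ : ∀ x y, ¬ ExtractRuleApplies I x y) (h₄ : ∀ x y, ¬ NestedRuleApplies I x y) :
    I.N ≤ kernelBound I.k := by
  rw [← Fintype.card_fin I.N]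
  refine card_le_kernelBound hpos (fun X hX hc => ?_) (fun u w _ hm => ?_) ?_
  · have hind := not_adj_of_no_twinModule h₂ hX hc
    refine ⟨hind, ?_⟩
    rcases X.eq_empty_or_nonempty with rfl | ⟨x, hx⟩
    · simp
    -- An independent module consists of twins of any one of its vertices.
    · refine le_trans (Set.ncard_le_ncard (t := twins I.G x) fun y hy z => ?_) (not_lt.1 (h₁ x x))
      by_cases hz : z ∈ X
      · simp [hind y hy z hz, hind x hx z hz]
      · exact hX y hy x hx z hz
  · exact not_lt.1 fun h => h₃ u w ⟨hm, h⟩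
  · intro hk t a₀ u₁ w₁ u₂ w₂ u₃ w₃ _ hn x hx y hy
    by_contra hxy
    -- The search over `t` may be confined to numbers below `N`, since `k + t < |A₁| ≤ N`.
    have ht : t < I.N := by
      have h5 := hn.card
      have h6 := Set.ncard_le_ncard (Set.subset_univ (nbrDiff I.G u₁ w₁))
      rw [Set.ncard_univ, Nat.card_eq_fintype_card, Fintype.card_fin] at h6
      omega
    exact h₄ x y ⟨hk, ⟨t, ht⟩, a₀, u₁, w₁, u₂, w₂, u₃, w₃, hn, hx, hy, hxy⟩

theorem twinRule_valid : twinRule.Valid TwinRuleApplies where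
  ok := by
    simp [twinRule, Expr.Ok, Expr.card, Expr.mem_twins, Expr.all, Expr.not, Expr.iff, Expr.count,
      Expr.ind, Expr.eq, Expr.le, Expr.and]
  holds_iff := by
    intro M e K I x y h hx hy
    rw [twinRule, holds_lt, h.eval_card (h.defines_twins hx (by norm_num)), eval_add, eval_var,
      h.k, eval_const, TwinRuleApplies]
  apply := by
    classical
    intro M e K I x y h hx hy hk hP
    have hN : 0 < I.N := x.pos
    let φ : Fin (I.N - 1) → Fin I.N := fun i =>
      if (i : ℕ) = x then ⟨I.N - 1, by omega⟩ else ⟨i, by omega⟩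
    have hφ : Function.Injective φ := by
      intro i j hij
      have := i.2
      have := j.2
      simp only [φ, Fin.ext_iff] at hij ⊢
      split_ifs at hij <;> simp at hij <;> omega
    have hval : ∀ i : Fin (I.N - 1), (if (i : ℕ) = x then I.N - 1 else (i : ℕ)) = φ i := by
      intro i
      simp only [φ]
      split_ifs <;> rfl
    refine ⟨⟨I.N - 1, I.k, I.G.comap φ⟩, ?_, h.k, ?_, ?_, le_rfl, ?_⟩
    · simp [twinRule, h.N]
    · intro i j
      have h6 : (Expr.ite (.eq (.var 6) (.var 4)) (.sub (.var 0) (.const 1)) (.var 6)).eval M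
          (Function.update (Function.update e 6 i) 7 j) = φ i := by
        rw [← hval, Expr.eval]
        refine if_congr (holds_eq.trans ?_) ?_ ?_ <;> simp [hx, h.N]
      have h7 : (Expr.ite (.eq (.var 7) (.var 4)) (.sub (.var 0) (.const 1)) (.var 7)).eval M
          (Function.update (Function.update e 6 i) 7 j) = φ j := by
        rw [← hval, Expr.eval]
        refine if_congr (holds_eq.trans ?_) ?_ ?_ <;> simp [hx, h.N]
      refine eval_ind_of_iff ?_
      rw [holds_adj, h6, h7, h.pos_iff]
      rfl
    · refine cographEditable_remove_twin_iff hφ (fun v hv => ?_) hP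
      by_cases hv' : (v : ℕ) = I.N - 1
      · refine ⟨⟨x, ?_⟩, ?_⟩
        · have := x.2
          have : (x : ℕ) ≠ v := fun e => hv (Fin.ext e.symm)
          change (x : ℕ) < I.N - 1
          omega
        · simp [φ, Fin.ext_iff, hv']
      · refine ⟨⟨v, ?_⟩, ?_⟩
        · have := v.2
          change (v : ℕ) < I.N - 1
          omega
        · have : (v : ℕ) ≠ x := fun e => hv (Fin.ext e)
          simp [φ, this]
    · have h1 : {p : Fin (I.N - 1) × Fin (I.N - 1) | (I.G.comap φ).Adj p.1 p.2}.ncard ≤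
          {p : Fin I.N × Fin I.N | I.G.Adj p.1 p.2}.ncard :=
        ncard_le_of_map hφ fun _ _ h => h
      have h2 := Nat.mul_le_mul_left (K + 2) (Nat.add_le_add_right h1 (3 * I.k))
      simp only [Inst.potential]
      omega

theorem bipartiteRule_valid : bipartiteRule.Valid fun I x y => TwinModule I.G x y where
  ok := by
    simp [bipartiteRule, Expr.Ok, Expr.twinModule, Expr.mem_twins, Expr.all, Expr.not, Expr.iff,
      Expr.ind, Expr.and, Expr.or]
  holds_iff := by
    intro M e K I x y h hx hy
    exact h.holds_twinModule hx hy (by norm_num) (by norm_num)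
  apply := by
    classical
    intro M e K I x y h hx hy hk hP
    let G' : SimpleGraph (Fin I.N) :=
      { Adj := fun p q => I.G.Adj p q ∧
          ¬ (p ∈ twins I.G x ∪ twins I.G y ∧ q ∈ twins I.G x ∪ twins I.G y)
        symm := ⟨fun p q h => ⟨h.1.symm, fun h' => h.2 h'.symm⟩⟩
        loopless := ⟨fun p h => I.G.loopless.irrefl _ h.1⟩ }
    refine ⟨⟨I.N, I.k, G'⟩, h.N, h.k, ?_, hP.cographEditable_iff fun _ _ => Iff.rfl, le_rfl, ?_⟩
    · intro i j
      set e' := Function.update (Function.update e 6 i) 7 j with he'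
      have h' : Rep M e' K I := (h.update (by norm_num) _).update (by norm_num) _
      have e4 : e' 4 = x := by simp [he', hx]
      have e5 : e' 5 = y := by simp [he', hy]
      have e6 : e' 6 = i := by simp [he']
      have e7 : e' 7 = j := by simp [he']
      have dx := h'.defines_twins e4 (by norm_num)
      have dy := h'.defines_twins e5 (by norm_num)
      refine eval_ind_of_iff ?_
      rw [holds_and, holds_not, holds_and, holds_or, holds_or, h'.holds_adj e6 e7,
        dx e' (Agree.refl _) 6 (by norm_num) i e6, dx e' (Agree.refl _) 7 (by norm_num) j e7,
        dy e' (Agree.refl _) 6 (by norm_num) i e6, dy e' (Agree.refl _) 7 (by norm_num) j e7]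
      rfl
    · have h1 : {p : Fin I.N × Fin I.N | G'.Adj p.1 p.2}.ncard <
          {p : Fin I.N × Fin I.N | I.G.Adj p.1 p.2}.ncard := by
        refine Set.ncard_lt_ncard ⟨fun p hp => hp.1, fun hsub => ?_⟩
        have h2 : G'.Adj x y := @hsub (x, y) hP.1
        exact h2.2 ⟨Or.inl fun _ => Iff.rfl, Or.inr fun _ => Iff.rfl⟩
      have h2 := Nat.mul_lt_mul_of_pos_left (Nat.add_lt_add_right h1 (3 * I.k))
        (show 0 < K + 2 by omega)
      simp only [Inst.potential]
      omega

theorem nestedRule_valid : nestedRule.Valid NestedRuleApplies where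
  ok := by
    simp [nestedRule, Expr.Ok, Expr.nested, Expr.mem_nbrDiff, Expr.all, Expr.not, Expr.iff,
      Expr.ind, Expr.and, Expr.or, Expr.eq, Expr.le, Expr.smul, Expr.layer, Expr.defect,
      Expr.count, Expr.card, Expr.subset]
  holds_iff := by
    intro M e K I x y h hx hy
    rw [nestedRule, holds_and, holds_lt, eval_const, eval_var, h.k, NestedRuleApplies]
    refine and_congr Iff.rfl ?_
    rw [holds_sum h.N]; refine exists_congr fun t => ?_
    have h1 := h.update (x := 11) (by norm_num) t
    rw [holds_sum h1.N]; refine exists_congr fun a₀ => ?_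
    have h2 := h1.update (x := 12) (by norm_num) a₀
    rw [holds_sum h2.N]; refine exists_congr fun u₁ => ?_
    have h3 := h2.update (x := 13) (by norm_num) u₁
    rw [holds_sum h3.N]; refine exists_congr fun w₁ => ?_
    have h4 := h3.update (x := 14) (by norm_num) w₁
    rw [holds_sum h4.N]; refine exists_congr fun u₂ => ?_
    have h5 := h4.update (x := 15) (by norm_num) u₂
    rw [holds_sum h5.N]; refine exists_congr fun w₂ => ?_
    have h6 := h5.update (x := 16) (by norm_num) w₂
    rw [holds_sum h6.N]; refine exists_congr fun u₃ => ?_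
    have h7 := h6.update (x := 17) (by norm_num) u₃
    rw [holds_sum h7.N]; refine exists_congr fun w₃ => ?_
    have h8 := h7.update (x := 18) (by norm_num) w₃
    set e' := Function.update (Function.update (Function.update (Function.update
      (Function.update (Function.update (Function.update (Function.update e 11 t) 12 a₀) 13 u₁)
      14 w₁) 15 u₂) 16 w₂) 17 u₃) 18 w₃ with he'
    have d₁ := h8.defines_nbrDiff (u := 13) (w := 14) (a := u₁) (b := w₁) (by simp [he'])
      (by simp [he']) (by norm_num) (by norm_num)
    have d₂ := h8.defines_nbrDiff (u := 15) (w := 16) (a := u₂) (b := w₂) (by simp [he'])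
      (by simp [he']) (by norm_num) (by norm_num)
    have d₃ := h8.defines_nbrDiff (u := 17) (w := 18) (a := u₃) (b := w₃) (by simp [he'])
      (by simp [he']) (by norm_num) (by norm_num)
    have e4 : e' 4 = x := by simp [he', hx]
    have e5 : e' 5 = y := by simp [he', hy]
    have e11 : e' 11 = t := by simp [he']
    have e12 : e' 12 = a₀ := by simp [he']
    rw [holds_and, holds_and, holds_and, holds_not, holds_not, holds_iff,
      h8.holds_nested d₁ d₂ d₃ e12 (by norm_num), e11, h8.holds_adj e4 e5, h8.holds_adj e12 e5,
      d₁ e' (Agree.refl _) 4 (by norm_num) x e4, d₃ e' (Agree.refl _) 5 (by norm_num) y e5]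
  apply := by
    classical
    rintro M e K I x y h hx hy hk ⟨hk0, t, a₀, u₁, w₁, u₂, w₂, u₃, w₃, hn, hxA, hyA, hxy⟩
    have hne : x ≠ y := by
      rintro rfl
      exact hyA (hn.subset₂₃ (hn.subset₁₂ hxA))
    refine ⟨⟨I.N, I.k - 1, editBy I.G {s(x, y)}⟩, h.N, ?_, ?_,
      hn.cographEditable_flip_iff hk0 hxA hyA hxy, Nat.sub_le _ _, ?_⟩
    · simp [nestedRule, h.k]
    · intro i j
      set e' := Function.update (Function.update e 6 i) 7 j with he'
      have h' : Rep M e' K I := (h.update (by norm_num) _).update (by norm_num) _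
      have e4 : e' 4 = x := by simp [he', hx]
      have e5 : e' 5 = y := by simp [he', hy]
      have e6 : e' 6 = i := by simp [he']
      have e7 : e' 7 = j := by simp [he']
      refine eval_ind_of_iff ?_
      rw [holds_iff, holds_not, holds_or, holds_and, holds_and, holds_eq, holds_eq, holds_eq,
        holds_eq, h'.holds_adj e6 e7, editBy_adj, Finset.mem_singleton, Sym2.eq_iff]
      simp only [eval_var, e4, e5, e6, e7, ← Fin.ext_iff]
      constructor
      · refine fun h => ⟨by tauto, fun hij => ?_⟩
        rw [← hij] at h
        have : ¬ ((i = x ∧ i = y) ∨ (i = y ∧ i = x)) := by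
          rintro (⟨h1, h2⟩ | ⟨h1, h2⟩)
          · exact hne (h1.symm.trans h2)
          · exact hne (h2.symm.trans h1)
        exact I.G.loopless.irrefl i (h.2 this)
      · exact fun h => by tauto
    · have h1 : {p : Fin I.N × Fin I.N | (editBy I.G {s(x, y)}).Adj p.1 p.2}.ncard ≤
          {p : Fin I.N × Fin I.N | I.G.Adj p.1 p.2}.ncard + 2 := by
        refine le_trans (Set.ncard_le_ncard (t := {p : Fin I.N × Fin I.N | I.G.Adj p.1 p.2} ∪
          {(x, y), (y, x)}) ?_) ((Set.ncard_union_le _ _).trans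
            (Nat.add_le_add_left (Set.ncard_pair (by simp [hne])).le _))
        rintro ⟨p, q⟩ hp
        rw [Set.mem_ofPred_eq, editBy_adj, Finset.mem_singleton, Sym2.eq_iff] at hp
        simp only [Set.mem_union, Set.mem_ofPred_eq, Set.mem_insert_iff, Prod.mk.injEq,
          Set.mem_singleton_iff]
        tauto
      have h2 := Nat.mul_lt_mul_of_pos_left (show
        {p : Fin I.N × Fin I.N | (editBy I.G {s(x, y)}).Adj p.1 p.2}.ncard + 3 * (I.k - 1) <
          {p : Fin I.N × Fin I.N | I.G.Adj p.1 p.2}.ncard + 3 * I.k by omega)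
        (show 0 < K + 2 by omega)
      simp only [Inst.potential]
      omega

theorem extractRule_valid : extractRule.Valid ExtractRuleApplies where
  ok := by
    simp [extractRule, Expr.Ok, Expr.mem_nbrDiff, Expr.all, Expr.not, Expr.iff,
      Expr.ind, Expr.and, Expr.or, Expr.isModule, Expr.count, Expr.card]
  holds_iff := by
    intro M e K I x y h hx hy
    have d := h.defines_nbrDiff hx hy (by norm_num) (by norm_num)
    rw [extractRule, holds_and, h.holds_isModule d, holds_lt, h.eval_card d, eval_add, eval_var,
      h.k, eval_const, ExtractRuleApplies]
  apply := by
    classical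
    rintro M e K I x y h hx hy hk ⟨hm, hc⟩
    set A := nbrDiff I.G x y with hA
    have hxA : x ∉ A := notMem_nbrDiff_left x y
    -- the new vertices correspond to distinct vertices of the module other than `a₀`
    obtain ⟨a₀, ha₀⟩ : A.Nonempty := Set.nonempty_of_ncard_ne_zero (by omega)
    have hcard : Fintype.card (Fin (I.k + 1)) ≤ Fintype.card (A \ {a₀} : Set (Fin I.N)) := by
      rw [Fintype.card_fin, ← Nat.card_eq_fintype_card, Nat.card_coe_set_eq,
        Set.ncard_sdiff_singleton_of_mem ha₀]
      omega
    obtain ⟨g⟩ := Function.Embedding.nonempty_of_card_le hcard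
    have hgA : ∀ r, (g r : Fin I.N) ∈ A := fun r => (g r).2.1
    let ψ : Fin (I.N + (I.k + 1)) → Fin I.N := Fin.addCases id fun r => g r
    have ψl : ∀ i, ψ (Fin.castAdd _ i) = i := fun i => by simp [ψ]
    have ψr : ∀ r, ψ (Fin.natAdd _ r) = g r := fun r => by simp [ψ]
    -- New vertices count as lying outside the module although `ψ` maps them into it. Hence they
    -- inherit only its adjacencies to the outside.
    let G' : SimpleGraph (Fin (I.N + (I.k + 1))) :=
      { Adj := fun p q => I.G.Adj (ψ p) (ψ q) ∧
          (((p : ℕ) < I.N ∧ ψ p ∈ A) ↔ ((q : ℕ) < I.N ∧ ψ q ∈ A)) ∧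
          ((p : ℕ) < I.N ∨ (q : ℕ) < I.N)
        symm := ⟨fun p q h => ⟨h.1.symm, h.2.1.symm, h.2.2.symm⟩⟩
        loopless := ⟨fun p h => I.G.loopless.irrefl _ h.1⟩ }
    have hll : ∀ a b, G'.Adj (Fin.castAdd _ a) (Fin.castAdd _ b) ↔
        I.G.Adj a b ∧ (a ∈ A ↔ b ∈ A) := by
      intro a b
      simp [G', ψl]
    have hrl : ∀ r b, G'.Adj (Fin.natAdd _ r) (Fin.castAdd _ b) ↔ b ∉ A ∧ I.G.Adj a₀ b := by
      intro r b
      simp only [G', ψl, ψr, Fin.val_natAdd, Fin.val_castAdd, b.2, true_and, or_true, and_true,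
        show ¬ (I.N + (r : ℕ) < I.N) by omega, false_and, false_iff]
      rw [and_comm]
      exact and_congr_right fun hb => hm _ (hgA r) _ ha₀ _ hb
    have hrr : ∀ r s, ¬ G'.Adj (Fin.natAdd _ r) (Fin.natAdd _ s) := by
      rintro r s ⟨-, -, h1 | h1⟩ <;> simp at h1
    have hrange : ∀ p, p ∉ Set.range (Fin.castAdd (n := I.N) (I.k + 1)) →
        ∃ r, p = Fin.natAdd _ r := by
      intro p
      refine Fin.addCases (fun i hi => absurd ⟨i, rfl⟩ hi) (fun r _ => ⟨r, rfl⟩) p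
    have hex : ∀ b, (∃ v : Fin I.N, v ∈ A ∧ I.G.Adj v b) ∧ b ∉ A ↔ b ∉ A ∧ I.G.Adj a₀ b := by
      intro b
      constructor
      · rintro ⟨⟨v, hv, hvb⟩, hb⟩
        exact ⟨hb, (hm v hv a₀ ha₀ b hb).1 hvb⟩
      · rintro ⟨hb, hab⟩
        exact ⟨⟨a₀, ha₀, hab⟩, hb⟩
    refine ⟨⟨I.N + (I.k + 1), I.k, G'⟩, ?_, h.k, ?_, ?_, le_rfl, ?_⟩
    · simp [extractRule, h.N, h.k]
    · intro i j
      change Fin (I.N + (I.k + 1)) at i j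
      set e' := Function.update (Function.update e 6 i) 7 j with he'
      have h' : Rep M e' K I := (h.update (by norm_num) _).update (by norm_num) _
      have e4 : e' 4 = x := by simp [he', hx]
      have e5 : e' 5 = y := by simp [he', hy]
      have e6 : e' 6 = i := by simp [he']
      have e7 : e' 7 = j := by simp [he']
      have d := h'.defines_nbrDiff e4 e5 (by norm_num) (by norm_num)
      have hsum : ∀ (r : ℕ) (b : Fin I.N), r < 30 → e' r = b →
          (Holds M (.sum 30 (.and (.mem_nbrDiff 4 5 30) (.adj (.var 30) (.var r)))) e' ↔
            ∃ v : Fin I.N, v ∈ A ∧ I.G.Adj v b) := by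
        intro r b hr hb
        rw [holds_sum h'.N]
        refine exists_congr fun v => ?_
        rw [holds_and, d.holds_update (by norm_num) (by norm_num),
          h.holds_adj (a := v) (b := b) (by simp) (by rw [Function.update_of_ne (by omega), hb])]
      have hite : ∀ c a b : Expr, Holds M (.ite c a b) e' ↔
          if Holds M c e' then Holds M a e' else Holds M b e' := by
        intro c a b
        unfold Holds
        rw [Expr.eval]
        split_ifs <;> rfl
      have e0 : e' 0 = I.N := h'.N
      refine eval_ind_of_iff ?_
      rw [hite, hite]
      simp only [holds_and, holds_not, holds_iff, holds_lt, eval_var, e0, e6, e7]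
      revert e6 e7
      clear_value e'
      refine Fin.addCases (fun a => ?_) (fun r => ?_) i <;>
        refine Fin.addCases (fun b => ?_) (fun s => ?_) j <;> intro e6 e7
      · rw [Fin.val_castAdd] at e6 e7
        rw [hll, Fin.val_castAdd, Fin.val_castAdd, if_pos a.2, if_pos b.2, h'.holds_adj e6 e7,
          d e' (Agree.refl _) 6 (by norm_num) a e6, d e' (Agree.refl _) 7 (by norm_num) b e7]
      · rw [Fin.val_castAdd] at e6
        rw [SimpleGraph.adj_comm, hrl, Fin.val_castAdd, Fin.val_natAdd, if_pos a.2,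
          if_neg (by omega), hsum 6 a (by norm_num) e6,
          d e' (Agree.refl _) 6 (by norm_num) a e6, ← hex, and_comm]
      · rw [Fin.val_castAdd] at e7
        rw [hrl, Fin.val_castAdd, Fin.val_natAdd, if_neg (by omega), hsum 7 b (by norm_num) e7,
          d e' (Agree.refl _) 7 (by norm_num) b e7, ← hex]
        have := b.2
        tauto
      · rw [Fin.val_natAdd, Fin.val_natAdd, if_neg (by omega), iff_false_right (hrr r s)]
        rintro ⟨h1, -⟩
        omega
    · refine cographEditable_extract_iff (φ := Fin.castAdd (I.k + 1)) (A := A) (a₀ := a₀)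
        (Fin.castAdd_injective _ _) hm ha₀ (by omega) ?_ hll ?_ ?_
      · rw [Set.ncard_compl, Set.ncard_range_of_injective (Fin.castAdd_injective _ _)]
        simp
      · intro p hp b
        obtain ⟨r, rfl⟩ := hrange p hp
        exact hrl r b
      · intro p hp q hq
        obtain ⟨r, rfl⟩ := hrange p hp
        obtain ⟨s, rfl⟩ := hrange q hq
        exact hrr r s
    · have h1 : {p : Fin (I.N + (I.k + 1)) × Fin (I.N + (I.k + 1)) | G'.Adj p.1 p.2}.ncard <
          {p : Fin I.N × Fin I.N | I.G.Adj p.1 p.2}.ncard := by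
        have hnew : ∀ p : Fin (I.N + (I.k + 1)), ¬ (p : ℕ) < I.N → ∃ r, p = Fin.natAdd _ r := by
          intro p hp
          refine hrange p ?_
          rintro ⟨a, rfl⟩
          exact hp a.2
        -- `ψ` maps the adjacencies of `G'` injectively to those of `G`: an old vertex of the module
        -- keeps only neighbours in the module, while a new vertex has only old neighbours outside
        -- it.
        have hold : ∀ p q p' q', G'.Adj p q → G'.Adj p' q' → ψ p = ψ p' → ψ q = ψ q' →
            (p' : ℕ) < I.N → (p : ℕ) < I.N := by
          rintro p q p' q' ⟨-, h1, h2⟩ ⟨-, h3, -⟩ hp hq hp'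
          by_contra hpN
          obtain ⟨r, rfl⟩ := hnew p hpN
          have h4 := hgA r
          rw [← ψr, hp] at h4
          have h5 := (h3.1 ⟨hp', h4⟩).2
          rw [← hq] at h5
          exact hpN (h1.2 ⟨h2.resolve_left hpN, h5⟩).1
        have hfst : ∀ p q p' q', G'.Adj p q → G'.Adj p' q' → ψ p = ψ p' → ψ q = ψ q' →
            p = p' := by
          intro p q p' q' h1 h2 hp hq
          by_cases hpN : (p : ℕ) < I.N
          · have hpN' := hold p' q' p q h2 h1 hp.symm hq.symm hpN
            obtain ⟨a, rfl⟩ : ∃ a, p = Fin.castAdd (I.k + 1) a := ⟨⟨p, hpN⟩, rfl⟩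
            obtain ⟨b, rfl⟩ : ∃ b, p' = Fin.castAdd (I.k + 1) b := ⟨⟨p', hpN'⟩, rfl⟩
            rw [ψl, ψl] at hp
            rw [hp]
          · have hpN' : ¬ (p' : ℕ) < I.N := fun h' => hpN (hold p q p' q' h1 h2 hp hq h')
            obtain ⟨r, rfl⟩ := hnew p hpN
            obtain ⟨s, rfl⟩ := hnew p' hpN'
            rw [ψr, ψr] at hp
            rw [g.injective (Subtype.ext hp)]
        have hinj : Set.InjOn (Prod.map ψ ψ) {p | G'.Adj p.1 p.2} := by
          rintro ⟨p, q⟩ hpq ⟨p', q'⟩ hpq' heq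
          obtain ⟨h1, h2⟩ := Prod.mk.inj heq
          rw [hfst p q p' q' hpq hpq' h1 h2, hfst q p q' p' hpq.symm hpq'.symm h2 h1]
        rw [← hinj.ncard_image]
        refine Set.ncard_lt_ncard ⟨?_, fun hsub => ?_⟩
        · rintro _ ⟨p, hp, rfl⟩
          exact hp.1
        -- The adjacency of `a₀` and `x` is lost: the old `a₀` is cut off from `x ∉ A`, and no new
        -- vertex stands for `a₀`.
        · obtain ⟨⟨p, q⟩, hpq, heq⟩ := @hsub (a₀, x) ha₀.1.symm
          obtain ⟨h1, h2⟩ := Prod.mk.inj heq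
          by_cases hpN : (p : ℕ) < I.N
          · have h3 := (hpq.2.1.1 ⟨hpN, h1.symm ▸ ha₀⟩).2
            exact hxA (h2 ▸ h3)
          · obtain ⟨r, rfl⟩ := hnew p hpN
            exact (g r).2.2 ((ψr r).symm.trans h1)
      have h2 := Nat.mul_le_mul_left (K + 2) (show
        {p : Fin (I.N + (I.k + 1)) × Fin (I.N + (I.k + 1)) | G'.Adj p.1 p.2}.ncard + 3 * I.k + 1 ≤
          {p : Fin I.N × Fin I.N | I.G.Adj p.1 p.2}.ncard + 3 * I.k by omega)
      rw [mul_add (K + 2) _ 1] at h2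
      simp only [Inst.potential]
      omega

/-! ### The main loop -/

/-- No rule applies to `I`. -/
def Irreducible (I : Inst) : Prop :=
  (∀ x y, ¬ TwinRuleApplies I x y) ∧ (∀ x y, ¬ TwinModule I.G x y) ∧
    (∀ x y, ¬ ExtractRuleApplies I x y) ∧ ∀ x y, ¬ NestedRuleApplies I x y

/-- Try each rule once. -/
def passProg : RAM.Prog :=
  .seq (.const 3 0) (.seq twinRule.step (.seq bipartiteRule.step
    (.seq extractRule.step nestedRule.step)))

/-- A bound on the running time of `passProg`. -/
noncomputable def passCost : Polynomial ℕ :=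
  twinRule.stepCost + bipartiteRule.stepCost + extractRule.stepCost + nestedRule.stepCost + 1

theorem terminates_passProg {K B : ℕ} {I : Inst} (hk : I.k ≤ K) (hB : I.potential K ≤ B)
    {σ : RAM.Store} (h10 : σ.reg 10 = 0) (hσ : Rep (σ.arr 0) σ.reg K I) :
    Terminates passProg σ (passCost.eval B) (PassState K I (Irreducible I)) := by
  refine Terminates.mono (t := 1 + (twinRule.stepCost.eval B + (bipartiteRule.stepCost.eval B +
    (extractRule.stepCost.eval B + nestedRule.stepCost.eval B)))) ?_
    (by simp only [passCost, Polynomial.eval_add, Polynomial.eval_one]; omega) (fun _ h => h)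
  refine (terminates_const (Q := PassState K I True)
    ⟨by simp [h10], Or.inl ⟨by simp, hσ.congr rfl ?_ ?_ ?_, trivial⟩⟩).seq fun τ h1 => ?_
  · simp
  · simp
  · simp
  refine (twinRule_valid.terminates_step hk hB h1).seq fun τ h2 => ?_
  refine (bipartiteRule_valid.terminates_step hk hB h2).seq fun τ h3 => ?_
  refine (extractRule_valid.terminates_step hk hB h3).seq fun τ h4 => ?_
  refine (nestedRule_valid.terminates_step hk hB h4).mono le_rfl ?_
  rintro υ ⟨h5, ⟨h6, h7, ⟨⟨⟨-, a⟩, b⟩, c⟩, d⟩ | h⟩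
  · exact ⟨h5, Or.inl ⟨h6, h7, a, b, c, d⟩⟩
  · exact ⟨h5, Or.inr h⟩

/-- Apply the rules as long as possible. -/
def reduceProg : RAM.Prog := .seq (.const 10 0) (.seq (.const 3 1) (.while 10 3 passProg))

theorem terminates_reduceProg {K B : ℕ} {I : Inst} (hk : I.k ≤ K) (hB : I.potential K ≤ B)
    {σ : RAM.Store} (hσ : Rep (σ.arr 0) σ.reg K I) :
    Terminates reduceProg σ ((B + 1) * (passCost.eval B + 1) + 3) (fun τ => ∃ I' : Inst,
      Rep (τ.arr 0) τ.reg K I' ∧ (I.Positive ↔ I'.Positive) ∧ I'.k ≤ K ∧ I'.N ≤ B ∧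
      Irreducible I') := by
  let J : ℕ → RAM.Store → Prop := fun n τ => τ.reg 10 = 0 ∧ ∃ I' : Inst,
    Rep (τ.arr 0) τ.reg K I' ∧ (I.Positive ↔ I'.Positive) ∧ I'.k ≤ K ∧ I'.potential K = n ∧
    n ≤ B ∧ (τ.reg 3 = 0 → Irreducible I')
  refine Terminates.mono (t := 1 + (1 + ((I.potential K + 1) * (passCost.eval B + 1) + 1))) ?_ ?_
    (fun _ h => h)
  swap
  · have := Nat.mul_le_mul_right (passCost.eval B + 1) (Nat.add_le_add_right hB 1)
    omega
  refine (terminates_const (Q := fun τ => τ = σ.setReg 10 0) rfl).seq ?_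
  rintro _ rfl
  refine (terminates_const (σ := σ.setReg 10 0) (Q := J (I.potential K)) ⟨?_, I,
    hσ.congr rfl ?_ ?_ ?_, Iff.rfl, hk, rfl, hB, ?_⟩).seq fun τ hτ => ?_
  · simp
  · simp
  · simp
  · simp
  · simp
  refine (terminates_while_potential J ?_ _ τ hτ).mono le_rfl ?_
  · rintro n υ ⟨h10, I₁, hrep, hpos, hk₁, hn, hnB, -⟩ -
    refine (terminates_passProg hk₁ (hn.trans_le hnB) h10 hrep).mono le_rfl ?_
    rintro ω ⟨h10', ⟨h3, hrep', hirr⟩ | ⟨h3, I₂, hrep', hpos', hk₂, hpot⟩⟩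
    -- A pass in which no rule is applied leaves register `3` at zero. The loop then stops, and no
    -- decrease of the potential is required.
    · exact ⟨n, ⟨h10', I₁, hrep', hpos, hk₁, hn, hnB, fun _ => hirr⟩, by omega⟩
    · exact ⟨I₂.potential K, ⟨h10', I₂, hrep', hpos.trans hpos', hk₂.trans hk₁, rfl,
        (hpot.trans_eq hn).le.trans hnB, by omega⟩, fun _ => hn ▸ hpot⟩
  · rintro υ ⟨⟨n, h10, I₁, hrep, hpos, hk₁, hn, hnB, hirr⟩, hlt⟩
    exact ⟨I₁, hrep, hpos, hk₁, (I₁.N_le_potential K).trans (hn.trans_le hnB), hirr (by omega)⟩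

/-! ### Padding the reduced instance -/

namespace Expr

/-- The product of two numbers, the first at most the number of vertices. -/
def mul (x : ℕ) (a b : Expr) : Expr := sum x (ite (lt (var x) a) b (const 0))

/-- The value of `divisorSum` at the parameter. -/
def divisorSum : Expr :=
  sum 30 (sum 31 (ind (le (mul 32 (add (var 30) (const 1)) (add (var 31) (const 1))) (var 1))))

/-- The value of `kernelBound` at the parameter. -/
def kernelBound : Expr :=
  mul 33 (add (var 1) (const 1))
    (add (add (smul 32 divisorSum) (smul 48 (var 1))) (const 1))

/-- The instance has too many vertices for a positive one. -/
def tooLarge : Expr := and (lt (var 1) (var 0)) (lt kernelBound (var 0))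

/-- The number of vertices that are kept. -/
def kept : Expr := ite tooLarge (const 0) (var 0)

/-- The number of paths that are added. -/
def padding : Expr := ite tooLarge (add (var 2) (const 1)) (sub (var 2) (var 1))

/-- The adjacency matrix of the output. -/
def padMatrix : Expr :=
  ind (or (and (and (lt (var 6) kept) (lt (var 7) kept)) (adj (var 6) (var 7)))
    (or (and (le kept (var 6)) (eq (var 7) (add (var 6) padding)))
      (and (le kept (var 7)) (eq (var 6) (add (var 7) padding)))))

theorem eval_mul {M : ℕ → ℕ → ℕ} {e : ℕ → ℕ} {x m : ℕ} {a b : Expr}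
    (ha : ∀ v, a.eval M (Function.update e x v) = m)
    (hb : ∀ v, b.eval M (Function.update e x v) = b.eval M e) (hm : m ≤ e 0) :
    (mul x a b).eval M e = m * b.eval M e := by
  rw [mul, eval]
  have h : ∀ v, (ite (lt (var x) a) b (const 0)).eval M (Function.update e x v) =
      if v < m then b.eval M e else 0 := by
    intro v
    rw [eval, hb]
    refine if_congr (holds_lt.trans ?_) rfl rfl
    simp [ha]
  simp only [h]
  rw [← Finset.sum_filter, Finset.sum_const, smul_eq_mul]
  congr 1
  rw [show {v ∈ Finset.range (e 0) | v < m} = Finset.range m by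
    ext v; simp only [Finset.mem_filter, Finset.mem_range]; omega]
  simp

/-- The double sum counts the pairs with `(a + 1) * (b + 1) ≤ k`. Both entries are below `k`, so a
range up to the number of vertices misses none. -/
theorem eval_divisorSum {M : ℕ → ℕ → ℕ} {e : ℕ → ℕ} (h : e 1 ≤ e 0) :
    divisorSum.eval M e = CographKernel.divisorSum (e 1) := by
  classical
  rw [CographKernel.divisorSum, Finset.sum_subset (Finset.range_subset_range.2 h)]
  swap
  · intro a _ ha
    rw [Finset.mem_range] at ha
    exact Nat.div_eq_of_lt (by omega)
  · rw [divisorSum, eval]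
    refine Finset.sum_congr rfl fun a ha => ?_
    rw [Finset.mem_range] at ha
    have hmul : ∀ b, (mul 32 (add (var 30) (const 1)) (add (var 31) (const 1))).eval M
        (Function.update (Function.update e 30 a) 31 b) = (a + 1) * (b + 1) := by
      intro b
      rw [eval_mul (m := a + 1)] <;> simp [ha]
    have hind : ∀ b, (ind (le (mul 32 (add (var 30) (const 1)) (add (var 31) (const 1)))
        (var 1))).eval M (Function.update (Function.update e 30 a) 31 b) =
        if b < e 1 / (a + 1) then 1 else 0 := by
      intro b
      refine eval_ind_of_iff ?_
      rw [holds_le, hmul, Nat.lt_iff_add_one_le, Nat.le_div_iff_mul_le (Nat.succ_pos a),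
        mul_comm (b + 1)]
      simp
    rw [eval]
    simp only [hind]
    rw [Finset.sum_boole, Function.update_of_ne (by norm_num),
      show {b ∈ Finset.range (e 0) | b < e 1 / (a + 1)} = Finset.range (e 1 / (a + 1)) by
        ext b
        have := Nat.div_le_self (e 1) (a + 1)
        simp only [Finset.mem_filter, Finset.mem_range]
        omega]
    simp

theorem eval_kernelBound {M : ℕ → ℕ → ℕ} {e : ℕ → ℕ} (h : e 1 < e 0) :
    kernelBound.eval M e = CographKernel.kernelBound (e 1) := by
  have hc : ∀ v, divisorSum.eval M (Function.update e 33 v) = CographKernel.divisorSum (e 1) := by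
    intro v
    rw [eval_divisorSum] <;> simp [h.le]
  rw [kernelBound, eval_mul (m := e 1 + 1) (by simp) (fun v => ?_) h, CographKernel.kernelBound]
  · simp [eval_divisorSum h.le]
  · simp [hc, eval_divisorSum h.le]

theorem ok_tooLarge : tooLarge.Ok := by
  simp [tooLarge, kernelBound, divisorSum, mul, Ok, smul, and, ind, le, not]

theorem ok_kept : kept.Ok := by simp [kept, Ok, ok_tooLarge]

theorem ok_padding : padding.Ok := by simp [padding, Ok, ok_tooLarge]

theorem ok_padMatrix : padMatrix.Ok := by
  simp [padMatrix, Ok, ok_kept, ok_padding, ind, or, and, le, not, eq]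

end Expr

/-- Replace the reduced instance by an instance with the original parameter in register `2`. -/
def padProg : RAM.Prog :=
  updateProg (.add .kept (.smul 4 .padding)) (.var 2) .padMatrix

/-- A bound on the running time of `padProg`. -/
noncomputable def padCost : Polynomial ℕ :=
  updateCost (.add .kept (.smul 4 .padding)) (.var 2) .padMatrix

open Classical in
-- An irreducible instance with more than `kernelBound` vertices is negative. Otherwise each added
-- path uses up exactly one of the edits by which `K` exceeds the current parameter.
theorem terminates_padProg {K B : ℕ} {I : Inst} {σ : RAM.Store} (hσ : Rep (σ.arr 0) σ.reg K I)
    (hk : I.k ≤ K) (hB : I.N + 4 * (K + 1) ≤ B) (hI : Irreducible I) :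
    Terminates padProg σ (padCost.eval B) (fun τ => ∃ (m : ℕ) (G' : SimpleGraph (Fin m)),
      RAM.IsOutput τ G' K ∧ m ≤ kernelSize K ∧ (I.Positive ↔ CographEditable G' K)) := by
  have hsmall : I.Positive → I.N ≤ kernelBound I.k := fun h =>
    card_le_kernelBound_of_irreducible I h hI.1 hI.2.1 hI.2.2.1 hI.2.2.2
  have hle : I.k + 1 ≤ kernelBound I.k := by
    unfold kernelBound
    exact Nat.le_mul_of_pos_right _ (by omega)
  have hmono := kernelBound_mono hk
  -- `N` vertices are kept, and `D` paths are added
  obtain ⟨N, D, hN, hND, hkept, hpad, hsize, hiff⟩ : ∃ (N D : ℕ) (hN : N ≤ I.N),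
      N + 4 * D ≤ B ∧
      (∀ e, (∀ r < 6, e r = σ.reg r) → Expr.kept.eval (σ.arr 0) e = N) ∧
      (∀ e, (∀ r < 6, e r = σ.reg r) → Expr.padding.eval (σ.arr 0) e = D) ∧
      N + 4 * D ≤ kernelSize K ∧ (I.Positive ↔
        (D ≤ K ∧ CographEditable (I.G.comap (Fin.castLE hN)) (K - D))) := by
    -- `kernelBound` is evaluated correctly only if `k < N`, because sums run up to `N`. Nothing is
    -- lost by testing this as well, since `kernelBound` is at least `k + 1`.
    have htl : ∀ e, (∀ r < 6, e r = σ.reg r) → (Holds (σ.arr 0) .tooLarge e ↔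
        kernelBound I.k < I.N) := by
      intro e he
      have e0 : e 0 = I.N := (he 0 (by norm_num)).trans hσ.N
      have e1 : e 1 = I.k := (he 1 (by norm_num)).trans hσ.k
      rw [Expr.tooLarge, holds_and, holds_lt, holds_lt, eval_var, eval_var, e0, e1]
      constructor
      · rintro ⟨h1, h2⟩
        rwa [Expr.eval_kernelBound (by omega), e1] at h2
      · intro h1
        rw [Expr.eval_kernelBound (by omega), e1]
        exact ⟨by omega, h1⟩
    by_cases hlarge : kernelBound I.k < I.N
    -- `K + 1` disjoint paths cannot be repaired by `K` edits.
    · refine ⟨0, K + 1, Nat.zero_le _, by omega, fun e he => ?_, fun e he => ?_, ?_, ?_⟩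
      · rw [Expr.kept, Expr.eval]
        exact if_pos ((htl e he).2 hlarge)
      · rw [Expr.padding, Expr.eval]
        refine (if_pos ((htl e he).2 hlarge)).trans ?_
        simp [he 2 (by norm_num), hσ.K]
      · unfold kernelSize
        omega
      · exact ⟨fun h => absurd (hsmall h) (not_le.2 hlarge), fun h => absurd h.1 (by omega)⟩
    · refine ⟨I.N, K - I.k, le_rfl, by omega, fun e he => ?_, fun e he => ?_, ?_, ?_⟩
      · rw [Expr.kept, Expr.eval]
        exact (if_neg (fun h => hlarge ((htl e he).1 h))).trans
          ((he 0 (by norm_num)).trans hσ.N)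
      · rw [Expr.padding, Expr.eval]
        refine (if_neg (fun h => hlarge ((htl e he).1 h))).trans ?_
        simp [he 1 (by norm_num), he 2 (by norm_num), hσ.K, hσ.k]
      · unfold kernelSize
        omega
      · have h1 : I.G.comap (Fin.castLE le_rfl) = I.G := by
          ext a b; rfl
        rw [h1, Nat.sub_sub_self hk]
        exact ⟨fun h => ⟨Nat.sub_le _ _, h⟩, fun h => h.2⟩
  have hν : (Expr.add .kept (.smul 4 .padding)).eval (σ.arr 0) σ.reg = N + 4 * D := by
    simp [hkept σ.reg (fun _ _ => rfl), hpad σ.reg (fun _ _ => rfl)]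
  let G' : SimpleGraph (Fin (N + 4 * D)) :=
    { Adj := fun i j => (∃ (hi : (i : ℕ) < N) (hj : (j : ℕ) < N),
          (I.G.comap (Fin.castLE hN)).Adj ⟨i, hi⟩ ⟨j, hj⟩) ∨
        (N ≤ i ∧ (j : ℕ) = i + D) ∨ (N ≤ j ∧ (i : ℕ) = j + D)
      symm := ⟨by
        rintro i j (⟨hi, hj, h⟩ | h | h)
        · exact Or.inl ⟨hj, hi, h.symm⟩
        · exact Or.inr (Or.inr h)
        · exact Or.inr (Or.inl h)⟩
      loopless := ⟨by
        rintro i (⟨hi, hj, h⟩ | h | h)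
        · exact (I.G.comap _).loopless.irrefl _ h
        · have := i.2; omega
        · have := i.2; omega⟩ }
  refine (terminates_updateProg (ν := .add .kept (.smul 4 .padding)) (κ := .var 2)
    (μ := .padMatrix) (B := B) ?_ ?_ Expr.ok_padMatrix ?_ ?_).mono le_rfl ?_
  · simp [Expr.Ok, Expr.smul, Expr.ok_kept, Expr.ok_padding]
  · simp [Expr.Ok]
  · rw [hσ.N]; omega
  · rw [hν]; exact hND
  · rintro τ ⟨h0, h1, -, hM⟩
    rw [hν] at h0 hM
    refine ⟨N + 4 * D, G', ⟨h0, h1.trans hσ.K, fun i j => ?_⟩, hsize, hiff.trans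
      (cographEditable_pad_iff fun i j => Iff.rfl).symm⟩
    rw [hM i i.2 j j.2]
    set e' := Function.update (Function.update σ.reg 6 i) 7 j with he'
    have hagree : ∀ r < 6, e' r = σ.reg r := by
      intro r hr
      rw [he', Function.update_of_ne (by omega), Function.update_of_ne (by omega)]
    have e6 : e' 6 = i := by simp [he']
    have e7 : e' 7 = j := by simp [he']
    refine eval_ind_of_iff ?_
    simp only [holds_or, holds_and, holds_lt, holds_le, holds_eq, eval_add, eval_var, e6, e7,
      hkept e' hagree, hpad e' hagree]
    refine or_congr ?_ Iff.rfl
    constructor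
    · rintro ⟨⟨hi, hj⟩, h⟩
      refine ⟨hi, hj, ?_⟩
      rw [holds_adj, eval_var, eval_var, e6, e7] at h
      exact (hσ.pos_iff (Fin.castLE hN ⟨i, hi⟩) (Fin.castLE hN ⟨j, hj⟩)).1 h
    · rintro ⟨hi, hj, h⟩
      refine ⟨⟨hi, hj⟩, ?_⟩
      rw [holds_adj, eval_var, eval_var, e6, e7]
      exact (hσ.pos_iff (Fin.castLE hN ⟨i, hi⟩) (Fin.castLE hN ⟨j, hj⟩)).2 h

/-! ### The kernel -/

/-- The kernelization algorithm. -/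
def kernelProg : RAM.Prog :=
  .seq (.const 61 0) (.seq (.add 2 1 61) (.ite 1 0 (.seq reduceProg padProg) .skip))

/-- A bound on the potential of an instance in terms of the number of vertices. -/
noncomputable def potentialBound : Polynomial ℕ :=
  Polynomial.X + (Polynomial.X + 2) * (Polynomial.X * Polynomial.X + 3 * Polynomial.X)

theorem potential_le {n k : ℕ} (G : SimpleGraph (Fin n)) (hk : k ≤ n) :
    Inst.potential k ⟨n, k, G⟩ ≤ potentialBound.eval n := by
  have h1 : {p : Fin n × Fin n | G.Adj p.1 p.2}.ncard ≤ n * n := by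
    refine (Set.ncard_le_ncard (Set.subset_univ _)).trans ?_
    simp [Set.ncard_univ]
  simp only [Inst.potential, potentialBound, Polynomial.eval_add, Polynomial.eval_mul,
    Polynomial.eval_X, Polynomial.eval_ofNat]
  gcongr

/-- If `k ≥ n`, the input is small enough to be its own kernel. Otherwise `k < n`, which makes the
initial potential, and with it the number of passes and all sizes, polynomial in `n` alone. -/
theorem hasCographEditingKernel_kernelSize : HasCographEditingKernel kernelSize := by
  classical
  refine ⟨kernelProg, (potentialBound + 1) * (passCost.comp potentialBound + 1) +
    padCost.comp (potentialBound + 4 * Polynomial.X) + 7, fun n G k => ?_⟩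
  set B := potentialBound.eval n with hB
  have hterm : Terminates kernelProg (RAM.inputStore G k) (1 + (1 + ((((B + 1) *
      (passCost.eval B + 1) + 3) + padCost.eval (B + 4 * n)) + 1))) (fun τ => ∃ (m : ℕ)
        (G' : SimpleGraph (Fin m)), RAM.IsOutput τ G' k ∧ m ≤ kernelSize k ∧
        (CographEditable G k ↔ CographEditable G' k)) := by
    refine (terminates_const (Q := fun τ => τ = (RAM.inputStore G k).setReg 61 0) rfl).seq ?_
    rintro _ rfl
    refine (terminates_add (Q := fun τ => τ.reg 0 = n ∧ τ.reg 1 = k ∧ τ.reg 2 = k ∧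
      τ.arr = (RAM.inputStore G k).arr) ?_).seq ?_
    · simp [RAM.inputStore]
    rintro τ ⟨h0, h1, h2, harr⟩
    have hadj : ∀ i j : Fin n, τ.arr 0 i j = if G.Adj i j then 1 else 0 := by
      intro i j
      rw [harr]
      simp [RAM.inputStore]
    refine terminates_ite (fun h => ?_) fun h => ?_
    · have hkn : k < n := by rwa [h0, h1] at h
      have hrep : Rep (τ.arr 0) τ.reg k ⟨n, k, G⟩ := ⟨h0, h1, h2, hadj⟩
      refine (terminates_reduceProg le_rfl (potential_le G hkn.le) hrep).seq ?_
      rintro υ ⟨I, hI, hpos, hk, hN, hirr⟩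
      refine (terminates_padProg hI hk (Nat.add_le_add hN (Nat.mul_le_mul_left 4 hkn)) hirr).mono le_rfl ?_
      rintro ω ⟨m, G', hout, hm, hiff⟩
      exact ⟨m, G', hout, hm, hpos.trans hiff⟩
    · rw [h0, h1, not_lt] at h
      refine Terminates.mono (t := 1) (terminates_skip ⟨n, G, ⟨h0, h1, hadj⟩, ?_, Iff.rfl⟩)
        (by omega) (fun _ h => h)
      unfold kernelSize
      omega
  obtain ⟨t, τ, hrun, ht, m, G', hout, hm, hiff⟩ := hterm
  refine ⟨t, τ, m, G', hrun, ht.trans ?_, hout, hm, hiff⟩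
  simp only [Polynomial.eval_add, Polynomial.eval_mul, Polynomial.eval_comp, Polynomial.eval_X,
    Polynomial.eval_ofNat, Polynomial.eval_one, ← hB]
  omega

end CographKernel

theorem mainTheorem1 :
    (∃ f : ℕ → ℕ,
      Asymptotics.IsBigO Filter.atTop (fun k : ℕ => (f k : ℝ))
        (fun k : ℕ => (k : ℝ) ^ 2 * Real.log (k : ℝ)) ∧
      (∀ k : ℕ, 1 ≤ k →
        (f k : ℝ) ≤ 409 * (k : ℝ) ^ 2 * (1 + Real.logb 2 (2 * (k : ℝ)))) ∧
      HasCographEditingKernel f) ∧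
    (∀ (V : Type*) [Fintype V] (G : SimpleGraph V) (k : ℕ),
      559 ≤ k → IsReducedInstance G k → CographEditable G k →
        (Fintype.card V : ℝ) ≤ 409 * (k : ℝ) ^ 2 * (1 + Real.logb 2 (2 * (k : ℝ)))) := by
  refine ⟨⟨CographKernel.kernelSize, CographKernel.kernelSize_isBigO,
    fun k hk => CographKernel.kernelSize_le hk,
    CographKernel.hasCographEditingKernel_kernelSize⟩, fun V _ G k hk hred hpos => ?_⟩
  refine le_trans ?_ (CographKernel.kernelSize_le (by omega))
  have h := CographKernel.card_le_kernelBound_of_isReducedInstance hred hpos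
  exact_mod_cast h.trans (Nat.le_add_right _ _)
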